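/- All objects are $C^\infty$; manifolds and vector bundles may be modelled on Banach spaces. Let $\pi:E\to M$ be a vector bundle and let $\mathrm{Hor}$ be an Ehresmann connection on $E$, that is, a smooth splitting $\xi:\pi^*TM\to TE$, linear in the tangent vector but not necessarily in the point of $E$, with $T\pi(\xi(a,v))=v$ and $\xi(a,v)\in T_aE$. Let $\pi^*E=\{(a,b)\in E\times E:\pi(a)=\pi(b)\}$ be the pullback bundle over $E$, with projection $(a,b)\mapsto a$, identify $T(\pi^*E)$ with $TE\times_{TM}TE$, and let $\xi^V(a,b)=\frac{d}{ds}(a+sb)|_{s=0}\in T_aE$ be the vertical lift. The linearization $\overline{\mathrm{Hor}}$ of $\mathrm{Hor}$ is the connection on $\pi^*E\to E$ whose horizontal lift of $w\in T_aE$ to $(a,b)$ is $(w,B(a,b)w)$, where $B(a,b)w\in T_bE$ is the derivative at $a$, in the direction $b$, of the map $c\mapsto\xi(c,T\pi(w))$ from the vector space $E_{\pi(a)}$ to the vector space $(T\pi)^{-1}(T\pi(w))$, a fibre of the vector bundle $T\pi:TE\to TM$. There is exactly one such connection. For an open set $U\subseteq M$, a vector field $Y$ on $\pi^{-1}(U)$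 is called $\mathrm{Hor}$-basic if it projects onto a vector field $X$ on $U$ and its vertical part is the vertical lift of a section $\eta$ of $E$ over $U$, i.e. $Y(a)=\xi(a,X(\pi(a)))+\xi^V(a,\eta(\pi(a)))$. A local flow of $Y$ is a smooth map $(s,a)\mapsto\phi_s(a)\in\pi^{-1}(U)$, defined on an open subset of $\mathbb R\times\pi^{-1}(U)$, such that for each $a$ the set $J_a$ of times at which $\phi_s(a)$ is defined is empty or an interval containing $0$, and $s\mapsto\phi_s(a)$ is an integral curve of $Y$ on $J_a$ with $\phi_0(a)=a$. The fibre derivative $\mathcal F\phi_s$ is the partially defined map $\pi^*E\to\pi^*E$ determined by $\xi^V\circ\mathcal F\phi_s=T\phi_s\circ\xi^V$. A connection $\mathrm{Hor}'$ on $\pi^*E$ (not assumed linear) is said to have the transport property over $U$ if, for every $\mathrm{Hor}$-basic vector field $Y$ on $\pi^{-1}(U)$, every local flow $\{\phi_s\}$ of $Y$, every $a$ with $J_a\neq\emptyset$ and every $b\in E_{\pi(a)}$, the curve $s\mapsto\mathcal F\phi_s(a,b)$, $s\in J_a$, is the (unique) $\mathrm{Hor}'$-horizontal lift of the flow line $s\mapsto\phi_s(a)$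 with value $(a,b)$ at $s=0$; that is, parallel transport along the flow line is given by $\mathcal F\phi_s$. **Theorem.** (1) The linearization $\overline{\mathrm{Hor}}$ has the transport property over every open set $U\subseteq M$, in particular over $U=M$. (2) Conversely, if a connection $\mathrm{Hor}'$ on $\pi^*E$ has the transport property over every open set $U\subseteq M$, then $\mathrm{Hor}'=\overline{\mathrm{Hor}}$. If every neighbourhood $W$ of every point $m\in M$ carries a smooth bump function (a smooth $f:M\to\mathbb R$ with $f(m)=1$ and closed support contained in $W$), as is the case when $M$ is finite dimensional and Hausdorff, then the transport property over $U=M$ alone, that is, for the globally defined $\mathrm{Hor}$-basic vector fields on $E$, already implies $\mathrm{Hor}'=\overline{\mathrm{Hor}}$. -/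

import Mathlib

open Set Function Bundle Manifold
open scoped Manifold ContDiff Topology Bundle

noncomputable section

/-! ### Smooth (Banach) manifolds: curves, flows, bump functions -/

section Manifolds

variable {A : Type*} [NormedAddCommGroup A] [NormedSpace ℝ A]
  {H : Type*} [TopologicalSpace H] (I : ModelWithCorners ℝ A H)
  {N : Type*} [TopologicalSpace N] [ChartedSpace H N]

/-- The velocity of a curve `γ` at time `t`, as a point of the tangent bundle over `γ t`. -/
def velocity (γ : ℝ → N) (t : ℝ) : TangentBundle I N :=
  tangentMap 𝓘(ℝ, ℝ) I γ ⟨t, (1 : ℝ)⟩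

/-- `Y` is a smooth vector field on the set `W` (its values outside of `W` are irrelevant). -/
def IsSmoothFieldOn [IsManifold I ∞ N] (W : Set N) (Y : ∀ x : N, TangentSpace I x) : Prop :=
  ContMDiffOn I I.tangent ∞ (fun x => (⟨x, Y x⟩ : TangentBundle I N)) W

/-- `φ`, with domain `D`, is a local flow of the vector field `Y` given on the open set `W`:
`D ⊆ ℝ × W` is open, the times at which `φ · x` is defined form an interval containing `0`
(if there are any), `φ` is smooth on `D`, and `s ↦ φ s x` is an integral curve of `Y` in `W`
that starts at `x`.  The maximal flow of `Y` is the largest example. -/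
structure IsLocalFlow (W : Set N) (Y : ∀ x : N, TangentSpace I x)
    (D : Set (ℝ × N)) (φ : ℝ → N → N) : Prop where
  isOpen_domain : IsOpen D
  zero_mem : ∀ s x, (s, x) ∈ D → ((0 : ℝ), x) ∈ D
  ordConnected : ∀ x, OrdConnected {s : ℝ | (s, x) ∈ D}
  mem : ∀ s x, (s, x) ∈ D → φ s x ∈ W
  smooth : ContMDiffOn (𝓘(ℝ, ℝ).prod I) I ∞ (fun q : ℝ × N => φ q.1 q.2) D
  map_zero : ∀ x, ((0 : ℝ), x) ∈ D → φ 0 x = x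
  integral : ∀ x, IsMIntegralCurveOn (I := I) (fun s => φ s x) Y {s : ℝ | (s, x) ∈ D}

/-- Every neighbourhood of every point carries a smooth bump function.  All finite dimensional
Hausdorff manifolds have this property, and many infinite dimensional ones. -/
def AdmitsSmoothBumps (N : Type*) [TopologicalSpace N] [ChartedSpace H N] : Prop :=
  ∀ x : N, ∀ U ∈ 𝓝 x, ∃ f : N → ℝ, ContMDiff I 𝓘(ℝ, ℝ) ∞ f ∧ f x = 1 ∧ tsupport f ⊆ U

end Manifolds

/-! ### Ehresmann connections on a vector bundle `V → N` and their parallel transport -/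

section Connections

variable {A : Type*} [NormedAddCommGroup A] [NormedSpace ℝ A]
  {H : Type*} [TopologicalSpace H] (I : ModelWithCorners ℝ A H)
  {N : Type*} [TopologicalSpace N] [ChartedSpace H N]
  (F : Type*) [NormedAddCommGroup F] [NormedSpace ℝ F]
  (V : N → Type*) [∀ x, AddCommMonoid (V x)] [∀ x, Module ℝ (V x)]
  [∀ x, TopologicalSpace (V x)] [TopologicalSpace (TotalSpace F V)]
  [FiberBundle F V] [VectorBundle ℝ F V]

/-- The projection of a smooth vector bundle, as a smooth map. -/
def projMap : C^∞⟮I.prod 𝓘(ℝ, F), TotalSpace F V; I, N⟯ :=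
  ⟨TotalSpace.proj, contMDiff_proj V⟩

/-- An (in general nonlinear) Ehresmann connection on a vector bundle `p : V → N`: a smooth
right splitting `ξ : p^*TN → TV` of the fundamental sequence `0 → p^*V → TV → p^*TN → 0`, i.e.
a smooth horizontal lifting which is linear on the fibres over `V`. -/
@[ext]
structure EhresmannConnection [IsManifold I ∞ N] [ContMDiffVectorBundle ∞ F V I] where
  /-- the horizontal lift of the vector `v`, tangent to the base at `p a`, to the point `a` -/
  lift : ∀ a : TotalSpace F V,
    TangentSpace I a.proj →L[ℝ] TangentSpace (I.prod 𝓘(ℝ, F)) a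
  proj_lift : ∀ (a : TotalSpace F V) (v : TangentSpace I a.proj),
    mfderiv (I.prod 𝓘(ℝ, F)) I (TotalSpace.proj : TotalSpace F V → N) a (lift a v) = v
  smooth_lift : ContMDiff ((I.prod 𝓘(ℝ, F)).prod 𝓘(ℝ, A)) (I.prod 𝓘(ℝ, F)).tangent ∞
    (fun q : TotalSpace A (projMap I F V *ᵖ (TangentSpace I : N → Type _)) =>
      (⟨q.proj, lift q.proj q.2⟩ : TangentBundle (I.prod 𝓘(ℝ, F)) (TotalSpace F V)))

variable {I F V} [IsManifold I ∞ N] [ContMDiffVectorBundle ∞ F V I]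

/-- The horizontal part `ξ(a, Tp(w))` of a vector `w` tangent to `V` at `a`. -/
def EhresmannConnection.horPart (C : EhresmannConnection I F V) (a : TotalSpace F V)
    (w : TangentSpace (I.prod 𝓘(ℝ, F)) a) : TangentSpace (I.prod 𝓘(ℝ, F)) a :=
  C.lift a (mfderiv (I.prod 𝓘(ℝ, F)) I (TotalSpace.proj : TotalSpace F V → N) a w)

/-- The horizontal subbundle, as a subset of `TV`. -/
def EhresmannConnection.horizontal (C : EhresmannConnection I F V) :
    Set (TangentBundle (I.prod 𝓘(ℝ, F)) (TotalSpace F V)) :=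
  {w | ∃ v : TangentSpace I w.proj.proj, w.2 = C.lift w.proj v}

/-- `σ` is, on the open interval `S`, a horizontal lift of the curve `γ`. -/
def EhresmannConnection.IsHorizontalLift (C : EhresmannConnection I F V)
    (γ : ℝ → N) (S : Set ℝ) (σ : ℝ → TotalSpace F V) : Prop :=
  (∀ s ∈ S, (σ s).proj = γ s) ∧
  ContMDiffOn 𝓘(ℝ, ℝ) (I.prod 𝓘(ℝ, F)) ∞ σ S ∧
  ∀ s ∈ S, velocity (I.prod 𝓘(ℝ, F)) σ s ∈ C.horizontal

/-- `T s` (from the fibre over `γ 0` to the fibre over `γ s`, for `s` in the open interval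
`S ∋ 0`) is the parallel transport map along `γ`: for every `p` in the fibre over `γ 0` the
curve `s ↦ T s p` is the horizontal lift of `γ` with initial value `p`. -/
def EhresmannConnection.IsParallelTransport (C : EhresmannConnection I F V)
    (γ : ℝ → N) (S : Set ℝ) (T : ℝ → TotalSpace F V → TotalSpace F V) : Prop :=
  ∀ p : TotalSpace F V, p.proj = γ 0 →
    T 0 p = p ∧ C.IsHorizontalLift γ S (fun s => T s p) ∧
    ∀ (S' : Set ℝ) (σ : ℝ → TotalSpace F V), S' ⊆ S → IsOpen S' → OrdConnected S' →
      (0 : ℝ) ∈ S' → C.IsHorizontalLift γ S' σ → σ 0 = p → ∀ s ∈ S', σ s = T s p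

end Connections

/-! ### The pullback bundle `π^*E → E`, vertical lifts, fibre derivatives, linearization -/

section Pullback

variable {B : Type*} [NormedAddCommGroup B] [NormedSpace ℝ B]
  {H : Type*} [TopologicalSpace H] (I : ModelWithCorners ℝ B H)
  {M : Type*} [TopologicalSpace M] [ChartedSpace H M]
  (F : Type*) [NormedAddCommGroup F] [NormedSpace ℝ F]
  (E : M → Type*) [∀ m, AddCommMonoid (E m)] [∀ m, Module ℝ (E m)]
  [∀ m, TopologicalSpace (E m)] [TopologicalSpace (TotalSpace F E)]
  [FiberBundle F E] [VectorBundle ℝ F E]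

/-- The fibres of the pullback bundle `π^*π : π^*E → E`; the fibre over `a` is `E_{π(a)}`. -/
abbrev PullbackFibre : TotalSpace F E → Type _ := projMap I F E *ᵖ E

/-- The manifold `π^*E`; its points are the pairs `(a, b)` with `a, b ∈ E` and `π a = π b`. -/
abbrev PullbackTotal : Type _ := TotalSpace F (PullbackFibre I F E)

variable {I F E}

/-- The second projection `(a, b) ↦ b` of `π^*E`. -/
def snd (p : PullbackTotal I F E) : TotalSpace F E := Pullback.lift (projMap I F E) p

/-- The map `(a, b) ↦ a + s b` from `π^*E` to `E`. -/
def addSMul (s : ℝ) (p : PullbackTotal I F E) : TotalSpace F E :=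
  ⟨p.proj.proj, p.proj.2 + s • (show E p.proj.proj from p.2)⟩

/-- The vertical lifting `ξ_π^V : π^*E → TE`, `(a, b) ↦ d/ds (a + s b)` at `s = 0`. -/
def verticalLift (p : PullbackTotal I F E) :
    TangentBundle (I.prod 𝓘(ℝ, F)) (TotalSpace F E) :=
  velocity (I.prod 𝓘(ℝ, F)) (fun s : ℝ => addSMul s p) 0

/-- The fibre derivative `𝓕φ : π^*E → π^*E` of a map `φ : E → E`, determined by
`ξ_π^V ∘ 𝓕φ = Tφ ∘ ξ_π^V` where `φ` is smooth and sends fibres to fibres (junk elsewhere):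
`𝓕φ` is the inverse of the injective map `ξ_π^V`, applied to `Tφ ∘ ξ_π^V`. -/
def fibreDeriv (φ : TotalSpace F E → TotalSpace F E) (p : PullbackTotal I F E) :
    PullbackTotal I F E :=
  Function.extend (verticalLift (I := I) (F := F) (E := E)) id (fun _ => p)
    (tangentMap (I.prod 𝓘(ℝ, F)) (I.prod 𝓘(ℝ, F)) φ (verticalLift p))

variable [IsManifold I ∞ M] [ContMDiffVectorBundle ∞ F E I]

/-- The vertical lifting `ξ_{Tπ}^V : (Tπ)^*(TE) → TTE` of the vector bundle `Tπ : TE → TM`.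
A point `z` of `T(π^*E)` is the pair `(v, w)` of vectors in `TE` with `Tπ(v) = Tπ(w)` given by
its images under the tangents of the two projections.  The operations of `Tπ` are the tangents
of those of `π`; so `v +_τ s ·_τ w` is the image of `z` under the tangent of `(a, b) ↦ a + s b`,
and `ξ_{Tπ}^V(v, w) = d/ds (v +_τ s ·_τ w)` at `s = 0`. -/
def tauVerticalLift
    (z : TangentBundle ((I.prod 𝓘(ℝ, F)).prod 𝓘(ℝ, F)) (PullbackTotal I F E)) :
    TangentBundle (I.prod 𝓘(ℝ, F)).tangent
      (TangentBundle (I.prod 𝓘(ℝ, F)) (TotalSpace F E)) :=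
  velocity (I.prod 𝓘(ℝ, F)).tangent
    (fun s : ℝ =>
      tangentMap ((I.prod 𝓘(ℝ, F)).prod 𝓘(ℝ, F)) (I.prod 𝓘(ℝ, F)) (addSMul s) z) 0

/-- The vertical projection `ν_{Tπ}`, determined by `ν_{Tπ}(ξ_{Tπ}^V(v, w)) = w`
(junk on vectors which are not `Tπ`-vertical). -/
def tauVerticalProj
    (u : TangentBundle (I.prod 𝓘(ℝ, F)).tangent
      (TangentBundle (I.prod 𝓘(ℝ, F)) (TotalSpace F E))) :
    TangentBundle (I.prod 𝓘(ℝ, F)) (TotalSpace F E) :=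
  Function.extend (tauVerticalLift (I := I) (F := F) (E := E))
    (tangentMap ((I.prod 𝓘(ℝ, F)).prod 𝓘(ℝ, F)) (I.prod 𝓘(ℝ, F)) snd) (fun u => u.proj) u

/-- The vector `B(a, b)w = ν_{Tπ}(d/ds ξ(a + s b, Tπ(w)) at s = 0)`, for `w` tangent to `E` at
`a`: the derivative in the direction `b`, at the point `a`, of the map `c ↦ ξ(c, Tπ(w))` between
the vector spaces `E_{π(a)}` and `(Tπ)⁻¹(Tπ(w))`. -/
def EhresmannConnection.linLift (Hor : EhresmannConnection I F E) (p : PullbackTotal I F E)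
    (w : TangentSpace (I.prod 𝓘(ℝ, F)) p.proj) :
    TangentBundle (I.prod 𝓘(ℝ, F)) (TotalSpace F E) :=
  tauVerticalProj (velocity (I.prod 𝓘(ℝ, F)).tangent
    (fun s : ℝ =>
      (⟨addSMul s p, Hor.lift (addSMul s p)
        (mfderiv (I.prod 𝓘(ℝ, F)) I (TotalSpace.proj : TotalSpace F E → M) p.proj w)⟩ :
        TangentBundle (I.prod 𝓘(ℝ, F)) (TotalSpace F E))) 0)

/-- The connection `Hor'` on `π^*π : π^*E → E` is the linearization of the connection `Hor` on
`π : E → M`: the lift of `w` to `(a, b)` is `(w, B(a, b)w)`, as an element of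
`T(π^*E) = TE ×_{TM} TE`.  (That its first component is `w` holds for every connection.) -/
def EhresmannConnection.IsLinearization (Hor : EhresmannConnection I F E)
    (Hor' : EhresmannConnection (I.prod 𝓘(ℝ, F)) F (PullbackFibre I F E)) : Prop :=
  ∀ (p : PullbackTotal I F E) (w : TangentSpace (I.prod 𝓘(ℝ, F)) p.proj),
    tangentMap ((I.prod 𝓘(ℝ, F)).prod 𝓘(ℝ, F)) (I.prod 𝓘(ℝ, F)) snd ⟨p, Hor'.lift p w⟩ =
      Hor.linLift p w

/-- `Y` is a `Hor`-basic vector field on `π⁻¹(U)`, the restriction of `E` to the open set `U`: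
it is smooth, projectable onto a vector field `X` on `U`, and `κ(Y)` is a basic section: it is
given by a section `η` of `E` over `U`, so that the vertical part `Y - ξ(Tπ(Y))` of `Y` at `a`
is `ξ_π^V(a, η(π(a)))`. -/
def EhresmannConnection.IsBasicField (Hor : EhresmannConnection I F E) (U : Set M)
    (Y : ∀ a : TotalSpace F E, TangentSpace (I.prod 𝓘(ℝ, F)) a) : Prop :=
  IsSmoothFieldOn (I.prod 𝓘(ℝ, F)) (TotalSpace.proj ⁻¹' U) Y ∧
  (∃ X : ∀ m : M, TangentSpace I m, IsSmoothFieldOn I U X ∧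
    ∀ a : TotalSpace F E, a.proj ∈ U →
      mfderiv (I.prod 𝓘(ℝ, F)) I (TotalSpace.proj : TotalSpace F E → M) a (Y a) = X a.proj) ∧
  ∃ η : ∀ m : M, E m,
    ContMDiffOn I (I.prod 𝓘(ℝ, F)) ∞ (fun m => (⟨m, η m⟩ : TotalSpace F E)) U ∧
    ∀ a : TotalSpace F E, a.proj ∈ U →
      (⟨a, Y a - Hor.horPart a (Y a)⟩ : TangentBundle (I.prod 𝓘(ℝ, F)) (TotalSpace F E)) =
        verticalLift (I := I) ⟨a, η a.proj⟩

/-- The property of a connection `Hor'` on `π^*E` that, for each `Hor`-basic vector field `Y`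
on `π⁻¹(U)` with local flow `φ`, the parallel transport map along each flow line
`s ↦ φ s a` is `𝓕(φ s)`. -/
def EhresmannConnection.TransportsByFlows (Hor : EhresmannConnection I F E)
    (Hor' : EhresmannConnection (I.prod 𝓘(ℝ, F)) F (PullbackFibre I F E)) (U : Set M) : Prop :=
  ∀ Y : ∀ a : TotalSpace F E, TangentSpace (I.prod 𝓘(ℝ, F)) a, Hor.IsBasicField U Y →
  ∀ (D : Set (ℝ × TotalSpace F E)) (φ : ℝ → TotalSpace F E → TotalSpace F E),
    IsLocalFlow (I.prod 𝓘(ℝ, F)) (TotalSpace.proj ⁻¹' U) Y D φ →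
  ∀ a : TotalSpace F E, ((0 : ℝ), a) ∈ D →
    Hor'.IsParallelTransport (fun s => φ s a) {s : ℝ | (s, a) ∈ D} (fun s => fibreDeriv (φ s))

end Pullback

end

/-! In the chart and trivialization at a point, `Hor` is a coefficient `Γ`: the lift of `v` to `(x,
y)` is `(v, Γ(x, y) v)`. Differentiating along the fibre gives the linearization: the lift of `(v,
u)` to `(x, y, y')` has the extra component `∂_yΓ(x, y)(y') v`. A basic field reads `(X(x), Γ(x, y)
X(x) + η(x))`. Since `X` and `η` are constant on fibres, its derivative in the fibre direction `y'`
is `(0, ∂_yΓ(x, y)(y') X(x))`, and `η` has disappeared.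

Transport property: the curve `s ↦ Tφ_s(ξ^V(a, b))` solves the variation equation along the flow
line (`hasDerivAt_variation`). Its base component obeys a closed linear equation with zero initial
value, so it stays zero and the curve stays vertical. Its fibre component then obeys `(y')˙ =
∂_yΓ(x, y)(y') ẋ`, which is exactly horizontality for the linearization. This equation is linear in
`y'`, so horizontal lifts along a given curve are determined by one value. Both arguments are local
in time and are continued over the whole interval by connectedness
(`IsPreconnected.forall_of_locally`).

Converse: every `w ∈ T_aE` is the value at `a` of a basic field `Y`. With a local flow of `Y`, the
curve `s ↦ 𝓕φ_s(a, b)` is horizontal for `Hor'` by hypothesis and for the linearization by the first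
part. Its velocity at `s = 0` lies over `w`, hence is the lift of `w` for both connections. A field
defined in a chart suffices if all open sets are allowed; over `M` it is cut off by a bump function
equal to `1` at the point.

The converse needs smooth local flows in Banach spaces. They come from the inverse function theorem
applied to the integral equation on `C([-1, 1], E)`, once the superposition operator `γ ↦ f ∘ γ` is
known to be smooth. Identities between vectors in `TM`, `TE`, `TTE` and `T(π^*E)` are checked in
coordinates through `SmoothChart`. -/

noncomputable section

/-! ### Smoothness of superposition operators on spaces of continuous maps -/

section Superposition

variable {K : Type*} [TopologicalSpace K]

/-- The superposition operator `γ ↦ g ∘ γ` on continuous functions (zero where `g ∘ γ` is not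
continuous). -/
def superposition {E G : Type*} [TopologicalSpace E] [TopologicalSpace G] [Zero G] (g : E → G)
    (γ : C(K, E)) : C(K, G) :=
  open Classical in if h : Continuous (g ∘ γ) then ⟨g ∘ γ, h⟩ else 0

theorem superposition_apply {E G : Type*} [TopologicalSpace E] [TopologicalSpace G] [Zero G]
    {g : E → G} {s : Set E} (hg : ContinuousOn g s) {γ : C(K, E)} (hγ : ∀ t, γ t ∈ s) (t : K) :
    superposition g γ t = g (γ t) := by
  have h : Continuous (g ∘ γ) := hg.comp_continuous γ.continuous hγ
  simp [superposition, h]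

variable [CompactSpace K] {E G : Type*} [NormedAddCommGroup E] [NormedSpace ℝ E]
  [NormedAddCommGroup G] [NormedSpace ℝ G]

instance instNormedAddCommGroupContinuousMapCLM : NormedAddCommGroup C(K, E →L[ℝ] G) :=
  ContinuousMap.instNormedAddCommGroup

instance instSeminormedAddCommGroupContinuousMapCLM : SeminormedAddCommGroup C(K, E →L[ℝ] G) :=
  ContinuousMap.instSeminormedAddCommGroup

theorem norm_apply_le (A : C(K, E →L[ℝ] G)) (h : C(K, E)) :
    ‖(⟨fun t => A t (h t), by fun_prop⟩ : C(K, G))‖ ≤ ‖A‖ * ‖h‖ := by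
  rw [ContinuousMap.norm_le _ (by positivity)]
  intro t
  exact ((A t).le_opNorm _).trans (mul_le_mul (A.norm_coe_le_norm t) (h.norm_coe_le_norm t)
    (norm_nonneg _) (norm_nonneg _))

/-- Pointwise application `h ↦ (t ↦ A t (h t))` of a continuous family of linear maps. -/
def pointwiseApplyCLM (A : C(K, E →L[ℝ] G)) : C(K, E) →L[ℝ] C(K, G) :=
  LinearMap.mkContinuous
    { toFun := fun h => (⟨fun t => A t (h t), by fun_prop⟩ : C(K, G))
      map_add' := fun _ _ => by ext; simp
      map_smul' := fun _ _ => by ext; simp } ‖A‖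
    (norm_apply_le A)

/-- Pointwise application `(A, h) ↦ (t ↦ A t (h t))`, as a continuous bilinear map. -/
def pointwiseApply : C(K, E →L[ℝ] G) →L[ℝ] C(K, E) →L[ℝ] C(K, G) :=
  LinearMap.mkContinuous
    { toFun := fun A => pointwiseApplyCLM A
      map_add' := fun _ _ => by ext; rfl
      map_smul' := fun _ _ => by ext; rfl } 1
    (fun A => by
      rw [one_mul]
      exact LinearMap.mkContinuous_norm_le _ (norm_nonneg A) (norm_apply_le A))

@[simp] theorem pointwiseApply_apply (A : C(K, E →L[ℝ] G)) (h : C(K, E)) (t : K) :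
    pointwiseApply A h t = A t (h t) := rfl

theorem isOpen_setOf_forall_mem {E : Type*} [TopologicalSpace E] {s : Set E} (hs : IsOpen s) :
    IsOpen {γ : C(K, E) | ∀ t, γ t ∈ s} := by
  have := ContinuousMap.isOpen_setOfPred_mapsTo (X := K) (Y := E) (isCompact_univ (X := K)) hs
  simpa [MapsTo] using this

/-- The range of `γ` is compact, so the derivative of `g` is uniformly continuous near it, and the
mean value inequality bounds the first-order remainder at all `t` simultaneously. -/
theorem hasFDerivAt_superposition {g : E → G} {s : Set E} (hs : IsOpen s)
    (hg : ContDiffOn ℝ 1 g s) {γ : C(K, E)} (hγ : ∀ t, γ t ∈ s) :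
    HasFDerivAt (superposition g) (pointwiseApply (superposition (fderiv ℝ g) γ)) γ := by
  have hcont := hg.continuousOn_fderiv_of_isOpen hs le_rfl
  have hK : IsCompact (range γ) := isCompact_range γ.continuous
  have hsub : range γ ⊆ s := by rintro _ ⟨t, rfl⟩; exact hγ t
  obtain ⟨r, hr, hrs⟩ := hK.exists_thickening_subset_open hs hsub
  rw [hasFDerivAt_iff_isLittleO_nhds_zero, Asymptotics.isLittleO_iff]
  intro c hc
  -- Uniform continuity at the compact range: only one of the two points compared must lie in it, so
  -- `d` serves for every small perturbation of `γ`.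
  have huc := hK.uniformContinuousAt_of_continuousAt (fderiv ℝ g)
    (fun a ha => hcont.continuousAt (hs.mem_nhds (hsub ha))) (Metric.dist_mem_uniformity hc)
  obtain ⟨d, hd, hdc⟩ := Metric.mem_uniformity_dist.1 huc
  have hball : Metric.ball (0 : C(K, E)) (min r d) ∈ 𝓝 (0 : C(K, E)) :=
    Metric.ball_mem_nhds _ (lt_min hr hd)
  filter_upwards [hball] with h hh
  rw [mem_ball_zero_iff, lt_min_iff] at hh
  have hmem : ∀ t, ∀ y ∈ Metric.ball (γ t) (min r d), y ∈ s := fun t y hy =>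
    hrs (Metric.mem_thickening_iff.2 ⟨γ t, mem_range_self t, hy.trans_le (min_le_left _ _)⟩)
  have hin : ∀ t, γ t + h t ∈ Metric.ball (γ t) (min r d) := fun t => by
    rw [mem_ball_iff_norm, add_sub_cancel_left]
    exact (h.norm_coe_le_norm t).trans_lt (lt_min hh.1 hh.2)
  rw [ContinuousMap.norm_le _ (by positivity)]
  intro t
  have h1 : superposition g (γ + h) t = g (γ t + h t) :=
    superposition_apply hg.continuousOn (γ := γ + h) (fun t => hmem t _ (hin t)) t
  simp only [ContinuousMap.sub_apply, pointwiseApply_apply, h1,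
    superposition_apply hg.continuousOn hγ, superposition_apply hcont hγ]
  -- Mean value inequality on a ball around `γ t`, with the derivative compared to its value at the
  -- centre.
  have := (convex_ball (γ t) (min r d)).norm_image_sub_le_of_norm_hasFDerivWithin_le'
    (f := g) (f' := fderiv ℝ g) (φ := fderiv ℝ g (γ t)) (C := c) (x := γ t) (y := γ t + h t)
    (fun y hy => ((hg.differentiableOn one_ne_zero).differentiableAt
      (hs.mem_nhds (hmem t y hy))).hasFDerivAt.hasFDerivWithinAt)
    (fun y hy => by
      have : (γ t, y) ∈ {x : E × E | x.1 ∈ range γ → (fderiv ℝ g x.1, fderiv ℝ g x.2) ∈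
          {p : (E →L[ℝ] G) × (E →L[ℝ] G) | dist p.1 p.2 < c}} :=
        hdc (by rw [dist_comm]; exact lt_of_lt_of_le hy (min_le_right _ _))
      have := this (mem_range_self t)
      simp only [mem_ofPred_eq, dist_eq_norm] at this
      rw [norm_sub_rev]; exact this.le)
    (Metric.mem_ball_self (lt_min hr hd)) (hin t)
  rw [add_sub_cancel_left] at this
  exact this.trans (mul_le_mul_of_nonneg_left (h.norm_coe_le_norm t) hc.le)

end Superposition

/-- The derivative of a superposition operator is the superposition operator of `fderiv ℝ g`
followed by a continuous linear map, so induction on `n` works if the target varies. `E` and `G`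
share a universe so that `E →L[ℝ] G` is again an admissible target. -/
theorem contDiffOn_superposition_nat.{u} {K : Type*} [TopologicalSpace K] [CompactSpace K]
    {E : Type u} [NormedAddCommGroup E] [NormedSpace ℝ E] {s : Set E} (hs : IsOpen s) (n : ℕ) :
    ∀ {G : Type u} [NormedAddCommGroup G] [NormedSpace ℝ G] {g : E → G},
      ContDiffOn ℝ ∞ g s → ContDiffOn ℝ n (superposition (K := K) g) {γ | ∀ t, γ t ∈ s} := by
  induction n with
  | zero =>
    intro G _ _ g hg
    refine contDiffOn_zero.2 fun γ hγ => ?_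
    exact (hasFDerivAt_superposition hs (hg.of_le (by simp)) hγ).continuousAt.continuousWithinAt
  | succ n ih =>
    intro G _ _ g hg
    have hg' := (contDiffOn_infty_iff_fderiv_of_isOpen hs).1 hg
    have hd : ∀ γ : C(K, E), (∀ t, γ t ∈ s) → HasFDerivAt (superposition g)
        (pointwiseApply (superposition (fderiv ℝ g) γ)) γ := fun γ hγ =>
      hasFDerivAt_superposition hs (hg.of_le (by simp)) hγ
    push_cast
    refine (contDiffOn_succ_iff_fderiv_of_isOpen (isOpen_setOf_forall_mem hs)).2
      ⟨fun γ hγ => (hd γ hγ).differentiableAt.differentiableWithinAt, by simp, ?_⟩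
    have h0 : ContDiff ℝ n (fun A : C(K, E →L[ℝ] G) => pointwiseApply A) :=
      ContinuousLinearMap.contDiff (𝕜 := ℝ) (E := C(K, E →L[ℝ] G))
        (F := C(K, E) →L[ℝ] C(K, G)) pointwiseApply
    have hc : ContDiffOn ℝ n (fun γ => pointwiseApply (superposition (K := K) (fderiv ℝ g) γ))
        {γ | ∀ t, γ t ∈ s} :=
      h0.comp_contDiffOn (ih hg'.2)
    exact hc.congr fun γ hγ => (hd γ hγ).fderiv

theorem contDiffOn_superposition.{u} {K : Type*} [TopologicalSpace K] [CompactSpace K]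
    {E G : Type u} [NormedAddCommGroup E] [NormedSpace ℝ E] [NormedAddCommGroup G]
    [NormedSpace ℝ G] {s : Set E} (hs : IsOpen s) {g : E → G} (hg : ContDiffOn ℝ ∞ g s) :
    ContDiffOn ℝ ∞ (superposition (K := K) g) {γ | ∀ t, γ t ∈ s} :=
  contDiffOn_infty.2 fun n => contDiffOn_superposition_nat hs n hg

/-! ### The integration operator on `C([-1, 1], E)` -/

section Primitive

variable {E : Type*} [NormedAddCommGroup E]

/-- The continuous extension to `ℝ` of a function on `[-1, 1]`, constant outside. -/
def extendIcc (γ : C(Icc (-1 : ℝ) 1, E)) (t : ℝ) : E := γ (projIcc (-1) 1 (by norm_num) t)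

theorem continuous_extendIcc (γ : C(Icc (-1 : ℝ) 1, E)) : Continuous (extendIcc γ) :=
  γ.continuous.comp continuous_projIcc

theorem extendIcc_of_mem (γ : C(Icc (-1 : ℝ) 1, E)) {t : ℝ} (ht : t ∈ Icc (-1 : ℝ) 1) :
    extendIcc γ t = γ ⟨t, ht⟩ := by
  rw [extendIcc, projIcc_of_mem]

variable [NormedSpace ℝ E] [CompleteSpace E]

/-- The primitive `t ↦ ∫₀ᵗ γ`, as a continuous linear map on `C([-1, 1], E)`. -/
def primitiveCLM : C(Icc (-1 : ℝ) 1, E) →L[ℝ] C(Icc (-1 : ℝ) 1, E) :=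
  LinearMap.mkContinuous
    { toFun := fun γ => ⟨fun t => ∫ τ in (0 : ℝ)..t, extendIcc γ τ, by
        have h : Continuous fun u : ℝ => ∫ τ in (0 : ℝ)..u, extendIcc γ τ :=
          intervalIntegral.continuous_primitive
            (fun a b => (continuous_extendIcc γ).intervalIntegrable a b) 0
        exact h.comp continuous_subtype_val⟩
      map_add' := fun γ₁ γ₂ => by
        ext t
        exact intervalIntegral.integral_add ((continuous_extendIcc γ₁).intervalIntegrable _ _)
          ((continuous_extendIcc γ₂).intervalIntegrable _ _)
      map_smul' := fun c γ => by
        ext t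
        exact intervalIntegral.integral_smul c (extendIcc γ) } 1
    (fun γ => by
      rw [ContinuousMap.norm_le _ (by positivity)]
      intro t
      refine (intervalIntegral.norm_integral_le_of_norm_le_const
        (C := ‖γ‖) fun τ _ => γ.norm_coe_le_norm _).trans ?_
      have : |(t : ℝ) - 0| ≤ 1 := by rw [sub_zero]; exact abs_le.2 t.2
      nlinarith [norm_nonneg γ])

end Primitive

/-! ### Smooth local flows in Banach spaces -/

section SmoothFlow

variable {E : Type*} [NormedAddCommGroup E] [NormedSpace ℝ E]

/-- Constant curves, as a continuous linear map. -/
def constCLM : E →L[ℝ] C(Icc (-1 : ℝ) 1, E) :=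
  LinearMap.mkContinuous
    { toFun := fun x => ContinuousMap.const _ x
      map_add' := fun _ _ => rfl
      map_smul' := fun _ _ => rfl } 1
    (fun x => by
      rw [ContinuousMap.norm_le _ (by positivity), one_mul]
      exact fun _ => le_rfl)

/-- The defect `γ - x - s ∫ f(γ)` of the integral equation for the curve `γ` on `[-1, 1]` with
initial value `x` and equation `γ' = s f(γ)`. -/
def integralDefect (f : E → E) (q : (ℝ × E) × C(Icc (-1 : ℝ) 1, E)) : C(Icc (-1 : ℝ) 1, E) :=
  q.2 - constCLM q.1.2 -
    q.1.1 • primitiveCLM (superposition f q.2)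

theorem contDiffOn_integralDefect {f : E → E} {Ω : Set E} (hΩ : IsOpen Ω)
    (hf : ContDiffOn ℝ ∞ f Ω) :
    ContDiffOn ℝ ∞ (integralDefect f) {q | ∀ t, q.2 t ∈ Ω} := by
  have h1 : ContDiffOn ℝ ∞ (fun q : (ℝ × E) × C(Icc (-1 : ℝ) 1, E) =>
      primitiveCLM (superposition f q.2)) {q | ∀ t, q.2 t ∈ Ω} :=
    primitiveCLM.contDiff.comp_contDiffOn
      ((contDiffOn_superposition hΩ hf).comp contDiff_snd.contDiffOn fun _ h => h)
  have h2 : ContDiff ℝ ∞ fun q : (ℝ × E) × C(Icc (-1 : ℝ) 1, E) =>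
      constCLM q.1.2 :=
    (constCLM (E := E)).contDiff.comp contDiff_fst.snd
  exact (contDiff_snd.sub h2).contDiffOn.sub (contDiff_fst.fst.contDiffOn.smul h1)

theorem integralDefect_eq_zero_iff {f : E → E} {Ω : Set E} (hf : ContinuousOn f Ω) {s : ℝ} {x : E}
    {γ : C(Icc (-1 : ℝ) 1, E)} (hγ : ∀ t, γ t ∈ Ω) :
    integralDefect f ((s, x), γ) = 0 ↔
      ∀ t : Icc (-1 : ℝ) 1, γ t = x + s • ∫ τ in (0 : ℝ)..t, f (extendIcc γ τ) := by
  rw [ContinuousMap.ext_iff]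
  refine forall_congr' fun t => ?_
  have h : ∀ τ, extendIcc (superposition f γ) τ = f (extendIcc γ τ) := fun τ =>
    superposition_apply hf hγ _
  have h' : primitiveCLM (superposition f γ) t = ∫ τ in (0 : ℝ)..t, f (extendIcc γ τ) := by
    simp only [← h]; rfl
  have h'' : integralDefect f ((s, x), γ) t =
      γ t - (x + s • ∫ τ in (0 : ℝ)..t, f (extendIcc γ τ)) := by
    rw [← h', ← sub_sub]; rfl
  rw [h'', ContinuousMap.zero_apply, sub_eq_zero]

variable [CompleteSpace E]

/-- Inverse function theorem for `(p, γ) ↦ (p, defect)` at the constant curve with `s = 0`; `G p` is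
read off from the preimage of `(p, 0)`. The last clause is a uniqueness statement made for
reparametrizations `t ↦ G p (r t)`: a curve with values in the range of `G p` is no farther from the
constant curve than `G p` is, so it lies where the map is injective. -/
theorem exists_smooth_integral_solution {f : E → E} {Ω : Set E} (hΩ : IsOpen Ω)
    (hf : ContDiffOn ℝ ∞ f Ω) {x₀ : E} (hx₀ : x₀ ∈ Ω) :
    ∃ (δ : ℝ) (G : ℝ × E → C(Icc (-1 : ℝ) 1, E)), 0 < δ ∧
      ContDiffOn ℝ ∞ G (Ioo (-δ) δ ×ˢ Metric.ball x₀ δ) ∧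
      (∀ p ∈ Ioo (-δ) δ ×ˢ Metric.ball x₀ δ, (∀ t, G p t ∈ Ω) ∧ integralDefect f (p, G p) = 0) ∧
      ∀ p ∈ Ioo (-δ) δ ×ˢ Metric.ball x₀ δ, ∀ r ∈ Icc (-1 : ℝ) 1, ∀ γ : C(Icc (-1 : ℝ) 1, E),
        (∀ t, γ t ∈ range (G p)) → integralDefect f ((r * p.1, p.2), γ) = 0 →
          G (r * p.1, p.2) = γ := by
  set c₀ : C(Icc (-1 : ℝ) 1, E) := constCLM x₀ with hc₀
  set O : Set ((ℝ × E) × C(Icc (-1 : ℝ) 1, E)) := {q | ∀ t, q.2 t ∈ Ω} with hO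
  have hOo : IsOpen O := (isOpen_setOf_forall_mem hΩ).preimage continuous_snd
  set H : (ℝ × E) × C(Icc (-1 : ℝ) 1, E) → (ℝ × E) × C(Icc (-1 : ℝ) 1, E) :=
    fun q => (q.1, integralDefect f q) with hH
  have hHs : ContDiffOn ℝ ∞ H O :=
    contDiff_fst.contDiffOn.prodMk (contDiffOn_integralDefect hΩ hf)
  have hp₀ : (((0 : ℝ), x₀), c₀) ∈ O := fun _ => hx₀
  have hHat : ContDiffAt ℝ ∞ H ((0, x₀), c₀) := hHs.contDiffAt (hOo.mem_nhds hp₀)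
  have hH0 : H ((0, x₀), c₀) = ((0, x₀), 0) := by
    simp [hH, integralDefect, hc₀]
  -- the derivative at the base point
  let A : ℝ × E →L[ℝ] C(Icc (-1 : ℝ) 1, E) :=
    -(constCLM.comp (ContinuousLinearMap.snd ℝ ℝ E) +
      (ContinuousLinearMap.fst ℝ ℝ E).smulRight (primitiveCLM (superposition f c₀)))
  let e : ((ℝ × E) × C(Icc (-1 : ℝ) 1, E)) ≃L[ℝ] ((ℝ × E) × C(Icc (-1 : ℝ) 1, E)) :=
    (ContinuousLinearEquiv.refl ℝ (ℝ × E)).skewProd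
      (ContinuousLinearEquiv.refl ℝ C(Icc (-1 : ℝ) 1, E)) A
  have hder : HasFDerivAt H (e : _ →L[ℝ] _) ((0, x₀), c₀) := by
    have h1 : HasFDerivAt (fun q : (ℝ × E) × C(Icc (-1 : ℝ) 1, E) =>
        constCLM q.1.2)
        (constCLM.comp
          ((ContinuousLinearMap.snd ℝ ℝ E).comp (ContinuousLinearMap.fst ℝ _ _)))
        ((0, x₀), c₀) :=
      (((constCLM (E := E)).comp ((ContinuousLinearMap.snd ℝ ℝ E).comp (ContinuousLinearMap.fst ℝ
        (ℝ × E) C(Icc (-1 : ℝ) 1, E)))).hasFDerivAt (x := (((0 : ℝ), x₀), c₀)) :)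
    have hs : HasFDerivAt (superposition f)
        (pointwiseApply (superposition (fderiv ℝ f) c₀)) c₀ :=
      hasFDerivAt_superposition hΩ (hf.of_le (by simp)) (fun _ => hx₀)
    have h2 := (primitiveCLM.hasFDerivAt.comp c₀ hs).comp (((0 : ℝ), x₀), c₀)
      (hasFDerivAt_snd (𝕜 := ℝ) (p := (((0 : ℝ), x₀), c₀)))
    have h3 : HasFDerivAt (fun q : (ℝ × E) × C(Icc (-1 : ℝ) 1, E) => q.1.1)
      ((ContinuousLinearMap.fst ℝ ℝ E).comp (ContinuousLinearMap.fst ℝ _ _)) ((0, x₀), c₀) :=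
      (((ContinuousLinearMap.fst ℝ ℝ E).comp (ContinuousLinearMap.fst ℝ
        (ℝ × E) C(Icc (-1 : ℝ) 1, E))).hasFDerivAt (x := (((0 : ℝ), x₀), c₀)) :)
    have h4 := ((hasFDerivAt_snd (𝕜 := ℝ) (p := (((0 : ℝ), x₀), c₀))).sub h1).sub (h3.smul h2)
    refine ((hasFDerivAt_fst (𝕜 := ℝ) (p := (((0 : ℝ), x₀), c₀))).prodMk h4).congr_fderiv ?_
    refine ContinuousLinearMap.ext fun q => Prod.ext rfl ?_
    -- The factor `0` is the base value of `s`; it removes the derivative of the superposition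
    -- operator.
    change q.2 - constCLM q.1.2 - ((0 : ℝ) • (primitiveCLM
      (pointwiseApply (superposition (fderiv ℝ f) c₀) q.2)) +
        q.1.1 • primitiveCLM (superposition f c₀)) =
      q.2 + -(constCLM q.1.2 + q.1.1 • primitiveCLM (superposition f c₀))
    rw [zero_smul, zero_add, sub_sub, sub_eq_add_neg]
  -- Invertible operators form an open set, so the derivative stays invertible on a neighbourhood
  -- `N`. This gives smoothness of the inverse near the base point and not only at it.
  obtain ⟨N, hN, hNo, hN0⟩ := mem_nhds_iff.1 (((hHs.continuousOn_fderiv_of_isOpen hOo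
    (by simp)).continuousAt (hOo.mem_nhds hp₀)).preimage_mem_nhds
      (by rw [hder.fderiv]; exact e.nhds))
  set T := hHat.toOpenPartialHomeomorph H hder (by simp) with hT
  have hTH : ∀ q, T q = H q := fun q => rfl
  have hT0 : (((0 : ℝ), x₀), c₀) ∈ T.source := hHat.mem_toOpenPartialHomeomorph_source hder (by simp)
  have hTt : (((0 : ℝ), x₀), (0 : C(Icc (-1 : ℝ) 1, E))) ∈ T.target := by
    rw [← hH0, ← hTH]; exact T.map_source hT0
  have hTs0 : T.symm (((0 : ℝ), x₀), (0 : C(Icc (-1 : ℝ) 1, E))) = ((0, x₀), c₀) := by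
    rw [← hH0, ← hTH]; exact T.left_inv hT0
  obtain ⟨ρ, hρ, hρs⟩ := Metric.isOpen_iff.1 T.open_source _ hT0
  -- good parameters
  set W : Set ((ℝ × E) × C(Icc (-1 : ℝ) 1, E)) := N ∩ O ∩ Metric.ball ((0, x₀), c₀) ρ with hW
  have hWo : IsOpen W := (hNo.inter hOo).inter Metric.isOpen_ball
  have hV : T.target ∩ T.symm ⁻¹' W ∈ 𝓝 (((0 : ℝ), x₀), (0 : C(Icc (-1 : ℝ) 1, E))) :=
    (T.symm.isOpen_inter_preimage hWo).mem_nhds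
      ⟨hTt, by rw [mem_preimage, hTs0]; exact ⟨⟨hN0, hp₀⟩, Metric.mem_ball_self hρ⟩⟩
  have hV' : {p : ℝ × E | (p, (0 : C(Icc (-1 : ℝ) 1, E))) ∈ T.target ∩ T.symm ⁻¹' W} ∈
      𝓝 ((0 : ℝ), x₀) :=
    (by fun_prop : ContinuousAt (fun p : ℝ × E => (p, (0 : C(Icc (-1 : ℝ) 1, E))))
      ((0 : ℝ), x₀)).preimage_mem_nhds hV
  obtain ⟨δ, hδ, hδV⟩ := Metric.mem_nhds_iff.1 hV'
  have hball : ∀ d ≤ δ, ∀ p ∈ Ioo (-d) d ×ˢ Metric.ball x₀ d, p ∈ Metric.ball ((0 : ℝ), x₀) d := by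
    rintro d - ⟨s, x⟩ ⟨hs, hx⟩
    rw [← ball_prod_same]
    exact ⟨by rw [mem_ball_zero_iff, Real.norm_eq_abs, abs_lt]; exact hs, hx⟩
  set G : ℝ × E → C(Icc (-1 : ℝ) 1, E) := fun p => (T.symm (p, 0)).2 with hG
  -- `δ` keeps `(p, 0)` in the target with preimage in `W`; `ρ` keeps the competitors of the
  -- uniqueness clause in the source.
  have hmin : 0 < min δ ρ := lt_min hδ hρ
  have key : ∀ p ∈ Ioo (-min δ ρ) (min δ ρ) ×ˢ Metric.ball x₀ (min δ ρ),
      (p, (0 : C(Icc (-1 : ℝ) 1, E))) ∈ T.target ∧ T.symm (p, 0) ∈ W ∧ T.symm (p, 0) = (p, G p) ∧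
        integralDefect f (p, G p) = 0 := by
    intro p hp
    have h := hδV ((Metric.ball_subset_ball (min_le_left _ _))
      (hball _ (min_le_left _ _) p hp))
    have hr := T.right_inv h.1
    rw [hTH] at hr
    have h1 : (T.symm (p, 0)).1 = p := congrArg Prod.fst hr
    have h2 : T.symm (p, 0) = (p, G p) := Prod.ext h1 rfl
    refine ⟨h.1, h.2, h2, ?_⟩
    have h3 := congrArg Prod.snd hr
    rw [h2] at h3
    exact h3
  refine ⟨min δ ρ, G, hmin, fun p hp => ?_, fun p hp => ?_, fun p hp r hr γ hγ hdef => ?_⟩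
  · obtain ⟨h1, h2, h3, -⟩ := key p hp
    obtain ⟨e', he'⟩ := hN h2.1.1
    have hsm : ContDiffAt ℝ ∞ H (T.symm (p, 0)) := hHs.contDiffAt (hOo.mem_nhds h2.1.2)
    have hd : HasFDerivAt T (e' : _ →L[ℝ] _) (T.symm (p, 0)) := by
      rw [he']; exact (hsm.differentiableAt (by simp)).hasFDerivAt
    have h5 : ContDiffAt ℝ ∞ T.symm (p, 0) := T.contDiffAt_symm h1 hd hsm
    have h6 : ContDiffAt ℝ ∞ (fun p : ℝ × E => (p, (0 : C(Icc (-1 : ℝ) 1, E)))) p := by fun_prop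
    exact (contDiffAt_snd.comp p (h5.comp p h6)).contDiffWithinAt
  · obtain ⟨h1, h2, h3, h4⟩ := key p hp
    exact ⟨by have := h2.1.2; rw [h3] at this; exact this, h4⟩
  · obtain ⟨h1, h2, h3, h4⟩ := key p hp
    have hGρ : ‖G p - c₀‖ < ρ := by
      have := h2.2
      rw [h3, ← ball_prod_same] at this
      rw [← dist_eq_norm]; exact this.2
    have hγρ : ‖γ - c₀‖ < ρ := by
      refine lt_of_le_of_lt ((ContinuousMap.norm_le _ (norm_nonneg _)).2 fun t => ?_) hGρ
      -- `γ t` is a value of `G p`, so its distance to `x₀` is at most `‖G p - c₀‖`.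
      obtain ⟨u, hu⟩ := hγ t
      have := (G p - c₀).norm_coe_le_norm u
      rw [ContinuousMap.sub_apply, hu] at this
      exact this
    have hrp : |r * p.1| < ρ := by
      have h5 : |p.1| < ρ := (abs_lt.2 hp.1).trans_le (min_le_right _ _)
      rw [abs_mul]
      exact (mul_le_of_le_one_left (abs_nonneg _) (abs_le.2 hr)).trans_lt h5
    have hsrc : ((r * p.1, p.2), γ) ∈ T.source := by
      refine hρs ?_
      rw [← ball_prod_same, ← ball_prod_same]
      refine ⟨⟨?_, Metric.ball_subset_ball (min_le_right _ _) hp.2⟩, ?_⟩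
      · rwa [mem_ball_zero_iff]
      · rwa [mem_ball_iff_norm]
    have hTq : T ((r * p.1, p.2), γ) = ((r * p.1, p.2), 0) := by
      rw [hTH]; exact Prod.ext rfl hdef
    have := T.left_inv hsrc
    rw [hTq] at this
    simp only [hG, this]

/-- Smooth local flows of smooth autonomous ordinary differential equations in Banach spaces. -/
theorem exists_smooth_flow {f : E → E} {Ω : Set E} (hΩ : IsOpen Ω)
    (hf : ContDiffOn ℝ ∞ f Ω) {x₀ : E} (hx₀ : x₀ ∈ Ω) :
    ∃ (δ : ℝ) (φ : ℝ → E → E), 0 < δ ∧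
      ContDiffOn ℝ ∞ (uncurry φ) (Ioo (-δ) δ ×ˢ Metric.ball x₀ δ) ∧
      (∀ x ∈ Metric.ball x₀ δ, φ 0 x = x) ∧
      ∀ s ∈ Ioo (-δ) δ, ∀ x ∈ Metric.ball x₀ δ, φ s x ∈ Ω ∧
        HasDerivAt (fun s => φ s x) (f (φ s x)) s := by
  obtain ⟨δ, G, hδ, hGs, hG, hGu⟩ := exists_smooth_integral_solution hΩ hf hx₀
  have hone : (1 : ℝ) ∈ Icc (-1 : ℝ) 1 := by norm_num
  -- The curve `G (s, x)` solves `γ' = s f(γ)`, so its value at parameter `1` is the solution of `x'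
  -- = f x` at time `s`.
  set φ : ℝ → E → E := fun s x => G (s, x) ⟨1, hone⟩ with hφ
  have hint : ∀ p ∈ Ioo (-δ) δ ×ˢ Metric.ball x₀ δ, ∀ t : Icc (-1 : ℝ) 1,
      G p t = p.2 + p.1 • ∫ τ in (0 : ℝ)..t, f (extendIcc (G p) τ) := fun p hp =>
    (integralDefect_eq_zero_iff hf.continuousOn (hG p hp).1).1 (hG p hp).2
  -- By uniqueness `t ↦ G p (r t)` is the solution for speed `r s`. Hence a single curve `G p`
  -- contains the flow at all times `r s` with `|r| ≤ 1`.
  have hrescale : ∀ p ∈ Ioo (-δ) δ ×ˢ Metric.ball x₀ δ, ∀ r (hr : r ∈ Icc (-1 : ℝ) 1),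
      φ (r * p.1) p.2 = G p ⟨r, hr⟩ := by
    intro p hp r hr
    have hmul : ∀ t : Icc (-1 : ℝ) 1, r * t ∈ Icc (-1 : ℝ) 1 := fun t => by
      rw [mem_Icc, ← abs_le, abs_mul]
      exact mul_le_one₀ (abs_le.2 hr) (abs_nonneg _) (abs_le.2 t.2)
    let γ : C(Icc (-1 : ℝ) 1, E) := ⟨fun t => G p ⟨r * t, hmul t⟩, by fun_prop⟩
    have hγ : G (r * p.1, p.2) = γ := by
      refine hGu p hp r hr γ (fun t => mem_range_self _) ?_
      refine (integralDefect_eq_zero_iff (γ := γ) hf.continuousOn fun t => (hG p hp).1 _).2 fun t => ?_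
      have h1 : γ t = p.2 + p.1 • ∫ τ in (0 : ℝ)..(r * t), f (extendIcc (G p) τ) :=
        hint p hp ⟨r * t, hmul t⟩
      have h2 : (∫ τ in (0 : ℝ)..t, f (extendIcc γ τ)) =
          ∫ τ in (0 : ℝ)..t, f (extendIcc (G p) (r * τ)) := by
        refine intervalIntegral.integral_congr fun τ hτ => ?_
        have hτ' : τ ∈ Icc (-1 : ℝ) 1 :=
          (ordConnected_Icc.uIcc_subset (by norm_num) t.2) hτ
        rw [extendIcc_of_mem _ hτ', extendIcc_of_mem _ (hmul ⟨τ, hτ'⟩)]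
        rfl
      rw [h1, h2, mul_comm r p.1, mul_smul, 
        intervalIntegral.smul_integral_comp_mul_left (fun τ => f (extendIcc (G p) τ)), mul_zero]
    simp only [hφ]
    rw [hγ]
    change G p ⟨r * 1, _⟩ = _
    simp only [mul_one]
  refine ⟨δ, φ, hδ, ?_, fun x hx => ?_, fun s hs x hx => ⟨(hG (s, x) ⟨hs, hx⟩).1 _, ?_⟩⟩
  · exact (ContinuousMap.evalCLM ℝ (⟨1, hone⟩ : Icc (-1 : ℝ) 1)).contDiff.comp_contDiffOn hGs
  · have h0 : ((0 : ℝ), x) ∈ Ioo (-δ) δ ×ˢ Metric.ball x₀ δ := ⟨⟨by linarith, hδ⟩, hx⟩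
    simpa using hint _ h0 ⟨1, hone⟩
  -- For `|s'| < S` all `φ s' x` are values of the one curve `G (S, x)` at `s' / S`, and the
  -- derivative at `s` follows from the fundamental theorem of calculus.
  · obtain ⟨S, hsS, hSδ⟩ := exists_between (abs_lt.2 hs)
    have hS0 : 0 < S := (abs_nonneg s).trans_lt hsS
    have hp : (S, x) ∈ Ioo (-δ) δ ×ˢ Metric.ball x₀ δ := ⟨⟨by linarith, hSδ⟩, hx⟩
    have hmem : ∀ s', |s'| < S → s' / S ∈ Icc (-1 : ℝ) 1 := fun s' h => by
      rw [mem_Icc, ← abs_le, abs_div, abs_of_pos hS0, div_le_one hS0]; exact h.le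
    have hφS : ∀ s', |s'| < S →
        φ s' x = x + S • ∫ τ in (0 : ℝ)..(s' / S), f (extendIcc (G (S, x)) τ) := by
      intro s' h
      have := hrescale (S, x) hp (s' / S) (hmem s' h)
      rw [div_mul_cancel₀ _ hS0.ne'] at this
      rw [this]
      exact hint (S, x) hp ⟨s' / S, hmem s' h⟩
    have hcont : Continuous fun τ => f (extendIcc (G (S, x)) τ) :=
      hf.continuousOn.comp_continuous (continuous_extendIcc _) fun τ => (hG _ hp).1 _
    have hd := ((hcont.integral_hasStrictDerivAt 0 (s / S)).hasDerivAt.scomp s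
      ((hasDerivAt_id s).div_const S)).const_smul S |>.const_add x
    have hval : f (φ s x) = S • (1 / S) • f (extendIcc (G (S, x)) (s / S)) := by
      rw [extendIcc_of_mem _ (hmem s hsS), ← hrescale (S, x) hp _ (hmem s hsS), smul_smul,
        mul_one_div_cancel hS0.ne', one_smul]
      simp only [div_mul_cancel₀ _ hS0.ne']
    rw [hval]
    refine hd.congr_of_eventuallyEq ?_
    filter_upwards [(continuous_abs.isOpen_preimage _ isOpen_Iio).mem_nhds
      (show s ∈ abs ⁻¹' Iio S from hsS)] with s' hs'
    exact hφS s' hs'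

end SmoothFlow

/-! ### Linear equations and continuation along connected sets -/

section LinearODE

variable {E : Type*} [NormedAddCommGroup E] [NormedSpace ℝ E]

/-- Solutions of a linear equation `u' = A(t) u` on a neighbourhood of `t₀` which vanish at some
time in a suitable interval vanish on this interval. -/
theorem exists_forall_linear_ode_eq_zero {A : ℝ → E →L[ℝ] E} {t₀ : ℝ} (hA : ContinuousAt A t₀)
    {u : ℝ → E} (hu : ∀ᶠ t in 𝓝 t₀, HasDerivAt u (A t (u t)) t) :
    ∃ δ > 0, ∀ t ∈ Ioo (t₀ - δ) (t₀ + δ), u t = 0 → ∀ t' ∈ Ioo (t₀ - δ) (t₀ + δ), u t' = 0 := by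
  have hb : ∀ᶠ t in 𝓝 t₀, ‖A t‖ < ‖A t₀‖ + 1 :=
    hA.norm.eventually_lt continuousAt_const (by linarith)
  obtain ⟨δ, hδ, h⟩ := Metric.mem_nhds_iff.1 (hb.and hu)
  rw [Real.ball_eq_Ioo] at h
  refine ⟨δ, hδ, fun t ht hut t' ht' => ?_⟩
  have hK : 0 ≤ ‖A t₀‖ + 1 := by positivity
  -- Comparison with the zero solution; `‖A t₀‖ + 1` is a Lipschitz constant near `t₀` by continuity
  -- of `A`.
  exact ODE_solution_unique_of_mem_Ioo (v := fun t y => A t y) (s := fun _ => univ)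
    (K := ⟨‖A t₀‖ + 1, hK⟩) (f := u) (g := fun _ => 0)
    (fun s hs => ((A s).lipschitz.weaken (by exact_mod_cast (h hs).1.le)).lipschitzOnWith)
    ht (fun s hs => ⟨(h hs).2, mem_univ _⟩)
    (fun s _ => ⟨by rw [map_zero]; exact hasDerivAt_const s 0, mem_univ _⟩) hut ht'

end LinearODE

/-- A property of points of a preconnected set holds everywhere if it holds somewhere and if near
each point it holds everywhere or nowhere. -/
theorem IsPreconnected.forall_of_locally {X : Type*} [TopologicalSpace X] {J : Set X}
    (hJ : IsPreconnected J) {P : X → Prop} {x₀ : X} (hx₀ : x₀ ∈ J) (h₀ : P x₀)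
    (hloc : ∀ x ∈ J, ∃ V ∈ 𝓝 x, ∀ y ∈ V, P y → ∀ z ∈ V, P z) : ∀ x ∈ J, P x := by
  have h := hJ.subset_of_closure_inter_subset (u := interior {x | P x}) isOpen_interior ?_ ?_
  · exact fun x hx => interior_subset (h hx)
  · obtain ⟨V, hV, h⟩ := hloc x₀ hx₀
    exact ⟨x₀, hx₀, mem_interior_iff_mem_nhds.2
      (Filter.mem_of_superset hV fun z hz => h x₀ (mem_of_mem_nhds hV) h₀ z hz)⟩
  · rintro x ⟨hx, hxJ⟩
    obtain ⟨V, hV, h⟩ := hloc x hxJ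
    obtain ⟨y, hyV, hy⟩ := mem_closure_iff_nhds.1 hx V hV
    exact mem_interior_iff_mem_nhds.2
      (Filter.mem_of_superset hV fun z hz => h y hyV (interior_subset hy) z hz)

/-! ### Coordinates on manifolds and on their tangent bundles -/

section SmoothChart

variable {A : Type*} [NormedAddCommGroup A] [NormedSpace ℝ A]
  {H : Type*} [TopologicalSpace H] (I : ModelWithCorners ℝ A H)
  (N : Type*) [TopologicalSpace N] [ChartedSpace H N]
  (A' : Type*) [NormedAddCommGroup A'] [NormedSpace ℝ A']

/-- Local coordinates on the manifold `N` with values in a normed space. -/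
structure SmoothChart extends PartialEquiv N A' where
  open_source : IsOpen source
  open_target : IsOpen target
  contMDiffOn_toFun : ContMDiffOn I 𝓘(ℝ, A') ∞ toFun source
  contMDiffOn_invFun : ContMDiffOn 𝓘(ℝ, A') I ∞ invFun target

namespace SmoothChart

/-- The extended charts of a manifold without boundary. -/
def ofPoint {I : ModelWithCorners ℝ A H} [I.Boundaryless] {N : Type*} [TopologicalSpace N]
    [ChartedSpace H N] [IsManifold I ∞ N] (x : N) : SmoothChart I N A where
  toPartialEquiv := extChartAt I x
  open_source := isOpen_extChartAt_source x
  open_target := isOpen_extChartAt_target x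
  contMDiffOn_toFun := by
    rw [extChartAt_source]; exact contMDiffOn_extChartAt
  contMDiffOn_invFun := contMDiffOn_extChartAt_symm x

variable {I N A'} (c : SmoothChart I N A')

theorem contMDiffAt {x : N} (hx : x ∈ c.source) :
    ContMDiffAt I 𝓘(ℝ, A') ∞ c.toPartialEquiv x :=
  c.contMDiffOn_toFun.contMDiffAt (c.open_source.mem_nhds hx)

theorem contMDiffAt_symm {y : A'} (hy : y ∈ c.target) :
    ContMDiffAt 𝓘(ℝ, A') I ∞ c.toPartialEquiv.symm y :=
  c.contMDiffOn_invFun.contMDiffAt (c.open_target.mem_nhds hy)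

theorem mdifferentiableAt {x : N} (hx : x ∈ c.source) :
    MDifferentiableAt I 𝓘(ℝ, A') c.toPartialEquiv x :=
  (c.contMDiffAt hx).mdifferentiableAt (by simp)

theorem mdifferentiableAt_symm {y : A'} (hy : y ∈ c.target) :
    MDifferentiableAt 𝓘(ℝ, A') I c.toPartialEquiv.symm y :=
  (c.contMDiffAt_symm hy).mdifferentiableAt (by simp)

section Maps

variable {A₁ : Type*} [NormedAddCommGroup A₁] [NormedSpace ℝ A₁]
  {H₁ : Type*} [TopologicalSpace H₁] {I₁ : ModelWithCorners ℝ A₁ H₁}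
  {N₁ : Type*} [TopologicalSpace N₁] [ChartedSpace H₁ N₁]

theorem eventually_symm_comp {f : N₁ → N} {x : N₁} (hf : ContinuousAt f x) (hx : f x ∈ c.source) :
    f =ᶠ[𝓝 x] c.toPartialEquiv.symm ∘ (c.toPartialEquiv ∘ f) := by
  filter_upwards [hf.preimage_mem_nhds (c.open_source.mem_nhds hx)] with y hy
  exact (c.left_inv hy).symm

/-- Here continuity of `f` is a conclusion. It is needed for maps known only through their
coordinates, such as `s ↦ fibreDeriv (φ s) p`. -/
theorem continuousAt_of_comp {X : Type*} [TopologicalSpace X] {f : X → N} {x : X}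
    (hx : ∀ᶠ y in 𝓝 x, f y ∈ c.source) (h : ContinuousAt (c.toPartialEquiv ∘ f) x) :
    ContinuousAt f x := by
  have h1 : ContinuousAt (c.toPartialEquiv.symm ∘ (c.toPartialEquiv ∘ f)) x :=
    ContinuousAt.comp (c.contMDiffAt_symm (c.map_source hx.self_of_nhds)).continuousAt h
  refine h1.congr ?_
  filter_upwards [hx] with y hy using c.left_inv hy

theorem contMDiffAt_of_comp {f : N₁ → N} {x : N₁} (hf : ContinuousAt f x) (hx : f x ∈ c.source)
    (h : ContMDiffAt I₁ 𝓘(ℝ, A') ∞ (c.toPartialEquiv ∘ f) x) : ContMDiffAt I₁ I ∞ f x :=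
  ((c.contMDiffAt_symm (c.map_source hx)).comp x h).congr_of_eventuallyEq
    (c.eventually_symm_comp hf hx)

theorem mdifferentiableAt_of_comp {f : N₁ → N} {x : N₁} (hf : ContinuousAt f x)
    (hx : f x ∈ c.source) (h : MDifferentiableAt I₁ 𝓘(ℝ, A') (c.toPartialEquiv ∘ f) x) :
    MDifferentiableAt I₁ I f x :=
  ((c.mdifferentiableAt_symm (c.map_source hx)).comp x h).congr_of_eventuallyEq
    (c.eventually_symm_comp hf hx)

theorem contMDiffAt_comp {f : N₁ → N} {x : N₁} (hx : f x ∈ c.source)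
    (hf : ContMDiffAt I₁ I ∞ f x) : ContMDiffAt I₁ 𝓘(ℝ, A') ∞ (c.toPartialEquiv ∘ f) x :=
  (c.contMDiffAt hx).comp x hf

end Maps

/-- The coordinates of a tangent vector: those of its base point and its components. -/
def tmap (z : TangentBundle I N) : A' × A' :=
  (c.toPartialEquiv z.proj, mfderiv I 𝓘(ℝ, A') c.toPartialEquiv z.proj z.2)

@[simp] theorem tmap_fst (z : TangentBundle I N) : (c.tmap z).1 = c.toPartialEquiv z.proj := rfl

/-- The tangent vector with given coordinates. -/
def tinv (q : A' × A') : TangentBundle I N :=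
  tangentMap 𝓘(ℝ, A') I c.toPartialEquiv.symm ⟨q.1, q.2⟩

@[simp] theorem tinv_proj (q : A' × A') : (c.tinv q).proj = c.toPartialEquiv.symm q.1 := rfl

theorem tinv_tmap {z : TangentBundle I N} (hz : z.proj ∈ c.source) : c.tinv (c.tmap z) = z := by
  have h1 : tangentMap 𝓘(ℝ, A') I c.toPartialEquiv.symm
      (tangentMap I 𝓘(ℝ, A') c.toPartialEquiv z) = z := by
    rw [← tangentMap_comp_at z (c.mdifferentiableAt_symm (c.map_source hz))
      (c.mdifferentiableAt hz)]
    have : tangentMap I I (c.toPartialEquiv.symm ∘ c.toPartialEquiv) z =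
        tangentMap I I id z := by
      have he : (c.toPartialEquiv.symm ∘ c.toPartialEquiv) =ᶠ[𝓝 z.proj] id := by
        filter_upwards [c.open_source.mem_nhds hz] with y hy using c.left_inv hy
      simp only [tangentMap, he.mfderiv_eq]
      rw [he.eq_of_nhds]
    rw [this, tangentMap_id, id]
  exact h1

theorem tmap_tinv {q : A' × A'} (hq : q.1 ∈ c.target) : c.tmap (c.tinv q) = q := by
  have h1 : tangentMap I 𝓘(ℝ, A') c.toPartialEquiv
      (tangentMap 𝓘(ℝ, A') I c.toPartialEquiv.symm ⟨q.1, q.2⟩) = ⟨q.1, q.2⟩ := by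
    rw [← tangentMap_comp_at _ (c.mdifferentiableAt (c.map_target hq))
      (c.mdifferentiableAt_symm hq)]
    have : tangentMap 𝓘(ℝ, A') 𝓘(ℝ, A') (c.toPartialEquiv ∘ c.toPartialEquiv.symm) ⟨q.1, q.2⟩ =
        tangentMap 𝓘(ℝ, A') 𝓘(ℝ, A') id ⟨q.1, q.2⟩ := by
      have he : (c.toPartialEquiv ∘ c.toPartialEquiv.symm) =ᶠ[𝓝 q.1] id := by
        filter_upwards [c.open_target.mem_nhds hq] with y hy using c.right_inv hy
      simp only [tangentMap, he.mfderiv_eq]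
      rw [he.eq_of_nhds]
    rw [this, tangentMap_id, id]
  exact congrArg (fun z : TangentBundle 𝓘(ℝ, A') A' => ((z.proj, z.2) : A' × A')) h1

/-- Equality of tangent vectors, including that of their base points, reduces to equality of
coordinates; this avoids transport between tangent spaces. -/
theorem tmap_injOn {z z' : TangentBundle I N} (hz : z.proj ∈ c.source) (hz' : z'.proj ∈ c.source)
    (h : c.tmap z = c.tmap z') : z = z' := by
  rw [← c.tinv_tmap hz, h, c.tinv_tmap hz']

/-- The coordinates on the tangent bundle induced by coordinates on a manifold. -/
def tangent [IsManifold I ∞ N] : SmoothChart I.tangent (TangentBundle I N) (A' × A') where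
  toFun := c.tmap
  invFun := c.tinv
  source := TotalSpace.proj ⁻¹' c.source
  target := c.target ×ˢ univ
  map_source' := fun z hz => ⟨c.map_source hz, mem_univ _⟩
  map_target' := fun q hq => c.map_target hq.1
  left_inv' := fun z hz => c.tinv_tmap hz
  right_inv' := fun q hq => c.tmap_tinv hq.1
  open_source := c.open_source.preimage (FiberBundle.continuous_proj A _)
  open_target := c.open_target.prod isOpen_univ
  contMDiffOn_toFun := by
    have h : ContMDiffOn I.tangent 𝓘(ℝ, A').tangent ∞
        (tangentMapWithin I 𝓘(ℝ, A') c.toPartialEquiv c.source) (TotalSpace.proj ⁻¹' c.source) :=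
      c.contMDiffOn_toFun.contMDiffOn_tangentMapWithin (by simp) c.open_source.uniqueMDiffOn
    intro z hz
    have h1 : ContMDiffAt I.tangent 𝓘(ℝ, A').tangent ∞ (tangentMap I 𝓘(ℝ, A') c.toPartialEquiv) z :=
      (h.contMDiffAt ((c.open_source.preimage (FiberBundle.continuous_proj A _)).mem_nhds
        hz)).congr_of_eventuallyEq (by
        filter_upwards [(c.open_source.preimage (FiberBundle.continuous_proj A _)).mem_nhds hz]
          with y hy
        exact (tangentMapWithin_eq_tangentMap (c.open_source.uniqueMDiffOn _ hy)
          (c.mdifferentiableAt hy)).symm)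
    have h2 : ContMDiffAt I.tangent 𝓘(ℝ, A') ∞ (fun z => (c.tmap z).2) z :=
      (contMDiff_snd_tangentBundle_modelSpace A' 𝓘(ℝ, A')).contMDiffAt.comp z h1
    have h3 : ContMDiffAt I.tangent 𝓘(ℝ, A') ∞ (fun z => (c.tmap z).1) z :=
      (c.contMDiffAt hz).comp z (contMDiffAt_proj _)
    exact (h3.prodMk_space h2).contMDiffWithinAt
  contMDiffOn_invFun := by
    have h : ContMDiffOn 𝓘(ℝ, A').tangent I.tangent ∞
        (tangentMapWithin 𝓘(ℝ, A') I c.toPartialEquiv.symm c.target)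
        (TotalSpace.proj ⁻¹' c.target) :=
      c.contMDiffOn_invFun.contMDiffOn_tangentMapWithin (by simp) c.open_target.uniqueMDiffOn
    intro q hq
    have hopen := c.open_target.preimage
      (FiberBundle.continuous_proj A' (TangentSpace 𝓘(ℝ, A') : A' → Type _))
    -- The identification of `A' × A'` with the tangent bundle of the vector space `A'` is smooth.
    have h0 : ContMDiff 𝓘(ℝ, A' × A') 𝓘(ℝ, A').tangent ∞
        (fun q : A' × A' => (⟨q.1, q.2⟩ : TangentBundle 𝓘(ℝ, A') A')) := by
      intro q
      rw [contMDiffAt_totalSpace]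
      refine ⟨(contDiff_fst.contMDiff).contMDiffAt, ?_⟩
      convert! (contDiff_snd (𝕜 := ℝ) (E := A') (F := A') (n := ∞)).contMDiff.contMDiffAt
      simp
      rfl
    have h1 : ContMDiffAt 𝓘(ℝ, A').tangent I.tangent ∞
        (tangentMap 𝓘(ℝ, A') I c.toPartialEquiv.symm) ⟨q.1, q.2⟩ :=
      (h.contMDiffAt (hopen.mem_nhds hq.1)).congr_of_eventuallyEq (by
        filter_upwards [hopen.mem_nhds hq.1] with y hy
        exact (tangentMapWithin_eq_tangentMap (c.open_target.uniqueMDiffOn _ hy)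
          (c.mdifferentiableAt_symm hy)).symm)
    exact (h1.comp q (h0 q)).contMDiffWithinAt

section TangentMaps

variable {A₁ : Type*} [NormedAddCommGroup A₁] [NormedSpace ℝ A₁]
  {H₁ : Type*} [TopologicalSpace H₁] {I₁ : ModelWithCorners ℝ A₁ H₁}
  {N₁ : Type*} [TopologicalSpace N₁] [ChartedSpace H₁ N₁]
  {A₁' : Type*} [NormedAddCommGroup A₁'] [NormedSpace ℝ A₁'] (c₁ : SmoothChart I₁ N₁ A₁')

/-- The chain rule in charts. Differentiability of `f` itself follows from its continuity and from
that of its coordinate expression `g`. -/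
theorem tmap_tangentMap {f : N → N₁} {g : A' → A₁'} {g' : A' →L[ℝ] A₁'} {z : TangentBundle I N}
    (hz : z.proj ∈ c.source) (hf : ContinuousAt f z.proj) (hfz : f z.proj ∈ c₁.source)
    (hfg : ∀ᶠ y in 𝓝 z.proj, c₁.toPartialEquiv (f y) = g (c.toPartialEquiv y))
    (hg : HasFDerivAt g g' (c.toPartialEquiv z.proj)) :
    c₁.tmap (tangentMap I I₁ f z) = (g (c.tmap z).1, g' (c.tmap z).2) := by
  have hgc : MDifferentiableAt I 𝓘(ℝ, A₁') (g ∘ c.toPartialEquiv) z.proj :=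
    hg.differentiableAt.mdifferentiableAt.comp z.proj (c.mdifferentiableAt hz)
  have hev : c₁.toPartialEquiv ∘ f =ᶠ[𝓝 z.proj] g ∘ c.toPartialEquiv := hfg
  have hfd : MDifferentiableAt I I₁ f z.proj :=
    c₁.mdifferentiableAt_of_comp hf hfz (hgc.congr_of_eventuallyEq hev)
  have h1 : tangentMap I₁ 𝓘(ℝ, A₁') c₁.toPartialEquiv (tangentMap I I₁ f z) =
      tangentMap 𝓘(ℝ, A') 𝓘(ℝ, A₁') g (tangentMap I 𝓘(ℝ, A') c.toPartialEquiv z) := by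
    rw [← tangentMap_comp_at z (c₁.mdifferentiableAt hfz) hfd,
      ← tangentMap_comp_at z hg.differentiableAt.mdifferentiableAt (c.mdifferentiableAt hz)]
    simp only [tangentMap, hev.mfderiv_eq]
    rw [hev.eq_of_nhds]
  have h2 := congrArg (fun z : TangentBundle 𝓘(ℝ, A₁') A₁' => ((z.proj, z.2) : A₁' × A₁')) h1
  refine h2.trans (Prod.ext rfl ?_)
  change mfderiv 𝓘(ℝ, A') 𝓘(ℝ, A₁') g (c.toPartialEquiv z.proj) (c.tmap z).2 = g' (c.tmap z).2
  rw [mfderiv_eq_fderiv, hg.fderiv]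
  rfl

theorem tmap_velocity {γ : ℝ → N} {t : ℝ} {v : A'} (hγ : ContinuousAt γ t)
    (ht : γ t ∈ c.source) (hv : HasDerivAt (c.toPartialEquiv ∘ γ) v t) :
    c.tmap (velocity I γ t) = (c.toPartialEquiv (γ t), v) := by
  have hd : MDifferentiableAt 𝓘(ℝ, ℝ) I γ t :=
    c.mdifferentiableAt_of_comp hγ ht hv.differentiableAt.mdifferentiableAt
  have h1 : tangentMap I 𝓘(ℝ, A') c.toPartialEquiv (velocity I γ t) =
      tangentMap 𝓘(ℝ, ℝ) 𝓘(ℝ, A') (c.toPartialEquiv ∘ γ) ⟨t, (1 : ℝ)⟩ := by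
    rw [velocity, ← tangentMap_comp_at _ (c.mdifferentiableAt ht) hd]
  have h2 := congrArg (fun z : TangentBundle 𝓘(ℝ, A') A' => ((z.proj, z.2) : A' × A')) h1
  refine h2.trans (Prod.ext rfl ?_)
  change mfderiv 𝓘(ℝ, ℝ) 𝓘(ℝ, A') (c.toPartialEquiv ∘ γ) t (1 : ℝ) = v
  rw [mfderiv_eq_fderiv, hv.hasFDerivAt.fderiv]
  exact one_smul ℝ v

theorem hasDerivAt_comp {γ : ℝ → N} {t : ℝ} (hγ : MDifferentiableAt 𝓘(ℝ, ℝ) I γ t)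
    (ht : γ t ∈ c.source) :
    HasDerivAt (c.toPartialEquiv ∘ γ) (c.tmap (velocity I γ t)).2 t := by
  have h : DifferentiableAt ℝ (c.toPartialEquiv ∘ γ) t :=
    mdifferentiableAt_iff_differentiableAt.1 ((c.mdifferentiableAt ht).comp t hγ)
  rw [c.tmap_velocity hγ.continuousAt ht h.hasDerivAt]
  exact h.hasDerivAt

theorem tangent_tmap_injOn [IsManifold I ∞ N] {z z' : TangentBundle I.tangent (TangentBundle I N)}
    (hz : z.proj.proj ∈ c.source) (hz' : z'.proj.proj ∈ c.source)
    (h : c.tangent.tmap z = c.tangent.tmap z') : z = z' :=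
  c.tangent.tmap_injOn hz hz' h

/-- Computes velocities in the second tangent bundle, as they occur in `tauVerticalLift` and
`linLift`. -/
theorem tangent_tmap_velocity [IsManifold I ∞ N] {γ : ℝ → TangentBundle I N} {t : ℝ}
    {g : ℝ → A' × A'} {v : A' × A'} (hs : ∀ᶠ s in 𝓝 t, (γ s).proj ∈ c.source)
    (hg : ∀ᶠ s in 𝓝 t, c.tmap (γ s) = g s) (hv : HasDerivAt g v t) :
    c.tangent.tmap (velocity I.tangent γ t) = (g t, v) := by
  have hd : HasDerivAt (c.tangent.toPartialEquiv ∘ γ) v t := hv.congr_of_eventuallyEq hg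
  rw [c.tangent.tmap_velocity (c.tangent.continuousAt_of_comp hs hd.continuousAt)
    hs.self_of_nhds hd, ← hg.self_of_nhds]
  rfl

end TangentMaps

end SmoothChart

end SmoothChart

/-! ### Adapted charts of `E` and of `π^*E` -/

section BundleCharts

variable {B : Type*} [NormedAddCommGroup B] [NormedSpace ℝ B]
  {M : Type*} [TopologicalSpace M] [ChartedSpace B M] [IsManifold 𝓘(ℝ, B) ∞ M]
  {F : Type*} [NormedAddCommGroup F] [NormedSpace ℝ F]
  {E : M → Type*} [∀ m, AddCommMonoid (E m)] [∀ m, Module ℝ (E m)]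
  [∀ m, TopologicalSpace (E m)] [TopologicalSpace (TotalSpace F E)]
  [FiberBundle F E] [VectorBundle ℝ F E] [ContMDiffVectorBundle ∞ F E 𝓘(ℝ, B)]

variable (B) in
/-- The preferred chart of the base at `m`. -/
def baseChart (m : M) : SmoothChart 𝓘(ℝ, B) M B := .ofPoint m

variable (B F E) in
/-- The chart of the total space given by the preferred chart and trivialization at `m`. -/
def bundleChart (m : M) : SmoothChart (𝓘(ℝ, B).prod 𝓘(ℝ, F)) (TotalSpace F E) (B × F) :=
  .ofPoint ⟨m, 0⟩

variable (B F E) in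
/-- The chart of the pullback bundle given by the preferred chart and trivialization at `m`. -/
def pullbackChart (m : M) : SmoothChart ((𝓘(ℝ, B).prod 𝓘(ℝ, F)).prod 𝓘(ℝ, F))
    (PullbackTotal 𝓘(ℝ, B) F E) ((B × F) × F) :=
  .ofPoint ⟨⟨m, 0⟩, 0⟩

/-- The condition involves only the base point: the domain is a union of whole fibres, so moving
within a fibre never leaves the chart. -/
theorem mem_bundleChart_source {m : M} {a : TotalSpace F E} :
    a ∈ (bundleChart B F E m).source ↔
      a.proj ∈ (baseChart B m).source ∧ a.proj ∈ (trivializationAt F E m).baseSet := by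
  simp only [bundleChart, baseChart, SmoothChart.ofPoint, FiberBundle.extChartAt]
  constructor
  · rintro ⟨h1, h2, -⟩
    have h3 := (Trivialization.mem_source _).1 h1
    exact ⟨by rw [← Trivialization.coe_fst' _ h3]; exact h2, h3⟩
  · rintro ⟨h1, h2⟩
    refine ⟨(Trivialization.mem_source _).2 h2, ?_, mem_univ _⟩
    rw [← Trivialization.coe_fst' _ h2] at h1
    exact h1

theorem bundleChart_apply {m : M} {a : TotalSpace F E} (ha : a ∈ (bundleChart B F E m).source) :
    (bundleChart B F E m).toPartialEquiv a =
      ((baseChart B m).toPartialEquiv a.proj, (trivializationAt F E m a).2) := by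
  have h := (mem_bundleChart_source.1 ha).2
  simp only [bundleChart, baseChart, SmoothChart.ofPoint, FiberBundle.extChartAt]
  refine Prod.ext ?_ rfl
  exact congrArg (extChartAt 𝓘(ℝ, B) m) (Trivialization.coe_fst' _ h)

theorem mem_bundleChart_target {m : M} {z : B × F} :
    z ∈ (bundleChart B F E m).target ↔ z.1 ∈ (baseChart B m).target ∧
      (baseChart B m).toPartialEquiv.symm z.1 ∈ (trivializationAt F E m).baseSet := by
  simp only [bundleChart, baseChart, SmoothChart.ofPoint, FiberBundle.extChartAt_target]
  exact ⟨fun h => ⟨h.1.1, h.1.2⟩, fun h => ⟨⟨h.1, h.2⟩, mem_univ _⟩⟩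

theorem mem_pullbackChart_source {m : M} {p : PullbackTotal 𝓘(ℝ, B) F E} :
    p ∈ (pullbackChart B F E m).source ↔ p.proj ∈ (bundleChart B F E m).source := by
  simp only [pullbackChart, bundleChart, SmoothChart.ofPoint, FiberBundle.extChartAt]
  constructor
  · rintro ⟨h1, h2, -⟩
    have h3 := (Trivialization.mem_source _).1 h1
    rw [← Trivialization.coe_fst' _ h3]
    exact h2
  · intro h
    have h3 : p.proj ∈ (trivializationAt F (projMap 𝓘(ℝ, B) F E *ᵖ E) ⟨m, 0⟩).baseSet :=
      (Trivialization.mem_source (trivializationAt F E m)).1 h.1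
    refine ⟨(Trivialization.mem_source _).2 h3, ?_, mem_univ _⟩
    rw [← Trivialization.coe_fst' _ h3] at h
    exact h

theorem pullbackChart_apply {m : M} {p : PullbackTotal 𝓘(ℝ, B) F E}
    (hp : p.proj ∈ (bundleChart B F E m).source) :
    (pullbackChart B F E m).toPartialEquiv p =
      ((bundleChart B F E m).toPartialEquiv p.proj, (trivializationAt F E m (snd p)).2) := by
  simp only [pullbackChart, bundleChart, SmoothChart.ofPoint]
  rw [FiberBundle.extChartAt]
  refine Prod.ext ?_ rfl
  have h3 : p.proj ∈ (trivializationAt F (projMap 𝓘(ℝ, B) F E *ᵖ E) ⟨m, 0⟩).baseSet :=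
    (mem_bundleChart_source.1 hp).2
  exact congrArg (extChartAt (𝓘(ℝ, B).prod 𝓘(ℝ, F)) (⟨m, 0⟩ : TotalSpace F E))
    (Trivialization.coe_fst' _ h3)

theorem mem_bundleChart_self (a : TotalSpace F E) : a ∈ (bundleChart B F E a.proj).source :=
  mem_bundleChart_source.2 ⟨mem_extChartAt_source _, mem_baseSet_trivializationAt F E _⟩

theorem mem_pullbackChart_target {m : M} {z : (B × F) × F} :
    z ∈ (pullbackChart B F E m).target ↔ z.1 ∈ (bundleChart B F E m).target := by
  simp only [pullbackChart, bundleChart, SmoothChart.ofPoint]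
  rw [FiberBundle.extChartAt_target]
  simp only [mem_prod, mem_inter_iff, mem_univ, and_true, mem_preimage, and_iff_left_iff_imp]
  intro h
  exact (mem_bundleChart_source.1 ((bundleChart B F E m).map_target h)).2

-- From here on the charts enter only through the coordinate formulas above.
attribute [irreducible] baseChart bundleChart pullbackChart

theorem bundleChart_symm_proj {m : M} {z : B × F} (hz : z ∈ (bundleChart B F E m).target) :
    ((bundleChart B F E m).toPartialEquiv.symm z).proj =
      (baseChart B m).toPartialEquiv.symm z.1 := by
  have h := (bundleChart B F E m).map_target hz
  have h1 := bundleChart_apply h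
  have h2 : (bundleChart B F E m).toPartialEquiv ((bundleChart B F E m).toPartialEquiv.symm z) = z :=
    (bundleChart B F E m).right_inv hz
  rw [h2] at h1
  rw [congrArg Prod.fst h1]
  exact ((baseChart B m).left_inv (mem_bundleChart_source.1 h).1).symm

theorem mk_mem_bundleChart_target {m : M} {x : B} {y : F} (y' : F)
    (h : (x, y) ∈ (bundleChart B F E m).target) : (x, y') ∈ (bundleChart B F E m).target := by
  rw [mem_bundleChart_target] at h ⊢
  exact h

/-! ### Fibrewise operations and the vertical lift in coordinates -/

section Fibre

variable {m : M} {p : PullbackTotal 𝓘(ℝ, B) F E}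

theorem snd_mem_source (hp : p.proj ∈ (bundleChart B F E m).source) :
    snd p ∈ (bundleChart B F E m).source := by
  rw [mem_bundleChart_source] at hp ⊢
  exact hp

theorem addSMul_mem_source (s : ℝ) (hp : p.proj ∈ (bundleChart B F E m).source) :
    addSMul s p ∈ (bundleChart B F E m).source := by
  rw [mem_bundleChart_source] at hp ⊢
  exact hp

theorem bundleChart_snd (hp : p.proj ∈ (bundleChart B F E m).source) :
    (bundleChart B F E m).toPartialEquiv (snd p) =
      (((pullbackChart B F E m).toPartialEquiv p).1.1,
        ((pullbackChart B F E m).toPartialEquiv p).2) := by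
  rw [pullbackChart_apply hp, bundleChart_apply hp, bundleChart_apply (snd_mem_source hp)]
  rfl

theorem pullbackChart_fst (hp : p.proj ∈ (bundleChart B F E m).source) :
    ((pullbackChart B F E m).toPartialEquiv p).1 = (bundleChart B F E m).toPartialEquiv p.proj := by
  rw [pullbackChart_apply hp]

theorem trivialization_addSMul (s : ℝ) (hp : p.proj.proj ∈ (trivializationAt F E m).baseSet) :
    (trivializationAt F E m (addSMul s p)).2 =
      (trivializationAt F E m p.proj).2 + s • (trivializationAt F E m (snd p)).2 := by
  have h := (trivializationAt F E m).linear ℝ hp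
  have h1 : (trivializationAt F E m (addSMul s p)).2 = _ :=
    h.map_add p.proj.2 (s • (show E p.proj.proj from p.2))
  rw [h1, h.map_smul]
  rfl

theorem bundleChart_addSMul (s : ℝ) (hp : p.proj ∈ (bundleChart B F E m).source) :
    (bundleChart B F E m).toPartialEquiv (addSMul s p) =
      (((pullbackChart B F E m).toPartialEquiv p).1.1,
        ((pullbackChart B F E m).toPartialEquiv p).1.2 +
          s • ((pullbackChart B F E m).toPartialEquiv p).2) := by
  rw [pullbackChart_apply hp, bundleChart_apply hp, bundleChart_apply (addSMul_mem_source s hp),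
    trivialization_addSMul s (mem_bundleChart_source.1 hp).2]
  rfl

theorem addSMul_zero (p : PullbackTotal 𝓘(ℝ, B) F E) : addSMul 0 p = p.proj := by
  have hp := mem_bundleChart_self (B := B) p.proj
  refine (bundleChart B F E _).injOn (addSMul_mem_source 0 hp) hp ?_
  rw [bundleChart_addSMul 0 hp, zero_smul, add_zero, pullbackChart_fst hp]

theorem continuous_snd_pullback :
    Continuous (snd : PullbackTotal 𝓘(ℝ, B) F E → TotalSpace F E) :=
  Pullback.continuous_lift F E (projMap 𝓘(ℝ, B) F E)

theorem contMDiff_addSMul :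
    ContMDiff (𝓘(ℝ, ℝ).prod ((𝓘(ℝ, B).prod 𝓘(ℝ, F)).prod 𝓘(ℝ, F))) (𝓘(ℝ, B).prod 𝓘(ℝ, F)) ∞
      (fun q : ℝ × PullbackTotal 𝓘(ℝ, B) F E => addSMul q.1 q.2) := by
  rintro ⟨s, p⟩
  have hp := mem_bundleChart_self (B := B) p.proj
  have hs : ∀ᶠ q : ℝ × PullbackTotal 𝓘(ℝ, B) F E in 𝓝 (s, p),
      q.2.proj ∈ (bundleChart B F E p.proj.proj).source :=
    ((FiberBundle.continuous_proj F _).comp continuous_snd).continuousAt.preimage_mem_nhds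
      ((bundleChart B F E p.proj.proj).open_source.mem_nhds hp)
  have hc : ContMDiffAt (𝓘(ℝ, ℝ).prod ((𝓘(ℝ, B).prod 𝓘(ℝ, F)).prod 𝓘(ℝ, F)))
      𝓘(ℝ, (B × F) × F) ∞ (fun q : ℝ × PullbackTotal 𝓘(ℝ, B) F E =>
        (pullbackChart B F E p.proj.proj).toPartialEquiv q.2) (s, p) :=
    ContMDiffAt.comp (s, p) ((pullbackChart B F E p.proj.proj).contMDiffAt
      (mem_pullbackChart_source.2 hp)) contMDiffAt_snd
  have hfst : ContMDiffAt (𝓘(ℝ, ℝ).prod ((𝓘(ℝ, B).prod 𝓘(ℝ, F)).prod 𝓘(ℝ, F)))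
      𝓘(ℝ, ℝ) ∞ (fun q : ℝ × PullbackTotal 𝓘(ℝ, B) F E => q.1) (s, p) := contMDiffAt_fst
  have hpair := hfst.prodMk_space hc
  have hg : ContDiff ℝ ∞ (fun q : ℝ × ((B × F) × F) => (q.2.1.1, q.2.1.2 + q.1 • q.2.2)) := by
    fun_prop
  have hcomp := hg.contMDiff.contMDiffAt.comp (s, p) hpair
  have hev : (bundleChart B F E p.proj.proj).toPartialEquiv ∘
      (fun q : ℝ × PullbackTotal 𝓘(ℝ, B) F E => addSMul q.1 q.2) =ᶠ[𝓝 (s, p)]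
      (fun q : ℝ × ((B × F) × F) => (q.2.1.1, q.2.1.2 + q.1 • q.2.2)) ∘
        (fun q : ℝ × PullbackTotal 𝓘(ℝ, B) F E =>
          (q.1, (pullbackChart B F E p.proj.proj).toPartialEquiv q.2)) := by
    filter_upwards [hs] with q hq using bundleChart_addSMul q.1 hq
  have h1 := hcomp.congr_of_eventuallyEq hev
  exact (bundleChart B F E p.proj.proj).contMDiffAt_of_comp
    ((bundleChart B F E p.proj.proj).continuousAt_of_comp
      (hs.mono fun q hq => addSMul_mem_source q.1 hq) h1.continuousAt)
    (addSMul_mem_source s hp) h1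

theorem continuous_addSMul (s : ℝ) :
    Continuous (addSMul s : PullbackTotal 𝓘(ℝ, B) F E → TotalSpace F E) :=
  contMDiff_addSMul.continuous.comp (by fun_prop : Continuous fun p => (s, p))

theorem continuous_addSMul_left (p : PullbackTotal 𝓘(ℝ, B) F E) :
    Continuous (fun s : ℝ => addSMul s p) :=
  contMDiff_addSMul.continuous.comp (by fun_prop : Continuous fun s => (s, p))

theorem hasDerivAt_line (x : B) (y y' : F) (s : ℝ) :
    HasDerivAt (fun s : ℝ => (x, y + s • y')) ((0 : B), y') s := by
  refine (hasDerivAt_const s x).prodMk ?_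
  simpa using ((hasDerivAt_id s).smul_const y').const_add y

theorem tmap_verticalLift (hp : p.proj ∈ (bundleChart B F E m).source) :
    (bundleChart B F E m).tmap (verticalLift p) =
      (((pullbackChart B F E m).toPartialEquiv p).1,
        (0, ((pullbackChart B F E m).toPartialEquiv p).2)) := by
  rw [verticalLift, (bundleChart B F E m).tmap_velocity
    (continuous_addSMul_left p).continuousAt (addSMul_mem_source 0 hp)
    (v := (0, ((pullbackChart B F E m).toPartialEquiv p).2))
    ((hasDerivAt_line _ _ _ 0).congr_of_eventuallyEq
      (Filter.Eventually.of_forall fun s => bundleChart_addSMul s hp)),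
    bundleChart_addSMul 0 hp, zero_smul, add_zero]

theorem verticalLift_proj (p : PullbackTotal 𝓘(ℝ, B) F E) : (verticalLift p).proj = p.proj :=
  addSMul_zero p

/-- The coordinates `(x, y; 0, y')` of the lift determine `(x, y, y')`. Hence the `Function.extend`
in `fibreDeriv` is a genuine inverse on vertical vectors. -/
theorem verticalLift_injective :
    Injective (verticalLift : PullbackTotal 𝓘(ℝ, B) F E → _) := by
  intro p q h
  have hpq : p.proj = q.proj := by rw [← verticalLift_proj p, h, verticalLift_proj]
  have hp := mem_bundleChart_self (B := B) p.proj
  have hq : q.proj ∈ (bundleChart B F E p.proj.proj).source := by rw [← hpq]; exact hp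
  refine (pullbackChart B F E p.proj.proj).injOn (mem_pullbackChart_source.2 hp)
    (mem_pullbackChart_source.2 hq) ?_
  have h1 := congrArg (bundleChart B F E p.proj.proj).tmap h
  rw [tmap_verticalLift hp, tmap_verticalLift hq] at h1
  obtain ⟨h2, h3⟩ := Prod.mk.inj h1
  exact Prod.ext h2 (Prod.mk.inj h3).2

end Fibre

/-! ### Tangent maps of the bundle operations in coordinates -/

section TangentCoordinates

variable {m : M}

theorem tmap_tangentMap_snd
    {z : TangentBundle ((𝓘(ℝ, B).prod 𝓘(ℝ, F)).prod 𝓘(ℝ, F)) (PullbackTotal 𝓘(ℝ, B) F E)}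
    (hz : z.proj.proj ∈ (bundleChart B F E m).source) :
    (bundleChart B F E m).tmap (tangentMap ((𝓘(ℝ, B).prod 𝓘(ℝ, F)).prod 𝓘(ℝ, F))
        (𝓘(ℝ, B).prod 𝓘(ℝ, F)) snd z) =
      ((((pullbackChart B F E m).tmap z).1.1.1, ((pullbackChart B F E m).tmap z).1.2),
        (((pullbackChart B F E m).tmap z).2.1.1, ((pullbackChart B F E m).tmap z).2.2)) := by
  have hL := (((ContinuousLinearMap.fst ℝ B F).comp (ContinuousLinearMap.fst ℝ (B × F) F)).prod
    (ContinuousLinearMap.snd ℝ (B × F) F)).hasFDerivAt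
      (x := (pullbackChart B F E m).toPartialEquiv z.proj)
  refine (pullbackChart B F E m).tmap_tangentMap (bundleChart B F E m)
    (mem_pullbackChart_source.2 hz) continuous_snd_pullback.continuousAt (snd_mem_source hz) ?_ hL
  filter_upwards [(pullbackChart B F E m).open_source.mem_nhds (mem_pullbackChart_source.2 hz)]
    with p hp using bundleChart_snd (mem_pullbackChart_source.1 hp)

theorem tmap_tangentMap_proj_pullback
    {z : TangentBundle ((𝓘(ℝ, B).prod 𝓘(ℝ, F)).prod 𝓘(ℝ, F)) (PullbackTotal 𝓘(ℝ, B) F E)}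
    (hz : z.proj.proj ∈ (bundleChart B F E m).source) :
    (bundleChart B F E m).tmap (tangentMap ((𝓘(ℝ, B).prod 𝓘(ℝ, F)).prod 𝓘(ℝ, F))
        (𝓘(ℝ, B).prod 𝓘(ℝ, F)) TotalSpace.proj z) =
      (((pullbackChart B F E m).tmap z).1.1, ((pullbackChart B F E m).tmap z).2.1) := by
  refine (pullbackChart B F E m).tmap_tangentMap (bundleChart B F E m)
    (mem_pullbackChart_source.2 hz) (FiberBundle.continuous_proj F _).continuousAt hz ?_
    (ContinuousLinearMap.fst ℝ (B × F) F).hasFDerivAt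
  filter_upwards [(pullbackChart B F E m).open_source.mem_nhds (mem_pullbackChart_source.2 hz)]
    with p hp using (pullbackChart_fst (mem_pullbackChart_source.1 hp)).symm

theorem tmap_tangentMap_addSMul (s : ℝ)
    {z : TangentBundle ((𝓘(ℝ, B).prod 𝓘(ℝ, F)).prod 𝓘(ℝ, F)) (PullbackTotal 𝓘(ℝ, B) F E)}
    (hz : z.proj.proj ∈ (bundleChart B F E m).source) :
    (bundleChart B F E m).tmap (tangentMap ((𝓘(ℝ, B).prod 𝓘(ℝ, F)).prod 𝓘(ℝ, F))
        (𝓘(ℝ, B).prod 𝓘(ℝ, F)) (addSMul s) z) =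
      ((((pullbackChart B F E m).tmap z).1.1.1,
        ((pullbackChart B F E m).tmap z).1.1.2 + s • ((pullbackChart B F E m).tmap z).1.2),
        (((pullbackChart B F E m).tmap z).2.1.1,
        ((pullbackChart B F E m).tmap z).2.1.2 + s • ((pullbackChart B F E m).tmap z).2.2)) := by
  have hL := (((ContinuousLinearMap.fst ℝ B F).comp (ContinuousLinearMap.fst ℝ (B × F) F)).prod
    (((ContinuousLinearMap.snd ℝ B F).comp (ContinuousLinearMap.fst ℝ (B × F) F)) +
      s • ContinuousLinearMap.snd ℝ (B × F) F)).hasFDerivAt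
      (x := (pullbackChart B F E m).toPartialEquiv z.proj)
  refine (pullbackChart B F E m).tmap_tangentMap (bundleChart B F E m)
    (mem_pullbackChart_source.2 hz) (continuous_addSMul s).continuousAt
    (addSMul_mem_source s hz) ?_ hL
  filter_upwards [(pullbackChart B F E m).open_source.mem_nhds (mem_pullbackChart_source.2 hz)]
    with p hp using bundleChart_addSMul s (mem_pullbackChart_source.1 hp)

theorem tmap_tangentMap_proj {w : TangentBundle (𝓘(ℝ, B).prod 𝓘(ℝ, F)) (TotalSpace F E)}
    (hw : w.proj ∈ (bundleChart B F E m).source) :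
    (baseChart B m).tmap (tangentMap (𝓘(ℝ, B).prod 𝓘(ℝ, F)) 𝓘(ℝ, B) TotalSpace.proj w) =
      (((bundleChart B F E m).tmap w).1.1, ((bundleChart B F E m).tmap w).2.1) := by
  refine (bundleChart B F E m).tmap_tangentMap (baseChart B m) hw
    (FiberBundle.continuous_proj F _).continuousAt (mem_bundleChart_source.1 hw).1 ?_
    (ContinuousLinearMap.fst ℝ B F).hasFDerivAt
  filter_upwards [(bundleChart B F E m).open_source.mem_nhds hw]
    with p hp
  rw [bundleChart_apply hp]
  rfl

/-- The fibre coordinates of `Tπ` are `(y, ẏ)`, while `(x, ẋ)` are those of its base. So the line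
moves with velocity `(y', ẏ')` in the former and zero in the latter. -/
theorem tmap_tauVerticalLift
    {z : TangentBundle ((𝓘(ℝ, B).prod 𝓘(ℝ, F)).prod 𝓘(ℝ, F)) (PullbackTotal 𝓘(ℝ, B) F E)}
    (hz : z.proj.proj ∈ (bundleChart B F E m).source) :
    (bundleChart B F E m).tangent.tmap (tauVerticalLift z) =
      ((((pullbackChart B F E m).tmap z).1.1, ((pullbackChart B F E m).tmap z).2.1),
        ((0, ((pullbackChart B F E m).tmap z).1.2), (0, ((pullbackChart B F E m).tmap z).2.2))) := by
  generalize hq : (pullbackChart B F E m).tmap z = q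
  have hd := (hasDerivAt_line q.1.1.1 q.1.1.2 q.1.2 0).prodMk
    (hasDerivAt_line q.2.1.1 q.2.1.2 q.2.2 0)
  have h := (bundleChart B F E m).tangent_tmap_velocity
    (Filter.Eventually.of_forall fun s => addSMul_mem_source s hz)
    (Filter.Eventually.of_forall fun s => by rw [tmap_tangentMap_addSMul s hz, hq]) hd
  rw [tauVerticalLift, h]
  simp only [zero_smul, add_zero, Prod.mk.eta]

/-- Makes `tauVerticalProj` a genuine inverse followed by a projection on all `Tπ`-vertical vectors.
-/
theorem tauVerticalLift_injective : Injective (tauVerticalLift (I := 𝓘(ℝ, B)) (F := F) (E := E)) := by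
  intro z z' h
  have hproj : ∀ z : TangentBundle ((𝓘(ℝ, B).prod 𝓘(ℝ, F)).prod 𝓘(ℝ, F))
      (PullbackTotal 𝓘(ℝ, B) F E), (tauVerticalLift z).proj.proj = z.proj.proj := fun z =>
    addSMul_zero z.proj
  have hpq : z.proj.proj = z'.proj.proj := by rw [← hproj z, h, hproj]
  have hz := mem_bundleChart_self (B := B) z.proj.proj
  have hz' : z'.proj.proj ∈ (bundleChart B F E z.proj.proj.proj).source := by rw [← hpq]; exact hz
  refine (pullbackChart B F E z.proj.proj.proj).tmap_injOn (mem_pullbackChart_source.2 hz)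
    (mem_pullbackChart_source.2 hz') ?_
  have h1 := congrArg (bundleChart B F E z.proj.proj.proj).tangent.tmap h
  rw [tmap_tauVerticalLift hz, tmap_tauVerticalLift hz'] at h1
  simp only [Prod.mk.injEq, true_and] at h1
  exact Prod.ext (Prod.ext h1.1.1 h1.2.1) (Prod.ext h1.1.2 h1.2.2)

end TangentCoordinates

end BundleCharts

/-! ### Smooth maps into and out of pullback bundles -/

section PullbackSmoothness

variable {A : Type*} [NormedAddCommGroup A] [NormedSpace ℝ A]
  {H : Type*} [TopologicalSpace H] {I : ModelWithCorners ℝ A H}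
  {N : Type*} [TopologicalSpace N] [ChartedSpace H N]
  {A₁ : Type*} [NormedAddCommGroup A₁] [NormedSpace ℝ A₁]
  {H₁ : Type*} [TopologicalSpace H₁] {I₁ : ModelWithCorners ℝ A₁ H₁}
  {N₁ : Type*} [TopologicalSpace N₁] [ChartedSpace H₁ N₁]
  {A₂ : Type*} [NormedAddCommGroup A₂] [NormedSpace ℝ A₂]
  {H₂ : Type*} [TopologicalSpace H₂] {I₂ : ModelWithCorners ℝ A₂ H₂}
  {N₂ : Type*} [TopologicalSpace N₂] [ChartedSpace H₂ N₂]
  {F : Type*} [NormedAddCommGroup F] [NormedSpace ℝ F]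
  {V : N → Type*} [∀ x, AddCommMonoid (V x)]
  [∀ x, TopologicalSpace (V x)] [TopologicalSpace (TotalSpace F V)]
  [FiberBundle F V] (f : C^∞⟮I₁, N₁; I, N⟯)

theorem contMDiff_pullback_lift :
    ContMDiff (I₁.prod 𝓘(ℝ, F)) (I.prod 𝓘(ℝ, F)) ∞
      (Pullback.lift f : TotalSpace F (f *ᵖ V) → TotalSpace F V) := by
  intro q
  have h := contMDiffAt_totalSpace.1 (contMDiffAt_id (I := I₁.prod 𝓘(ℝ, F)) (n := ∞) (x := q))
  rw [contMDiffAt_totalSpace]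
  exact ⟨f.contMDiff.contMDiffAt.comp q (contMDiffAt_proj _), h.2⟩

theorem contMDiffAt_pullback {g : N₂ → TotalSpace F (f *ᵖ V)} {x : N₂}
    (h₁ : ContMDiffAt I₂ I₁ ∞ (fun x => (g x).proj) x)
    (h₂ : ContMDiffAt I₂ (I.prod 𝓘(ℝ, F)) ∞ (fun x => Pullback.lift f (g x)) x) :
    ContMDiffAt I₂ (I₁.prod 𝓘(ℝ, F)) ∞ g x := by
  rw [contMDiffAt_totalSpace] at h₂ ⊢
  exact ⟨h₁, h₂.2⟩

/-- Every tangent space is the model space by definition, so a vector can be re-attached to a point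
that is only propositionally equal to its base point. -/
theorem TangentBundle.mk_eq {x : N} {z : TangentBundle I N} (h : z.proj = x) :
    (⟨x, (show A from z.2)⟩ : TangentBundle I N) = z := by
  subst h
  rfl

end PullbackSmoothness

/-! ### The coefficient `Γ` of a connection and the linearized lift -/

section HorizontalCoordinates

variable {B : Type*} [NormedAddCommGroup B] [NormedSpace ℝ B]
  {M : Type*} [TopologicalSpace M] [ChartedSpace B M] [IsManifold 𝓘(ℝ, B) ∞ M]
  {F : Type*} [NormedAddCommGroup F] [NormedSpace ℝ F]
  {E : M → Type*} [∀ m, AddCommMonoid (E m)] [∀ m, Module ℝ (E m)]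
  [∀ m, TopologicalSpace (E m)] [TopologicalSpace (TotalSpace F E)]
  [FiberBundle F E] [VectorBundle ℝ F E] [ContMDiffVectorBundle ∞ F E 𝓘(ℝ, B)]
  (Hor : EhresmannConnection 𝓘(ℝ, B) F E) (m : M)

namespace EhresmannConnection

/-- The horizontal lift in the chart at `m`, from the base coordinates to the coordinates of the
total space. -/
def liftCoord (z : B × F) : B →L[ℝ] B × F :=
  let f₁ : B →L[ℝ] B := mfderiv 𝓘(ℝ, B) 𝓘(ℝ, B) (baseChart B m).toPartialEquiv.symm z.1
  let f₂ : B →L[ℝ] B × F := Hor.lift ((bundleChart B F E m).toPartialEquiv.symm z)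
  let f₃ : B × F →L[ℝ] B × F := mfderiv (𝓘(ℝ, B).prod 𝓘(ℝ, F)) 𝓘(ℝ, B × F)
    (bundleChart B F E m).toPartialEquiv ((bundleChart B F E m).toPartialEquiv.symm z)
  f₃.comp (f₂.comp f₁)

/-- The coefficient `Γ` of the horizontal lift `(x, y; v) ↦ (v, Γ(x, y) v)` in the chart at `m`. -/
def coeff (z : B × F) : B →L[ℝ] F :=
  (ContinuousLinearMap.snd ℝ B F).comp (Hor.liftCoord m z)

variable {m}

theorem contDiffOn_liftCoord :
    ContDiffOn ℝ ∞ (fun q : (B × F) × B => Hor.liftCoord m q.1 q.2)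
      ((bundleChart B F E m).target ×ˢ univ) := by
  intro q₀ hq₀
  have hopen := (bundleChart B F E m).open_target.prod (isOpen_univ (X := B))
  -- `Q` parametrizes `π^*TM` by the coordinates `(x, y; v)`; composing with it brings `smooth_lift`
  -- into the chart.
  let Q : (B × F) × B → TotalSpace B (projMap 𝓘(ℝ, B) F E *ᵖ (TangentSpace 𝓘(ℝ, B) : M → Type _)) :=
    fun q => ⟨(bundleChart B F E m).toPartialEquiv.symm q.1,
      (show B from ((baseChart B m).tinv (q.1.1, q.2)).2)⟩
  have hQ : ContMDiffAt 𝓘(ℝ, (B × F) × B) ((𝓘(ℝ, B).prod 𝓘(ℝ, F)).prod 𝓘(ℝ, B)) ∞ Q q₀ := by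
    refine contMDiffAt_pullback (projMap 𝓘(ℝ, B) F E) ?_ ?_
    · exact ((bundleChart B F E m).contMDiffAt_symm hq₀.1).comp q₀ contDiff_fst.contMDiff.contMDiffAt
    · have h1 : ContMDiffAt 𝓘(ℝ, B × B) 𝓘(ℝ, B).tangent ∞ (baseChart B m).tinv (q₀.1.1, q₀.2) :=
        (baseChart B m).tangent.contMDiffAt_symm ⟨(mem_bundleChart_target.1 hq₀.1).1, mem_univ _⟩
      have h2 : ContDiff ℝ ∞ (fun q : (B × F) × B => (q.1.1, q.2)) := by fun_prop
      refine (h1.comp q₀ h2.contMDiff.contMDiffAt).congr_of_eventuallyEq ?_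
      filter_upwards [hopen.mem_nhds hq₀] with q hq
      exact TangentBundle.mk_eq (bundleChart_symm_proj hq.1).symm
  have h3 := (bundleChart B F E m).tangent.contMDiffAt_comp
    (f := fun q => (⟨(Q q).proj, Hor.lift (Q q).proj (Q q).2⟩ :
      TangentBundle (𝓘(ℝ, B).prod 𝓘(ℝ, F)) (TotalSpace F E))) (x := q₀)
    ((bundleChart B F E m).map_target hq₀.1) (Hor.smooth_lift.contMDiffAt.comp q₀ hQ)
  exact (contDiff_snd.contDiffAt.comp q₀ h3.contDiffAt).contDiffWithinAt

/-- Joint smoothness of `(z, v) ↦ Γ(z) v` must be upgraded to smoothness in the operator norm. As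
`Γ(z)` is linear, it is its own derivative at `v = 0`, and partial derivatives of smooth maps are
smooth as operators. -/
theorem contDiffOn_coeff : ContDiffOn ℝ ∞ (Hor.coeff m) (bundleChart B F E m).target := by
  have hopen := (bundleChart B F E m).open_target.prod (isOpen_univ (X := B))
  have h := (contDiffOn_infty_iff_fderiv_of_isOpen hopen).1
    (contDiff_snd.comp_contDiffOn (Hor.contDiffOn_liftCoord (m := m)))
  have h0 : ContDiffOn ℝ ∞ (fun z : B × F => (z, (0 : B))) (bundleChart B F E m).target := by
    fun_prop
  have h1 := h.2.comp h0 fun z hz => ⟨hz, mem_univ _⟩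
  refine (h1.clm_comp (contDiffOn_const (c := ContinuousLinearMap.inr ℝ (B × F) B))).congr ?_
  intro z hz
  have h2 := ((h.1.differentiableAt (hopen.mem_nhds (x := (z, (0 : B)))
    ⟨hz, mem_univ _⟩)).hasFDerivAt.comp (0 : B) (hasFDerivAt_prodMk_right z (0 : B)))
  exact (Hor.coeff m z).hasFDerivAt.unique h2

theorem contDiffAt_coeff {z : B × F} (hz : z ∈ (bundleChart B F E m).target) :
    ContDiffAt ℝ ∞ (Hor.coeff m) z :=
  Hor.contDiffOn_coeff.contDiffAt ((bundleChart B F E m).open_target.mem_nhds hz)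

theorem tmap_lift {a : TotalSpace F E} (ha : a ∈ (bundleChart B F E m).source)
    (v : TangentSpace 𝓘(ℝ, B) a.proj) :
    (bundleChart B F E m).tmap ⟨a, Hor.lift a v⟩ =
      ((bundleChart B F E m).toPartialEquiv a, (((baseChart B m).tmap ⟨a.proj, v⟩).2,
        Hor.coeff m ((bundleChart B F E m).toPartialEquiv a)
          ((baseChart B m).tmap ⟨a.proj, v⟩).2)) := by
  have h1 := tmap_tangentMap_proj (w := ⟨a, Hor.lift a v⟩) ha
  have h2 : tangentMap (𝓘(ℝ, B).prod 𝓘(ℝ, F)) 𝓘(ℝ, B) TotalSpace.proj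
      (⟨a, Hor.lift a v⟩ : TangentBundle (𝓘(ℝ, B).prod 𝓘(ℝ, F)) (TotalSpace F E)) =
        ⟨a.proj, v⟩ := congrArg (TotalSpace.mk a.proj) (Hor.proj_lift a v)
  rw [h2] at h1
  refine Prod.ext rfl (Prod.ext (congrArg Prod.snd h1).symm ?_)
  -- `coeff` evaluates the lift at the point recovered from the coordinates of `a`; this replaces
  -- that point and its tangent vector by `a` and `v`.
  have h3 : ∀ (a' : TotalSpace F E) (u : TangentBundle 𝓘(ℝ, B) M), a' = a → u = ⟨a.proj, v⟩ →
      ((bundleChart B F E m).tmap ⟨a, Hor.lift a v⟩).2.2 =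
      ((bundleChart B F E m).tmap ⟨a', Hor.lift a' (show B from u.2)⟩).2.2 := by
    rintro _ _ rfl rfl
    rfl
  refine h3 _ ((baseChart B m).tinv (((bundleChart B F E m).toPartialEquiv a).1,
    ((baseChart B m).tmap ⟨a.proj, v⟩).2)) ((bundleChart B F E m).left_inv ha) ?_
  rw [bundleChart_apply ha]
  exact (baseChart B m).tinv_tmap (z := (⟨a.proj, v⟩ : TangentBundle 𝓘(ℝ, B) M)) (mem_bundleChart_source.1 ha).1

/-- The coordinates of the linearized horizontal lift `(x, y, y'; v, u) ↦
(v, u, (∂Γ/∂y)(x, y)(y') v)`. -/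
def linCoord (q : ((B × F) × F) × (B × F)) : ((B × F) × F) × ((B × F) × F) :=
  (q.1, (q.2, fderiv ℝ (Hor.coeff m) q.1.1 (0, q.1.2) q.2.1))

theorem tmap_tangentMap_proj_eq {p : PullbackTotal 𝓘(ℝ, B) F E}
    (hp : p.proj ∈ (bundleChart B F E m).source)
    (w : TangentSpace (𝓘(ℝ, B).prod 𝓘(ℝ, F)) p.proj) :
    ((baseChart B m).tmap ⟨p.proj.proj, mfderiv (𝓘(ℝ, B).prod 𝓘(ℝ, F)) 𝓘(ℝ, B)
      (TotalSpace.proj : TotalSpace F E → M) p.proj w⟩).2 =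
        ((bundleChart B F E m).tmap ⟨p.proj, w⟩).2.1 :=
  congrArg Prod.snd (tmap_tangentMap_proj (w := ⟨p.proj, w⟩) hp)

/-- The velocity of `s ↦ ξ(a + s b, Tπ(w))` has coordinates `((x, y), (v, Γ v)); ((0, y'), (0,
∂_yΓ(y') v))`, hence is a `Tπ`-vertical lift. It is attached at `ξ(a, Tπ(w))`, not at `w`, which is
why the vector in `T(π^*E)` chosen here has first component `(v, Γ v)`. -/
theorem linLift_eq {p : PullbackTotal 𝓘(ℝ, B) F E} (hp : p.proj ∈ (bundleChart B F E m).source)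
    (w : TangentSpace (𝓘(ℝ, B).prod 𝓘(ℝ, F)) p.proj) :
    Hor.linLift p w =
      tangentMap ((𝓘(ℝ, B).prod 𝓘(ℝ, F)).prod 𝓘(ℝ, F)) (𝓘(ℝ, B).prod 𝓘(ℝ, F)) snd
        ((pullbackChart B F E m).tinv (linCoord Hor (m := m) ((pullbackChart B F E m).toPartialEquiv p,
          (((bundleChart B F E m).tmap ⟨p.proj, w⟩).2.1,
            Hor.coeff m ((bundleChart B F E m).toPartialEquiv p.proj)
              ((bundleChart B F E m).tmap ⟨p.proj, w⟩).2.1)))) := by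
  have hpc := (pullbackChart B F E m).map_source (mem_pullbackChart_source.2 hp)
  have hv := tmap_tangentMap_proj_eq hp w
  generalize hq : (pullbackChart B F E m).toPartialEquiv p = q at *
  have hq1 : (bundleChart B F E m).toPartialEquiv p.proj = q.1 := by
    rw [← hq, pullbackChart_fst hp]
  generalize ((bundleChart B F E m).tmap ⟨p.proj, w⟩).2.1 = v at *
  set z := (pullbackChart B F E m).tinv (linCoord Hor (m := m) (q, (v,
    Hor.coeff m ((bundleChart B F E m).toPartialEquiv p.proj) v))) with hz
  have htz : (pullbackChart B F E m).tmap z = linCoord Hor (m := m) (q, (v,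
    Hor.coeff m ((bundleChart B F E m).toPartialEquiv p.proj) v)) :=
    (pullbackChart B F E m).tmap_tinv hpc
  have hzs : z.proj.proj ∈ (bundleChart B F E m).source :=
    mem_pullbackChart_source.1 ((pullbackChart B F E m).map_target hpc)
  clear_value z
  rw [linLift, tauVerticalProj]
  have key : velocity (𝓘(ℝ, B).prod 𝓘(ℝ, F)).tangent (fun s : ℝ =>
      (⟨addSMul s p, Hor.lift (addSMul s p) (mfderiv (𝓘(ℝ, B).prod 𝓘(ℝ, F)) 𝓘(ℝ, B)
        (TotalSpace.proj : TotalSpace F E → M) p.proj w)⟩ :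
        TangentBundle (𝓘(ℝ, B).prod 𝓘(ℝ, F)) (TotalSpace F E))) 0 = tauVerticalLift z := by
    have hd : HasDerivAt (fun s : ℝ => ((q.1.1, q.1.2 + s • q.2),
        (v, Hor.coeff m (q.1.1, q.1.2 + s • q.2) v)))
        ((0, q.2), (0, fderiv ℝ (Hor.coeff m) q.1 (0, q.2) v)) 0 := by
      have h1 := hasDerivAt_line q.1.1 q.1.2 q.2 0
      refine h1.prodMk ((hasDerivAt_const _ _).prodMk ?_)
      have h2 : HasFDerivAt (Hor.coeff m) (fderiv ℝ (Hor.coeff m) q.1)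
          (q.1.1, q.1.2 + (0 : ℝ) • q.2) := by
        rw [zero_smul, add_zero]
        exact ((Hor.contDiffAt_coeff (mem_pullbackChart_target.1 hpc)).differentiableAt
          (by simp)).hasFDerivAt
      exact ((ContinuousLinearMap.apply ℝ F v).hasFDerivAt.comp_hasDerivAt (0 : ℝ)
        (h2.comp_hasDerivAt (0 : ℝ) h1))
    have h3 := (bundleChart B F E m).tangent_tmap_velocity (t := 0) (γ := fun s : ℝ =>
      (⟨addSMul s p, Hor.lift (addSMul s p) (mfderiv (𝓘(ℝ, B).prod 𝓘(ℝ, F)) 𝓘(ℝ, B)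
        (TotalSpace.proj : TotalSpace F E → M) p.proj w)⟩ :
        TangentBundle (𝓘(ℝ, B).prod 𝓘(ℝ, F)) (TotalSpace F E)))
      (Filter.Eventually.of_forall fun s => addSMul_mem_source s hp)
      (Filter.Eventually.of_forall fun s => by
        have h4 := Hor.tmap_lift (addSMul_mem_source s hp) (mfderiv (𝓘(ℝ, B).prod 𝓘(ℝ, F))
          𝓘(ℝ, B) (TotalSpace.proj : TotalSpace F E → M) p.proj w)
        have h5 : ((baseChart B m).tmap ⟨(addSMul s p).proj, mfderiv (𝓘(ℝ, B).prod 𝓘(ℝ, F))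
          𝓘(ℝ, B) (TotalSpace.proj : TotalSpace F E → M) p.proj w⟩).2 = v := hv
        rw [h5, bundleChart_addSMul s hp, hq] at h4
        exact h4) hd
    refine (bundleChart B F E m).tangent_tmap_injOn (addSMul_mem_source 0 hp)
      (addSMul_mem_source 0 hzs) ?_
    have h6 := tmap_tauVerticalLift hzs
    rw [htz] at h6
    refine h3.trans (Eq.trans ?_ h6.symm)
    simp only [linCoord, zero_smul, add_zero, Prod.mk.eta, hq1]
  rw [key, tauVerticalLift_injective.extend_apply]

theorem linLift_proj_mem {p : PullbackTotal 𝓘(ℝ, B) F E}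
    (hp : p.proj ∈ (bundleChart B F E m).source)
    (w : TangentSpace (𝓘(ℝ, B).prod 𝓘(ℝ, F)) p.proj) :
    (Hor.linLift p w).proj ∈ (bundleChart B F E m).source := by
  rw [linLift_eq Hor hp]
  exact snd_mem_source (mem_pullbackChart_source.1 ((pullbackChart B F E m).map_target
    ((pullbackChart B F E m).map_source (mem_pullbackChart_source.2 hp))))

theorem tmap_linLift {p : PullbackTotal 𝓘(ℝ, B) F E}
    (hp : p.proj ∈ (bundleChart B F E m).source)
    (w : TangentSpace (𝓘(ℝ, B).prod 𝓘(ℝ, F)) p.proj) :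
    (bundleChart B F E m).tmap (Hor.linLift p w) =
      ((((pullbackChart B F E m).toPartialEquiv p).1.1, ((pullbackChart B F E m).toPartialEquiv p).2),
        (((bundleChart B F E m).tmap ⟨p.proj, w⟩).2.1,
          fderiv ℝ (Hor.coeff m) ((pullbackChart B F E m).toPartialEquiv p).1
            (0, ((pullbackChart B F E m).toPartialEquiv p).2)
              ((bundleChart B F E m).tmap ⟨p.proj, w⟩).2.1)) := by
  have hpc := (pullbackChart B F E m).map_source (mem_pullbackChart_source.2 hp)
  rw [linLift_eq Hor hp]
  have h1 : ∀ (z : TangentBundle ((𝓘(ℝ, B).prod 𝓘(ℝ, F)).prod 𝓘(ℝ, F))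
      (PullbackTotal 𝓘(ℝ, B) F E)) (q : ((B × F) × F) × ((B × F) × F)),
      z.proj.proj ∈ (bundleChart B F E m).source → (pullbackChart B F E m).tmap z = q →
      (bundleChart B F E m).tmap (tangentMap ((𝓘(ℝ, B).prod 𝓘(ℝ, F)).prod 𝓘(ℝ, F))
        (𝓘(ℝ, B).prod 𝓘(ℝ, F)) snd z) = ((q.1.1.1, q.1.2), (q.2.1.1, q.2.2)) := by
    rintro z q hz rfl
    exact tmap_tangentMap_snd hz
  exact h1 _ _ (mem_pullbackChart_source.1 ((pullbackChart B F E m).map_target hpc))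
    ((pullbackChart B F E m).tmap_tinv hpc)

/-- A vector tangent to the pullback bundle is the linearized horizontal lift of its projection if
and only if this holds in coordinates. -/
theorem tangentMap_snd_eq_linLift_iff {p : PullbackTotal 𝓘(ℝ, B) F E}
    (hp : p.proj ∈ (bundleChart B F E m).source)
    (u : TangentSpace ((𝓘(ℝ, B).prod 𝓘(ℝ, F)).prod 𝓘(ℝ, F)) p) :
    tangentMap ((𝓘(ℝ, B).prod 𝓘(ℝ, F)).prod 𝓘(ℝ, F)) (𝓘(ℝ, B).prod 𝓘(ℝ, F)) snd
        (⟨p, u⟩ : TangentBundle _ (PullbackTotal 𝓘(ℝ, B) F E)) =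
      Hor.linLift p (mfderiv ((𝓘(ℝ, B).prod 𝓘(ℝ, F)).prod 𝓘(ℝ, F)) (𝓘(ℝ, B).prod 𝓘(ℝ, F))
        (TotalSpace.proj : PullbackTotal 𝓘(ℝ, B) F E → TotalSpace F E) p u) ↔
    ((pullbackChart B F E m).tmap ⟨p, u⟩).2.2 =
      fderiv ℝ (Hor.coeff m) ((pullbackChart B F E m).toPartialEquiv p).1
            (0, ((pullbackChart B F E m).toPartialEquiv p).2)
              ((pullbackChart B F E m).tmap ⟨p, u⟩).2.1.1 := by
  have h1 := tmap_tangentMap_snd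
    (z := (⟨p, u⟩ : TangentBundle _ (PullbackTotal 𝓘(ℝ, B) F E))) hp
  have h2 := tmap_tangentMap_proj_pullback
    (z := (⟨p, u⟩ : TangentBundle _ (PullbackTotal 𝓘(ℝ, B) F E))) hp
  have h3 := Hor.tmap_linLift hp (mfderiv ((𝓘(ℝ, B).prod 𝓘(ℝ, F)).prod 𝓘(ℝ, F))
    (𝓘(ℝ, B).prod 𝓘(ℝ, F)) (TotalSpace.proj : PullbackTotal 𝓘(ℝ, B) F E → TotalSpace F E) p u)
  have h4 : ((bundleChart B F E m).tmap ⟨p.proj, mfderiv ((𝓘(ℝ, B).prod 𝓘(ℝ, F)).prod 𝓘(ℝ, F))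
    (𝓘(ℝ, B).prod 𝓘(ℝ, F)) (TotalSpace.proj : PullbackTotal 𝓘(ℝ, B) F E → TotalSpace F E)
      p u⟩).2 = ((pullbackChart B F E m).tmap ⟨p, u⟩).2.1 := congrArg Prod.snd h2
  rw [h4] at h3
  constructor
  · intro h
    rw [h, h3] at h1
    exact (congrArg (fun q : (B × F) × (B × F) => q.2.2) h1).symm
  · intro h
    refine (bundleChart B F E m).tmap_injOn (snd_mem_source hp) (Hor.linLift_proj_mem hp _) ?_
    rw [h1, h3, h]
    rfl

end EhresmannConnection

end HorizontalCoordinates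

/-! ### Existence and uniqueness of the linearization -/

section Linearization

variable {B : Type*} [NormedAddCommGroup B] [NormedSpace ℝ B]
  {M : Type*} [TopologicalSpace M] [ChartedSpace B M] [IsManifold 𝓘(ℝ, B) ∞ M]
  {F : Type*} [NormedAddCommGroup F] [NormedSpace ℝ F]
  {E : M → Type*} [∀ m, AddCommMonoid (E m)] [∀ m, Module ℝ (E m)]
  [∀ m, TopologicalSpace (E m)] [TopologicalSpace (TotalSpace F E)]
  [FiberBundle F E] [VectorBundle ℝ F E] [ContMDiffVectorBundle ∞ F E 𝓘(ℝ, B)]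
  (Hor : EhresmannConnection 𝓘(ℝ, B) F E)

namespace EhresmannConnection

/-- The horizontal lift of the linearization of `Hor`, defined in the chart at the base point. -/
def linearizationLift (p : PullbackTotal 𝓘(ℝ, B) F E) :
    TangentSpace (𝓘(ℝ, B).prod 𝓘(ℝ, F)) p.proj →L[ℝ]
      TangentSpace ((𝓘(ℝ, B).prod 𝓘(ℝ, F)).prod 𝓘(ℝ, F)) p :=
  let c := bundleChart B F E p.proj.proj
  let c' := pullbackChart B F E p.proj.proj
  let f₁ : B × F →L[ℝ] B × F :=
    mfderiv (𝓘(ℝ, B).prod 𝓘(ℝ, F)) 𝓘(ℝ, B × F) c.toPartialEquiv p.proj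
  let f₂ : B × F →L[ℝ] (B × F) × F := (ContinuousLinearMap.id ℝ (B × F)).prod
    ((fderiv ℝ (Hor.coeff p.proj.proj) (c'.toPartialEquiv p).1 (0, (c'.toPartialEquiv p).2)).comp
      (ContinuousLinearMap.fst ℝ B F))
  let f₃ : (B × F) × F →L[ℝ] (B × F) × F :=
    mfderiv 𝓘(ℝ, (B × F) × F) ((𝓘(ℝ, B).prod 𝓘(ℝ, F)).prod 𝓘(ℝ, F)) c'.toPartialEquiv.symm
      (c'.toPartialEquiv p)
  f₃.comp (f₂.comp f₁)

theorem mk_linearizationLift (p : PullbackTotal 𝓘(ℝ, B) F E)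
    (w : TangentSpace (𝓘(ℝ, B).prod 𝓘(ℝ, F)) p.proj) :
    (⟨p, Hor.linearizationLift p w⟩ : TangentBundle _ (PullbackTotal 𝓘(ℝ, B) F E)) =
      (pullbackChart B F E p.proj.proj).tinv (linCoord Hor (m := p.proj.proj)
        ((pullbackChart B F E p.proj.proj).toPartialEquiv p,
          ((bundleChart B F E p.proj.proj).tmap ⟨p.proj, w⟩).2)) := by
  have h : ((pullbackChart B F E p.proj.proj).tinv (linCoord Hor (m := p.proj.proj)
        ((pullbackChart B F E p.proj.proj).toPartialEquiv p,
          ((bundleChart B F E p.proj.proj).tmap ⟨p.proj, w⟩).2))).proj = p :=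
    (pullbackChart B F E p.proj.proj).left_inv
      (mem_pullbackChart_source.2 (mem_bundleChart_self p.proj))
  exact TangentBundle.mk_eq h

theorem tmap_linearizationLift_self (p : PullbackTotal 𝓘(ℝ, B) F E)
    (w : TangentSpace (𝓘(ℝ, B).prod 𝓘(ℝ, F)) p.proj) :
    (pullbackChart B F E p.proj.proj).tmap ⟨p, Hor.linearizationLift p w⟩ =
      linCoord Hor (m := p.proj.proj) ((pullbackChart B F E p.proj.proj).toPartialEquiv p,
          ((bundleChart B F E p.proj.proj).tmap ⟨p.proj, w⟩).2) := by
  rw [mk_linearizationLift]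
  exact (pullbackChart B F E p.proj.proj).tmap_tinv
    ((pullbackChart B F E p.proj.proj).map_source
      (mem_pullbackChart_source.2 (mem_bundleChart_self p.proj)))

theorem mfderiv_proj_linearizationLift (p : PullbackTotal 𝓘(ℝ, B) F E)
    (w : TangentSpace (𝓘(ℝ, B).prod 𝓘(ℝ, F)) p.proj) :
    mfderiv ((𝓘(ℝ, B).prod 𝓘(ℝ, F)).prod 𝓘(ℝ, F)) (𝓘(ℝ, B).prod 𝓘(ℝ, F))
      (TotalSpace.proj : PullbackTotal 𝓘(ℝ, B) F E → TotalSpace F E) p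
        (Hor.linearizationLift p w) = w := by
  have hp := mem_bundleChart_self (B := B) p.proj
  have h1 := tmap_tangentMap_proj_pullback (z := (⟨p, Hor.linearizationLift p w⟩ :
    TangentBundle _ (PullbackTotal 𝓘(ℝ, B) F E))) hp
  rw [tmap_linearizationLift_self] at h1
  have h2 : tangentMap ((𝓘(ℝ, B).prod 𝓘(ℝ, F)).prod 𝓘(ℝ, F)) (𝓘(ℝ, B).prod 𝓘(ℝ, F))
      (TotalSpace.proj : PullbackTotal 𝓘(ℝ, B) F E → TotalSpace F E)
        ⟨p, Hor.linearizationLift p w⟩ = ⟨p.proj, w⟩ := by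
    refine (bundleChart B F E p.proj.proj).tmap_injOn hp hp (h1.trans ?_)
    refine Prod.ext ?_ rfl
    exact pullbackChart_fst hp
  exact eq_of_heq (TotalSpace.mk.inj h2).2

theorem tangentMap_snd_linearizationLift (p : PullbackTotal 𝓘(ℝ, B) F E)
    (w : TangentSpace (𝓘(ℝ, B).prod 𝓘(ℝ, F)) p.proj) :
    tangentMap ((𝓘(ℝ, B).prod 𝓘(ℝ, F)).prod 𝓘(ℝ, F)) (𝓘(ℝ, B).prod 𝓘(ℝ, F)) snd
        (⟨p, Hor.linearizationLift p w⟩ : TangentBundle _ (PullbackTotal 𝓘(ℝ, B) F E)) =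
      Hor.linLift p w := by
  have h := (tangentMap_snd_eq_linLift_iff Hor (mem_bundleChart_self (B := B) p.proj)
    (Hor.linearizationLift p w)).2 (by rw [tmap_linearizationLift_self]; rfl)
  rwa [mfderiv_proj_linearizationLift] at h

/-- `linearizationLift` uses a different chart at each point, so smoothness requires one formula in
a fixed chart. It holds because `linLift` is chart-free and `tangentMap_snd_eq_linLift_iff` can be
used in any chart. -/
theorem tmap_linearizationLift {m : M} {p : PullbackTotal 𝓘(ℝ, B) F E}
    (hp : p.proj ∈ (bundleChart B F E m).source)
    (w : TangentSpace (𝓘(ℝ, B).prod 𝓘(ℝ, F)) p.proj) :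
    (pullbackChart B F E m).tmap ⟨p, Hor.linearizationLift p w⟩ =
      linCoord Hor (m := m) ((pullbackChart B F E m).toPartialEquiv p,
          ((bundleChart B F E m).tmap ⟨p.proj, w⟩).2) := by
  have h := tangentMap_snd_linearizationLift Hor p w
  conv_rhs at h => rw [← mfderiv_proj_linearizationLift Hor p w]
  have h1 := (tangentMap_snd_eq_linLift_iff Hor hp (Hor.linearizationLift p w)).1 h
  have h2 := tmap_tangentMap_proj_pullback (z := (⟨p, Hor.linearizationLift p w⟩ :
    TangentBundle _ (PullbackTotal 𝓘(ℝ, B) F E))) hp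
  have h3 : tangentMap ((𝓘(ℝ, B).prod 𝓘(ℝ, F)).prod 𝓘(ℝ, F)) (𝓘(ℝ, B).prod 𝓘(ℝ, F))
      (TotalSpace.proj : PullbackTotal 𝓘(ℝ, B) F E → TotalSpace F E)
        ⟨p, Hor.linearizationLift p w⟩ = ⟨p.proj, w⟩ :=
    congrArg (TotalSpace.mk p.proj) (mfderiv_proj_linearizationLift Hor p w)
  rw [h3] at h2
  have h4 : ((pullbackChart B F E m).tmap ⟨p, Hor.linearizationLift p w⟩).2.1 =
      ((bundleChart B F E m).tmap ⟨p.proj, w⟩).2 := (congrArg Prod.snd h2).symm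
  refine Prod.ext rfl (Prod.ext h4 ?_)
  rw [h1, h4]
  rfl

theorem contDiffAt_linCoord {m : M} {q : ((B × F) × F) × (B × F)}
    (hq : q.1.1 ∈ (bundleChart B F E m).target) :
    ContDiffAt ℝ ∞ (linCoord Hor (m := m)) q := by
  have hd := ((contDiffOn_infty_iff_fderiv_of_isOpen (bundleChart B F E m).open_target).1
    (Hor.contDiffOn_coeff (m := m))).2.contDiffAt ((bundleChart B F E m).open_target.mem_nhds hq)
  have h1 : ContDiffAt ℝ ∞ (fun q : ((B × F) × F) × (B × F) =>
      fderiv ℝ (Hor.coeff m) q.1.1) q :=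
    hd.comp q (contDiff_fst.fst.contDiffAt)
  have h2 : ContDiffAt ℝ ∞ (fun q : ((B × F) × F) × (B × F) => ((0 : B), q.1.2)) q := by fun_prop
  have h3 : ContDiffAt ℝ ∞ (fun q : ((B × F) × F) × (B × F) => q.2.1) q := by fun_prop
  exact contDiffAt_fst.prodMk (contDiffAt_snd.prodMk ((h1.clm_apply h2).clm_apply h3))

/-- The linearization of the connection `Hor`. -/
def linearization : EhresmannConnection (𝓘(ℝ, B).prod 𝓘(ℝ, F)) F (PullbackFibre 𝓘(ℝ, B) F E) where
  lift := Hor.linearizationLift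
  proj_lift := Hor.mfderiv_proj_linearizationLift
  smooth_lift := by
    intro q₀
    set m := q₀.proj.proj.proj with hm
    have hp := mem_bundleChart_self (B := B) q₀.proj.proj
    have hproj : ContMDiffAt (((𝓘(ℝ, B).prod 𝓘(ℝ, F)).prod 𝓘(ℝ, F)).prod 𝓘(ℝ, B × F))
        ((𝓘(ℝ, B).prod 𝓘(ℝ, F)).prod 𝓘(ℝ, F)) ∞
        (fun q : TotalSpace (B × F) (projMap (𝓘(ℝ, B).prod 𝓘(ℝ, F)) F (PullbackFibre 𝓘(ℝ, B) F E) *ᵖ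
          (TangentSpace (𝓘(ℝ, B).prod 𝓘(ℝ, F)) : TotalSpace F E → Type _)) => q.proj) q₀ :=
      contMDiffAt_proj _
    have h1 := (pullbackChart B F E m).contMDiffAt_comp (mem_pullbackChart_source.2 hp) hproj
    have h2 := (bundleChart B F E m).tangent.contMDiffAt_comp (x := q₀) hp
      (contMDiff_pullback_lift (V := (TangentSpace (𝓘(ℝ, B).prod 𝓘(ℝ, F)) :
        TotalSpace F E → Type _)) (F := B × F)
        (projMap (𝓘(ℝ, B).prod 𝓘(ℝ, F)) F (PullbackFibre 𝓘(ℝ, B) F E))).contMDiffAt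
    have h3 := (contDiff_snd.contMDiff.contMDiffAt.comp q₀ h2)
    have h4 := (contDiffAt_linCoord Hor (m := m) (q := ((pullbackChart B F E m).toPartialEquiv
      q₀.proj, ((bundleChart B F E m).tmap ⟨q₀.proj.proj, q₀.2⟩).2))
      (mem_pullbackChart_target.1 ((pullbackChart B F E m).map_source
        (mem_pullbackChart_source.2 hp)))).contMDiffAt.comp q₀ (h1.prodMk_space h3)
    have hev : ∀ᶠ q in 𝓝 q₀, q.proj.proj ∈ (bundleChart B F E m).source :=
      ((FiberBundle.continuous_proj F _).continuousAt.comp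
        hproj.continuousAt).preimage_mem_nhds ((bundleChart B F E m).open_source.mem_nhds hp)
    have h5 := h4.congr_of_eventuallyEq (hev.mono fun q hq =>
      (tmap_linearizationLift Hor hq q.2))
    refine (pullbackChart B F E m).tangent.contMDiffAt_of_comp
      ((pullbackChart B F E m).tangent.continuousAt_of_comp (hev.mono fun q hq =>
        mem_pullbackChart_source.2 hq) h5.continuousAt) (mem_pullbackChart_source.2 hp) h5

theorem isLinearization_linearization : Hor.IsLinearization Hor.linearization :=
  Hor.tangentMap_snd_linearizationLift

theorem tmap_mk_lift {Hor' : EhresmannConnection (𝓘(ℝ, B).prod 𝓘(ℝ, F)) F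
      (PullbackFibre 𝓘(ℝ, B) F E)} {m : M} {p : PullbackTotal 𝓘(ℝ, B) F E}
    (hp : p.proj ∈ (bundleChart B F E m).source)
    (w : TangentSpace (𝓘(ℝ, B).prod 𝓘(ℝ, F)) p.proj) :
    ((pullbackChart B F E m).tmap ⟨p, Hor'.lift p w⟩).2.1 =
      ((bundleChart B F E m).tmap ⟨p.proj, w⟩).2 := by
  have h2 := tmap_tangentMap_proj_pullback (z := (⟨p, Hor'.lift p w⟩ :
    TangentBundle _ (PullbackTotal 𝓘(ℝ, B) F E))) hp
  have h3 : tangentMap ((𝓘(ℝ, B).prod 𝓘(ℝ, F)).prod 𝓘(ℝ, F)) (𝓘(ℝ, B).prod 𝓘(ℝ, F))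
      (TotalSpace.proj : PullbackTotal 𝓘(ℝ, B) F E → TotalSpace F E)
        ⟨p, Hor'.lift p w⟩ = ⟨p.proj, w⟩ :=
    congrArg (TotalSpace.mk p.proj) (Hor'.proj_lift p w)
  rw [h3] at h2
  exact (congrArg Prod.snd h2).symm

theorem IsLinearization.tmap_lift {Hor' : EhresmannConnection (𝓘(ℝ, B).prod 𝓘(ℝ, F)) F
      (PullbackFibre 𝓘(ℝ, B) F E)} (h : Hor.IsLinearization Hor') {m : M}
    {p : PullbackTotal 𝓘(ℝ, B) F E} (hp : p.proj ∈ (bundleChart B F E m).source)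
    (w : TangentSpace (𝓘(ℝ, B).prod 𝓘(ℝ, F)) p.proj) :
    (pullbackChart B F E m).tmap ⟨p, Hor'.lift p w⟩ =
      linCoord Hor (m := m) ((pullbackChart B F E m).toPartialEquiv p,
          ((bundleChart B F E m).tmap ⟨p.proj, w⟩).2) := by
  have h1 := tmap_mk_lift (Hor' := Hor') hp w
  refine Prod.ext rfl (Prod.ext h1 ?_)
  have h2 : tangentMap ((𝓘(ℝ, B).prod 𝓘(ℝ, F)).prod 𝓘(ℝ, F)) (𝓘(ℝ, B).prod 𝓘(ℝ, F)) snd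
      (⟨p, Hor'.lift p w⟩ : TangentBundle _ (PullbackTotal 𝓘(ℝ, B) F E)) = Hor.linLift p w := h p w
  conv_rhs at h2 => rw [← Hor'.proj_lift p w]
  have h3 := (tangentMap_snd_eq_linLift_iff Hor hp (Hor'.lift p w)).1 h2
  rw [h3, h1]
  rfl

variable {Hor} in
theorem IsLinearization.eq_linearization {Hor' : EhresmannConnection (𝓘(ℝ, B).prod 𝓘(ℝ, F)) F
      (PullbackFibre 𝓘(ℝ, B) F E)} (h : Hor.IsLinearization Hor') : Hor' = Hor.linearization := by
  refine EhresmannConnection.ext (funext fun p => ContinuousLinearMap.ext fun w => ?_)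
  have hp := mem_bundleChart_self (B := B) p.proj
  have h1 : (⟨p, Hor'.lift p w⟩ : TangentBundle _ (PullbackTotal 𝓘(ℝ, B) F E)) =
      ⟨p, Hor.linearization.lift p w⟩ := by
    refine (pullbackChart B F E p.proj.proj).tmap_injOn (mem_pullbackChart_source.2 hp)
      (mem_pullbackChart_source.2 hp) ?_
    rw [IsLinearization.tmap_lift Hor h hp, IsLinearization.tmap_lift Hor
      Hor.isLinearization_linearization hp]
  exact eq_of_heq (TotalSpace.mk.inj h1).2

end EhresmannConnection

end Linearization

/-! ### The variation equation -/

section Variation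

variable {G : Type*} [NormedAddCommGroup G] [NormedSpace ℝ G]

/-- The variation equation: the transverse derivative of a family of solutions of `x' = f x`
solves the linearized equation. -/
theorem hasDerivAt_variation {h : ℝ × ℝ → G} {f : G → G} {s : ℝ}
    (hh : ContDiffAt ℝ 2 h (s, 0)) (hf : DifferentiableAt ℝ f (h (s, 0)))
    (hflow : ∀ᶠ q in 𝓝 (s, (0 : ℝ)), HasDerivAt (fun t => h (t, q.2)) (f (h q)) q.1) :
    HasDerivAt (fun t => fderiv ℝ h (t, 0) (0, 1))
      (fderiv ℝ f (h (s, 0)) (fderiv ℝ h (s, 0) (0, 1))) s := by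
  have hline : ∀ t : ℝ, HasDerivAt (fun t : ℝ => (t, (0 : ℝ))) ((1 : ℝ), (0 : ℝ)) t := fun t =>
    (hasDerivAt_id t).prodMk (hasDerivAt_const t 0)
  have hline' : HasDerivAt (fun ε : ℝ => (s, ε)) ((0 : ℝ), (1 : ℝ)) 0 :=
    (hasDerivAt_const _ s).prodMk (hasDerivAt_id _)
  have hd : DifferentiableAt ℝ (fderiv ℝ h) (s, 0) :=
    (hh.fderiv_right (m := 1) (by norm_num)).differentiableAt (by simp)
  have h1 : HasDerivAt (fun t => fderiv ℝ h (t, 0) (0, 1))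
      (fderiv ℝ (fderiv ℝ h) (s, 0) (1, 0) (0, 1)) s :=
    (ContinuousLinearMap.apply ℝ G ((0 : ℝ), (1 : ℝ))).hasFDerivAt.comp_hasDerivAt s
      (hd.hasFDerivAt.comp_hasDerivAt s (hline s))
  have h2 : HasDerivAt (fun ε => fderiv ℝ h (s, ε) (1, 0))
      (fderiv ℝ (fderiv ℝ h) (s, 0) (0, 1) (1, 0)) 0 :=
    (ContinuousLinearMap.apply ℝ G ((1 : ℝ), (0 : ℝ))).hasFDerivAt.comp_hasDerivAt (0 : ℝ)
      (hd.hasFDerivAt.comp_hasDerivAt (0 : ℝ) hline')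
  have hdiff : ∀ᶠ q in 𝓝 (s, (0 : ℝ)), DifferentiableAt ℝ h q :=
    (hh.eventually (by simp)).mono fun q hq => hq.differentiableAt (by simp)
  -- The flow equation holds on a neighbourhood, so it may be differentiated in the transverse
  -- direction.
  have heq : ∀ᶠ q in 𝓝 (s, (0 : ℝ)), fderiv ℝ h q (1, 0) = f (h q) := by
    filter_upwards [hdiff, hflow] with q hq hq'
    have hl : HasDerivAt (fun t : ℝ => (t, q.2)) ((1 : ℝ), (0 : ℝ)) q.1 :=
      (hasDerivAt_id _).prodMk (hasDerivAt_const _ _)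
    exact (hq.hasFDerivAt.comp_hasDerivAt q.1 hl).unique hq'
  have h3 : HasDerivAt (fun ε => f (h (s, ε)))
      (fderiv ℝ f (h (s, 0)) (fderiv ℝ h (s, 0) (0, 1))) 0 :=
    hf.hasFDerivAt.comp_hasDerivAt (0 : ℝ)
      (hdiff.self_of_nhds.hasFDerivAt.comp_hasDerivAt (0 : ℝ) hline')
  have h4 := h2.unique (h3.congr_of_eventuallyEq (hline'.continuousAt.eventually heq))
  -- Symmetry of the second derivative exchanges the time and the transverse derivative.
  have hsymm : IsSymmSndFDerivAt ℝ h (s, 0) := hh.isSymmSndFDerivAt (by simp)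
  rw [← h4, hsymm.eq]
  exact h1

end Variation

/-! ### Vector fields and local flows in charts -/

section Velocity

variable {A : Type*} [NormedAddCommGroup A] [NormedSpace ℝ A]
  {H : Type*} [TopologicalSpace H] {I : ModelWithCorners ℝ A H}
  {N : Type*} [TopologicalSpace N] [ChartedSpace H N]

theorem velocity_congr {γ γ' : ℝ → N} {t : ℝ} (h : γ =ᶠ[𝓝 t] γ') :
    velocity I γ t = velocity I γ' t := by
  simp only [velocity, tangentMap, h.mfderiv_eq]
  rw [h.eq_of_nhds]

theorem tangentMap_velocity {A₁ : Type*} [NormedAddCommGroup A₁] [NormedSpace ℝ A₁]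
    {H₁ : Type*} [TopologicalSpace H₁] {I₁ : ModelWithCorners ℝ A₁ H₁}
    {N₁ : Type*} [TopologicalSpace N₁] [ChartedSpace H₁ N₁] {f : N → N₁} {γ : ℝ → N} {t : ℝ}
    (hf : MDifferentiableAt I I₁ f (γ t)) (hγ : MDifferentiableAt 𝓘(ℝ, ℝ) I γ t) :
    tangentMap I I₁ f (velocity I γ t) = velocity I₁ (f ∘ γ) t :=
  (tangentMap_comp_at (p := (⟨t, (1 : ℝ)⟩ : TangentBundle 𝓘(ℝ, ℝ) ℝ)) hf hγ).symm

namespace SmoothChart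

variable {A' : Type*} [NormedAddCommGroup A'] [NormedSpace ℝ A'] (c : SmoothChart I N A')
  (Y : ∀ x : N, TangentSpace I x)

/-- The components of a vector field in a chart, as a function of the coordinates. -/
def fieldCoord (z : A') : A' :=
  (c.tmap ⟨c.toPartialEquiv.symm z, Y (c.toPartialEquiv.symm z)⟩).2

variable {Y} in
theorem fieldCoord_apply {x : N} (hx : x ∈ c.source) :
    c.fieldCoord Y (c.toPartialEquiv x) = (c.tmap ⟨x, Y x⟩).2 :=
  congrArg (fun x => (c.tmap ⟨x, Y x⟩).2) (c.left_inv hx)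

variable {Y} in
theorem contDiffAt_fieldCoord [IsManifold I ∞ N] {W : Set N} (hW : IsOpen W)
    (hY : IsSmoothFieldOn I W Y) {x : N} (hx : x ∈ c.source) (hxW : x ∈ W) :
    ContDiffAt ℝ ∞ (c.fieldCoord Y) (c.toPartialEquiv x) := by
  have h1 := c.tangent.contMDiffAt_comp (x := x) hx (hY.contMDiffAt (hW.mem_nhds hxW))
  rw [← c.left_inv hx] at h1
  exact contDiff_snd.contDiffAt.comp _ (h1.comp (c.toPartialEquiv x)
    (c.contMDiffAt_symm (c.map_source hx))).contDiffAt

end SmoothChart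

namespace IsLocalFlow

variable {W : Set N} {Y : ∀ x : N, TangentSpace I x}
  {D : Set (ℝ × N)} {φ : ℝ → N → N}

theorem isOpen_times (h : IsLocalFlow I W Y D φ) (x : N) : IsOpen {s : ℝ | (s, x) ∈ D} :=
  h.isOpen_domain.preimage (by fun_prop : Continuous fun s : ℝ => (s, x))

theorem hasMFDerivAt (h : IsLocalFlow I W Y D φ) {s : ℝ} {x : N} (hs : (s, x) ∈ D) :
    HasMFDerivAt 𝓘(ℝ, ℝ) I (fun s => φ s x) s ((1 : ℝ →L[ℝ] ℝ).smulRight (Y (φ s x))) :=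
  (h.integral x s hs).hasMFDerivAt ((h.isOpen_times x).mem_nhds hs)

theorem velocity_eq (h : IsLocalFlow I W Y D φ) {s : ℝ} {x : N} (hs : (s, x) ∈ D) :
    velocity I (fun s => φ s x) s = ⟨φ s x, Y (φ s x)⟩ := by
  refine congrArg (TotalSpace.mk (φ s x)) ?_
  change mfderiv 𝓘(ℝ, ℝ) I (fun s => φ s x) s (1 : ℝ) = _
  rw [(h.hasMFDerivAt hs).mfderiv]
  exact one_smul ℝ (Y (φ s x))

theorem contMDiffAt (h : IsLocalFlow I W Y D φ) {s : ℝ} {x : N} (hs : (s, x) ∈ D) :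
    ContMDiffAt (𝓘(ℝ, ℝ).prod I) I ∞ (fun q : ℝ × N => φ q.1 q.2) (s, x) :=
  h.smooth.contMDiffAt (h.isOpen_domain.mem_nhds hs)

theorem contMDiffAt_left (h : IsLocalFlow I W Y D φ) {s : ℝ} {x : N} (hs : (s, x) ∈ D) :
    ContMDiffAt 𝓘(ℝ, ℝ) I ∞ (fun s => φ s x) s :=
  (h.contMDiffAt hs).comp s (contMDiffAt_id.prodMk contMDiffAt_const)

theorem contMDiffAt_right (h : IsLocalFlow I W Y D φ) {s : ℝ} {x : N} (hs : (s, x) ∈ D) :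
    ContMDiffAt I I ∞ (φ s) x :=
  (h.contMDiffAt hs).comp x (contMDiffAt_const.prodMk contMDiffAt_id)

theorem hasDerivAt_comp {A' : Type*} [NormedAddCommGroup A'] [NormedSpace ℝ A']
    (h : IsLocalFlow I W Y D φ) (c : SmoothChart I N A') {s : ℝ} {x : N} (hs : (s, x) ∈ D)
    (hc : φ s x ∈ c.source) :
    HasDerivAt (fun s => c.toPartialEquiv (φ s x))
      (c.fieldCoord Y (c.toPartialEquiv (φ s x))) s := by
  have h1 := c.hasDerivAt_comp (h.hasMFDerivAt hs).mdifferentiableAt hc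
  rw [h.velocity_eq hs] at h1
  rw [c.fieldCoord_apply hc]
  exact h1

end IsLocalFlow

end Velocity

/-! ### Basic fields in coordinates -/

section BasicFields

variable {B : Type*} [NormedAddCommGroup B] [NormedSpace ℝ B]
  {M : Type*} [TopologicalSpace M] [ChartedSpace B M] [IsManifold 𝓘(ℝ, B) ∞ M]
  {F : Type*} [NormedAddCommGroup F] [NormedSpace ℝ F]
  {E : M → Type*} [∀ m, AddCommMonoid (E m)] [∀ m, Module ℝ (E m)]
  [∀ m, TopologicalSpace (E m)] [TopologicalSpace (TotalSpace F E)]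
  [FiberBundle F E] [VectorBundle ℝ F E] [ContMDiffVectorBundle ∞ F E 𝓘(ℝ, B)]
  {Hor : EhresmannConnection 𝓘(ℝ, B) F E} {m : M}

/-- Turns verticality into the vanishing of one coordinate, to which uniqueness for linear equations
applies. -/
theorem exists_verticalLift_eq_iff {z : TangentBundle (𝓘(ℝ, B).prod 𝓘(ℝ, F)) (TotalSpace F E)}
    (hz : z.proj ∈ (bundleChart B F E m).source) :
    (∃ q, verticalLift q = z) ↔ ((bundleChart B F E m).tmap z).2.1 = 0 := by
  constructor
  · rintro ⟨q, rfl⟩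
    rw [verticalLift_proj] at hz
    rw [tmap_verticalLift hz]
  · intro h
    have ht : (((bundleChart B F E m).tmap z).1, ((bundleChart B F E m).tmap z).2.2) ∈
        (pullbackChart B F E m).target :=
      mem_pullbackChart_target.2 ((bundleChart B F E m).map_source hz)
    have hs := mem_pullbackChart_source.1 ((pullbackChart B F E m).map_target ht)
    refine ⟨(pullbackChart B F E m).toPartialEquiv.symm _, (bundleChart B F E m).tmap_injOn
      ?_ hz ((tmap_verticalLift hs).trans ?_)⟩
    · rw [verticalLift_proj]
      exact hs
    · have e : (pullbackChart B F E m).toPartialEquiv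
          ((pullbackChart B F E m).toPartialEquiv.symm _) = _ :=
        (pullbackChart B F E m).right_inv ht
      rw [e]
      exact Prod.ext rfl (Prod.ext h.symm rfl)

theorem pullbackChart_of_verticalLift_eq {q : PullbackTotal 𝓘(ℝ, B) F E}
    {z : TangentBundle (𝓘(ℝ, B).prod 𝓘(ℝ, F)) (TotalSpace F E)} (h : verticalLift q = z)
    (hz : z.proj ∈ (bundleChart B F E m).source) :
    (pullbackChart B F E m).toPartialEquiv q =
      (((bundleChart B F E m).tmap z).1, ((bundleChart B F E m).tmap z).2.2) := by
  subst h
  rw [verticalLift_proj] at hz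
  rw [tmap_verticalLift hz]

theorem SmoothChart.tmap_sub {A : Type*} [NormedAddCommGroup A] [NormedSpace ℝ A]
    {H : Type*} [TopologicalSpace H] {I : ModelWithCorners ℝ A H}
    {N : Type*} [TopologicalSpace N] [ChartedSpace H N]
    {A' : Type*} [NormedAddCommGroup A'] [NormedSpace ℝ A'] (c : SmoothChart I N A') {x : N}
    (v w : TangentSpace I x) :
    (c.tmap ⟨x, v - w⟩).2 = (c.tmap ⟨x, v⟩).2 - (c.tmap ⟨x, w⟩).2 :=
  map_sub (mfderiv I 𝓘(ℝ, A') c.toPartialEquiv x) v w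

theorem SmoothChart.tmap_add {A : Type*} [NormedAddCommGroup A] [NormedSpace ℝ A]
    {H : Type*} [TopologicalSpace H] {I : ModelWithCorners ℝ A H}
    {N : Type*} [TopologicalSpace N] [ChartedSpace H N]
    {A' : Type*} [NormedAddCommGroup A'] [NormedSpace ℝ A'] (c : SmoothChart I N A') {x : N}
    (v w : TangentSpace I x) :
    (c.tmap ⟨x, v + w⟩).2 = (c.tmap ⟨x, v⟩).2 + (c.tmap ⟨x, w⟩).2 :=
  map_add (mfderiv I 𝓘(ℝ, A') c.toPartialEquiv x) v w

namespace EhresmannConnection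

/-- In coordinates a basic field is `(x, y) ↦ (X x, Γ(x, y) (X x) + η x)`. -/
theorem IsBasicField.exists_fieldCoord {U : Set M}
    {Y : ∀ a : TotalSpace F E, TangentSpace (𝓘(ℝ, B).prod 𝓘(ℝ, F)) a}
    (hY : Hor.IsBasicField U Y) (m : M) :
    ∃ (X : B → B) (η : B → F), ∀ z ∈ (bundleChart B F E m).target,
      (baseChart B m).toPartialEquiv.symm z.1 ∈ U →
      (bundleChart B F E m).fieldCoord Y z = (X z.1, Hor.coeff m z (X z.1) + η z.1) := by
  obtain ⟨-, ⟨X, -, hX⟩, η, -, hη⟩ := hY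
  refine ⟨fun x => ((baseChart B m).tmap ⟨_, X ((baseChart B m).toPartialEquiv.symm x)⟩).2,
    fun x => (trivializationAt F E m ⟨_, η ((baseChart B m).toPartialEquiv.symm x)⟩).2,
    fun z hz hzU => ?_⟩
  have ha := (bundleChart B F E m).map_target hz
  have hproj := bundleChart_symm_proj hz
  have hca : (bundleChart B F E m).toPartialEquiv
    ((bundleChart B F E m).toPartialEquiv.symm z) = z := (bundleChart B F E m).right_inv hz
  rw [SmoothChart.fieldCoord]
  beta_reduce
  rw [← hproj] at hzU ⊢
  generalize ((bundleChart B F E m).toPartialEquiv.symm z) = a at *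
  have h1 := tmap_tangentMap_proj_eq (p := ⟨a, η a.proj⟩) ha (Y a)
  have h2 := Hor.tmap_lift ha (mfderiv (𝓘(ℝ, B).prod 𝓘(ℝ, F)) 𝓘(ℝ, B)
      (TotalSpace.proj : TotalSpace F E → M) a (Y a))
  have h3 := congrArg (fun u => ((bundleChart B F E m).tmap u).2) (hη a hzU)
  simp only [SmoothChart.tmap_sub] at h3
  rw [tmap_verticalLift (p := ⟨a, η a.proj⟩) ha, pullbackChart_apply (p := ⟨a, η a.proj⟩) ha] at h3
  have h4 := hX a hzU
  simp only [horPart] at h3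
  rw [h2] at h3
  simp only [h4] at h1 h2 h3
  rw [hca] at h3
  have h5 := eq_add_of_sub_eq h3
  refine h5.trans (Prod.ext (zero_add _) (add_comm _ _))

end EhresmannConnection

end BasicFields

/-! ### Parallel transport of the linearization -/

section Transport

variable {B : Type*} [NormedAddCommGroup B] [NormedSpace ℝ B]
  {M : Type*} [TopologicalSpace M] [ChartedSpace B M] [IsManifold 𝓘(ℝ, B) ∞ M]
  {F : Type*} [NormedAddCommGroup F] [NormedSpace ℝ F]
  {E : M → Type*} [∀ m, AddCommMonoid (E m)] [∀ m, Module ℝ (E m)]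
  [∀ m, TopologicalSpace (E m)] [TopologicalSpace (TotalSpace F E)]
  [FiberBundle F E] [VectorBundle ℝ F E] [ContMDiffVectorBundle ∞ F E 𝓘(ℝ, B)]
  {Hor : EhresmannConnection 𝓘(ℝ, B) F E} {m : M}

namespace EhresmannConnection

/-- This is where being basic matters: along a fibre `X` and `η` are constant, so only `Γ` is
differentiated. The first component `0` makes the flow preserve verticality; the second is the
linearized coefficient. -/
theorem IsBasicField.fderiv_fieldCoord {U : Set M} (hU : IsOpen U)
    {Y : ∀ a : TotalSpace F E, TangentSpace (𝓘(ℝ, B).prod 𝓘(ℝ, F)) a}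
    (hY : Hor.IsBasicField U Y) {a : TotalSpace F E} (ha : a ∈ (bundleChart B F E m).source)
    (haU : a.proj ∈ U) (y : F) :
    fderiv ℝ ((bundleChart B F E m).fieldCoord Y) ((bundleChart B F E m).toPartialEquiv a) (0, y) =
      (0, fderiv ℝ (Hor.coeff m) ((bundleChart B F E m).toPartialEquiv a) (0, y)
        ((bundleChart B F E m).fieldCoord Y ((bundleChart B F E m).toPartialEquiv a)).1) := by
  have hW : IsOpen (TotalSpace.proj ⁻¹' U : Set (TotalSpace F E)) :=
    hU.preimage (FiberBundle.continuous_proj F E)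
  have hd := ((bundleChart B F E m).contDiffAt_fieldCoord hW hY.1 ha haU).differentiableAt (by simp)
  have ht := (bundleChart B F E m).map_source ha
  obtain ⟨X, η, hX⟩ := hY.exists_fieldCoord m
  have hbase : (baseChart B m).toPartialEquiv.symm ((bundleChart B F E m).toPartialEquiv a).1 ∈ U := by
    rw [← bundleChart_symm_proj ht]
    have e : (bundleChart B F E m).toPartialEquiv.symm
      ((bundleChart B F E m).toPartialEquiv a) = a := (bundleChart B F E m).left_inv ha
    rw [e]
    exact haU
  have ht' : (bundleChart B F E m).toPartialEquiv a ∈ (bundleChart B F E m).target := ht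
  generalize (bundleChart B F E m).toPartialEquiv a = z at *
  -- `exists_fieldCoord` gives `X` and `η` without smoothness, so the derivative is computed along a
  -- line in the fibre, where both are constant.
  have hl : HasDerivAt (fun s : ℝ => (z.1, z.2 + s • y)) ((0 : B), y) 0 := hasDerivAt_line _ _ _ _
  have hl0 : (z.1, z.2 + (0 : ℝ) • y) = z := by simp
  have h1 : HasDerivAt (fun s : ℝ => (bundleChart B F E m).fieldCoord Y (z.1, z.2 + s • y))
      (fderiv ℝ ((bundleChart B F E m).fieldCoord Y) z (0, y)) 0 := by
    have h0 := hd.hasFDerivAt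
    rw [← hl0] at h0
    have h3 := h0.comp_hasDerivAt (0 : ℝ) hl
    rw [hl0] at h3
    exact h3
  have h2 : HasDerivAt (fun s : ℝ => (X z.1, Hor.coeff m (z.1, z.2 + s • y) (X z.1) + η z.1))
      ((0 : B), fderiv ℝ (Hor.coeff m) z (0, y) (X z.1)) 0 := by
    refine (hasDerivAt_const _ _).prodMk (HasDerivAt.add_const _ ?_)
    have h0 := ((Hor.contDiffAt_coeff ht').differentiableAt (by simp)).hasFDerivAt
    rw [← hl0] at h0
    have h3 := h0.comp_hasDerivAt (0 : ℝ) hl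
    rw [hl0] at h3
    exact (ContinuousLinearMap.apply ℝ F (X z.1)).hasFDerivAt.comp_hasDerivAt (0 : ℝ) h3
  rw [hX z ht' hbase]
  refine h1.unique (h2.congr_of_eventuallyEq (Filter.Eventually.of_forall fun s => ?_))
  exact hX (z.1, z.2 + s • y) (mk_mem_bundleChart_target _ ht') hbase

variable {Hor' : EhresmannConnection (𝓘(ℝ, B).prod 𝓘(ℝ, F)) F (PullbackFibre 𝓘(ℝ, B) F E)}

/-- Horizontal lifts with respect to the linearization solve a linear equation in coordinates. -/
theorem IsLinearization.hasDerivAt_snd (h : Hor.IsLinearization Hor')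
    {σ : ℝ → PullbackTotal 𝓘(ℝ, B) F E} {t : ℝ}
    (hσ : MDifferentiableAt 𝓘(ℝ, ℝ) ((𝓘(ℝ, B).prod 𝓘(ℝ, F)).prod 𝓘(ℝ, F)) σ t)
    (ht : (σ t).proj ∈ (bundleChart B F E m).source)
    (hv : velocity ((𝓘(ℝ, B).prod 𝓘(ℝ, F)).prod 𝓘(ℝ, F)) σ t ∈ Hor'.horizontal) :
    HasDerivAt (fun s => ((pullbackChart B F E m).toPartialEquiv (σ s)).2)
      (fderiv ℝ (Hor.coeff m) ((bundleChart B F E m).toPartialEquiv (σ t).proj)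
        (0, ((pullbackChart B F E m).toPartialEquiv (σ t)).2)
        (deriv (fun s => (bundleChart B F E m).toPartialEquiv (σ s).proj) t).1) t := by
  have h1 := (pullbackChart B F E m).hasDerivAt_comp hσ (mem_pullbackChart_source.2 ht)
  obtain ⟨w, hw⟩ := hv
  have h2 : velocity ((𝓘(ℝ, B).prod 𝓘(ℝ, F)).prod 𝓘(ℝ, F)) σ t = ⟨σ t, Hor'.lift (σ t) w⟩ :=
    congrArg (TotalSpace.mk (σ t)) hw
  rw [h2, h.tmap_lift Hor ht w] at h1
  have hev : ∀ᶠ s in 𝓝 t, (σ s).proj ∈ (bundleChart B F E m).source :=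
    ((FiberBundle.continuous_proj F _).continuousAt.comp hσ.continuousAt).preimage_mem_nhds
      ((bundleChart B F E m).open_source.mem_nhds ht)
  have h3 : HasDerivAt (fun s => (bundleChart B F E m).toPartialEquiv (σ s).proj)
      ((bundleChart B F E m).tmap ⟨(σ t).proj, w⟩).2 t := by
    refine ((ContinuousLinearMap.fst ℝ (B × F) F).hasFDerivAt.comp_hasDerivAt t
      h1).congr_of_eventuallyEq ?_
    filter_upwards [hev] with s hs using (pullbackChart_fst hs).symm
  have h4 := (ContinuousLinearMap.snd ℝ (B × F) F).hasFDerivAt.comp_hasDerivAt t h1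
  rw [h3.deriv, ← pullbackChart_fst ht]
  exact h4

theorem IsHorizontalLift.contMDiffAt {γ : ℝ → TotalSpace F E} {S : Set ℝ} (hS : IsOpen S)
    {σ : ℝ → PullbackTotal 𝓘(ℝ, B) F E} (h : Hor'.IsHorizontalLift γ S σ) {t : ℝ} (ht : t ∈ S) :
    ContMDiffAt 𝓘(ℝ, ℝ) ((𝓘(ℝ, B).prod 𝓘(ℝ, F)).prod 𝓘(ℝ, F)) ∞ σ t :=
  h.2.1.contMDiffAt (hS.mem_nhds ht)

/-- Horizontal lifts with respect to the linearization are determined by their initial values. -/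
theorem IsLinearization.eqOn_of_isHorizontalLift (h : Hor.IsLinearization Hor')
    {γ : ℝ → TotalSpace F E} {S : Set ℝ} (hS : IsOpen S) (hS' : OrdConnected S)
    {σ τ : ℝ → PullbackTotal 𝓘(ℝ, B) F E} (hσ : Hor'.IsHorizontalLift γ S σ)
    (hτ : Hor'.IsHorizontalLift γ S τ) {t₀ : ℝ} (ht₀ : t₀ ∈ S) (h₀ : σ t₀ = τ t₀) :
    ∀ t ∈ S, σ t = τ t := by
  refine hS'.isPreconnected.forall_of_locally (P := fun t => σ t = τ t) ht₀ h₀ fun t ht => ?_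
  have hmem : (σ t).proj ∈ (bundleChart B F E (γ t).proj).source := by
    rw [hσ.1 t ht]
    exact mem_bundleChart_self (γ t)
  generalize (γ t).proj = m at hmem
  have hev : ∀ᶠ s in 𝓝 t, s ∈ S ∧ (σ s).proj ∈ (bundleChart B F E m).source :=
    (Filter.Eventually.and (hS.mem_nhds ht)
      (((FiberBundle.continuous_proj F _).continuousAt.comp
      (hσ.contMDiffAt hS ht).continuousAt).preimage_mem_nhds
        ((bundleChart B F E m).open_source.mem_nhds hmem)))
  have hproj : ∀ s ∈ S, (τ s).proj = (σ s).proj := fun s hs => (hτ.1 s hs).trans (hσ.1 s hs).symm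
  let g : ℝ → B × F := fun s => (bundleChart B F E m).toPartialEquiv (σ s).proj
  have hsm : ContDiffAt ℝ ∞ g t :=
    ((bundleChart B F E m).contMDiffAt_comp (f := fun s => (σ s).proj) hmem
      ((contMDiffAt_proj _).comp t (hσ.contMDiffAt hS ht))).contDiffAt
  -- `A s` is `y' ↦ ∂_yΓ(g s)(y') ẋ(s)`. It depends only on the common projection of `σ` and `τ`, so
  -- their difference solves the same linear equation.
  let A : ℝ → F →L[ℝ] F := fun s => (ContinuousLinearMap.apply ℝ F (deriv g s).1).comp
    ((fderiv ℝ (Hor.coeff m) (g s)).comp (ContinuousLinearMap.inr ℝ B F))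
  have hA : ContinuousAt A t := by
    have h1 : ContinuousAt (deriv g) t :=
      (hsm.continuousAt_fderiv (by simp)).clm_apply (continuousAt_const (y := (1 : ℝ)))
    have h2 : ContinuousAt (fun s => fderiv ℝ (Hor.coeff m) (g s)) t :=
      ContinuousAt.comp (f := g) ((Hor.contDiffAt_coeff ((bundleChart B F E m).map_source
        hmem)).fderiv_right (m := 0) (by simp)).continuousAt hsm.continuousAt
    exact (((ContinuousLinearMap.apply ℝ F).continuous.continuousAt.comp
      (continuousAt_fst.comp h1)).clm_comp (h2.clm_comp continuousAt_const))
  have hu : ∀ᶠ s in 𝓝 t, HasDerivAt (fun s => ((pullbackChart B F E m).toPartialEquiv (σ s)).2 -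
      ((pullbackChart B F E m).toPartialEquiv (τ s)).2)
      (A s (((pullbackChart B F E m).toPartialEquiv (σ s)).2 -
        ((pullbackChart B F E m).toPartialEquiv (τ s)).2)) s := by
    filter_upwards [hev] with s hs
    have hs' : (τ s).proj ∈ (bundleChart B F E m).source := by rw [hproj s hs.1]; exact hs.2
    have h1 := h.hasDerivAt_snd ((hσ.contMDiffAt hS hs.1).mdifferentiableAt (by simp)) hs.2
      (hσ.2.2 s hs.1)
    have h2 := h.hasDerivAt_snd ((hτ.contMDiffAt hS hs.1).mdifferentiableAt (by simp)) hs'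
      (hτ.2.2 s hs.1)
    have h3 : (fun s => (bundleChart B F E m).toPartialEquiv (τ s).proj) =ᶠ[𝓝 s] g := by
      filter_upwards [hS.mem_nhds hs.1] with r hr
      rw [hproj r hr]
    rw [h3.deriv_eq, hproj s hs.1] at h2
    rw [map_sub]
    exact h1.sub h2
  obtain ⟨δ, hδ, H⟩ := exists_forall_linear_ode_eq_zero hA hu
  have key : ∀ s, s ∈ S → (σ s).proj ∈ (bundleChart B F E m).source →
      (σ s = τ s ↔ ((pullbackChart B F E m).toPartialEquiv (σ s)).2 -
      ((pullbackChart B F E m).toPartialEquiv (τ s)).2 = 0) := by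
    intro s hs hs2
    have hs' : (τ s).proj ∈ (bundleChart B F E m).source := by rw [hproj s hs]; exact hs2
    refine ⟨fun e => by rw [e, sub_self], fun e => ?_⟩
    refine (pullbackChart B F E m).injOn (mem_pullbackChart_source.2 hs2)
      (mem_pullbackChart_source.2 hs') (Prod.ext ?_ (sub_eq_zero.1 e))
    rw [pullbackChart_fst hs2, pullbackChart_fst hs', hproj s hs]
  refine ⟨_, Filter.inter_mem hev (Ioo_mem_nhds (sub_lt_self t hδ) (lt_add_of_pos_right t hδ)), ?_⟩
  intro y hy hσy z hz
  exact (key z hz.1.1 hz.1.2).2 (H y hy.2 ((key y hy.1.1 hy.1.2).1 hσy) z hz.2)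

/-! ### Fibre derivatives of flows of basic fields -/

section Flow

variable {U : Set M} {Y : ∀ a : TotalSpace F E, TangentSpace (𝓘(ℝ, B).prod 𝓘(ℝ, F)) a}
  {D : Set (ℝ × TotalSpace F E)} {φ : ℝ → TotalSpace F E → TotalSpace F E}
  {p : PullbackTotal 𝓘(ℝ, B) F E} {s : ℝ}

theorem contMDiff_addSMul_left (p : PullbackTotal 𝓘(ℝ, B) F E) :
    ContMDiff 𝓘(ℝ, ℝ) (𝓘(ℝ, B).prod 𝓘(ℝ, F)) ∞ (fun s : ℝ => addSMul s p) :=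
  contMDiff_addSMul.comp (contMDiff_id.prodMk contMDiff_const)

theorem contMDiffAt_flow_addSMul
    (hflow : IsLocalFlow (𝓘(ℝ, B).prod 𝓘(ℝ, F)) (TotalSpace.proj ⁻¹' U) Y D φ)
    (hs : (s, p.proj) ∈ D) :
    ContMDiffAt 𝓘(ℝ, ℝ × ℝ) (𝓘(ℝ, B).prod 𝓘(ℝ, F)) ∞
      (fun q : ℝ × ℝ => φ q.1 (addSMul q.2 p)) (s, 0) := by
  rw [← addSMul_zero p] at hs
  have h1 : ContMDiffAt 𝓘(ℝ, ℝ × ℝ) 𝓘(ℝ, ℝ) ∞ (Prod.fst : ℝ × ℝ → ℝ) (s, 0) :=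
    contDiff_fst.contMDiff.contMDiffAt
  have h2 : ContMDiffAt 𝓘(ℝ, ℝ × ℝ) 𝓘(ℝ, ℝ) ∞ (Prod.snd : ℝ × ℝ → ℝ) (s, 0) :=
    contDiff_snd.contMDiff.contMDiffAt
  exact ContMDiffAt.comp (g := fun q : ℝ × TotalSpace F E => φ q.1 q.2)
    (f := fun q : ℝ × ℝ => (q.1, addSMul q.2 p)) (s, (0 : ℝ)) (hflow.contMDiffAt hs)
    (h1.prodMk ((contMDiff_addSMul_left p).contMDiffAt.comp (s, (0 : ℝ)) h2))

theorem tangentMap_flow_verticalLift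
    (hflow : IsLocalFlow (𝓘(ℝ, B).prod 𝓘(ℝ, F)) (TotalSpace.proj ⁻¹' U) Y D φ)
    (hs : (s, p.proj) ∈ D) :
    tangentMap (𝓘(ℝ, B).prod 𝓘(ℝ, F)) (𝓘(ℝ, B).prod 𝓘(ℝ, F)) (φ s) (verticalLift p) =
      velocity (𝓘(ℝ, B).prod 𝓘(ℝ, F)) (fun ε => φ s (addSMul ε p)) 0 := by
  rw [← addSMul_zero p] at hs
  exact tangentMap_velocity ((hflow.contMDiffAt_right hs).mdifferentiableAt (by simp))
    ((contMDiff_addSMul_left p).contMDiffAt.mdifferentiableAt (by simp))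

theorem tangentMap_flow_verticalLift_proj (φ : TotalSpace F E → TotalSpace F E) :
    (tangentMap (𝓘(ℝ, B).prod 𝓘(ℝ, F)) (𝓘(ℝ, B).prod 𝓘(ℝ, F)) φ (verticalLift p)).proj =
      φ p.proj :=
  congrArg φ (verticalLift_proj p)

/-- The family `(s, ε) ↦ φ_s(a + ε b)` in coordinates, to which the variation equation is applied;
its `ε`-derivative at `0` is `Tφ_s` of the vertical lift. -/
theorem contDiffAt_flowCoord
    (hflow : IsLocalFlow (𝓘(ℝ, B).prod 𝓘(ℝ, F)) (TotalSpace.proj ⁻¹' U) Y D φ)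
    (hs : (s, p.proj) ∈ D) (hm : φ s p.proj ∈ (bundleChart B F E m).source) :
    ContDiffAt ℝ ∞ (fun q : ℝ × ℝ =>
      (bundleChart B F E m).toPartialEquiv (φ q.1 (addSMul q.2 p))) (s, 0) := by
  rw [← addSMul_zero p] at hm
  exact ((bundleChart B F E m).contMDiffAt_comp (f := fun q : ℝ × ℝ => φ q.1 (addSMul q.2 p))
    (x := (s, 0)) hm (contMDiffAt_flow_addSMul hflow hs)).contDiffAt

theorem tmap_flow_verticalLift
    (hflow : IsLocalFlow (𝓘(ℝ, B).prod 𝓘(ℝ, F)) (TotalSpace.proj ⁻¹' U) Y D φ)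
    (hs : (s, p.proj) ∈ D) (hm : φ s p.proj ∈ (bundleChart B F E m).source) :
    (bundleChart B F E m).tmap (tangentMap (𝓘(ℝ, B).prod 𝓘(ℝ, F)) (𝓘(ℝ, B).prod 𝓘(ℝ, F)) (φ s)
        (verticalLift p)) = ((bundleChart B F E m).toPartialEquiv (φ s p.proj),
      fderiv ℝ (fun q : ℝ × ℝ =>
        (bundleChart B F E m).toPartialEquiv (φ q.1 (addSMul q.2 p))) (s, 0) (0, 1)) := by
  have hd := ((contDiffAt_flowCoord hflow hs hm).differentiableAt (by simp)).hasFDerivAt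
  have hl : HasDerivAt (fun ε : ℝ => (s, ε)) ((0 : ℝ), (1 : ℝ)) 0 :=
    (hasDerivAt_const _ s).prodMk (hasDerivAt_id _)
  have h1 := hd.comp_hasDerivAt (0 : ℝ) hl
  have hc : ContinuousAt (fun ε : ℝ => φ s (addSMul ε p)) 0 :=
    ContinuousAt.comp (f := fun ε : ℝ => (s, ε)) (g := fun q : ℝ × ℝ => φ q.1 (addSMul q.2 p))
      (contMDiffAt_flow_addSMul hflow hs).continuousAt hl.continuousAt
  have hm' : φ s (addSMul 0 p) ∈ (bundleChart B F E m).source := by rwa [addSMul_zero]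
  rw [tangentMap_flow_verticalLift hflow hs, (bundleChart B F E m).tmap_velocity hc hm' h1,
    addSMul_zero]

theorem eventually_flow_mem
    (hflow : IsLocalFlow (𝓘(ℝ, B).prod 𝓘(ℝ, F)) (TotalSpace.proj ⁻¹' U) Y D φ)
    (hs : (s, p.proj) ∈ D) (hm : φ s p.proj ∈ (bundleChart B F E m).source) :
    ∀ᶠ t in 𝓝 s, (t, p.proj) ∈ D ∧ φ t p.proj ∈ (bundleChart B F E m).source :=
  Filter.Eventually.and ((hflow.isOpen_times p.proj).mem_nhds hs)
    ((hflow.contMDiffAt_left hs).continuousAt.preimage_mem_nhds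
      ((bundleChart B F E m).open_source.mem_nhds hm))

theorem contDiffAt_tmap_flow
    (hflow : IsLocalFlow (𝓘(ℝ, B).prod 𝓘(ℝ, F)) (TotalSpace.proj ⁻¹' U) Y D φ)
    (hs : (s, p.proj) ∈ D) (hm : φ s p.proj ∈ (bundleChart B F E m).source) :
    ContDiffAt ℝ ∞ (fun t => (bundleChart B F E m).tmap
      (tangentMap (𝓘(ℝ, B).prod 𝓘(ℝ, F)) (𝓘(ℝ, B).prod 𝓘(ℝ, F)) (φ t) (verticalLift p))) s := by
  have hl : ContDiffAt ℝ ∞ (fun t : ℝ => (t, (0 : ℝ))) s := by fun_prop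
  have h := contDiffAt_flowCoord hflow hs hm
  have h1 := ContDiffAt.comp (f := fun t : ℝ => (t, (0 : ℝ))) s h hl
  have h2 := ContDiffAt.comp (f := fun t : ℝ => (t, (0 : ℝ))) s
    ((h.fderiv_right (m := ∞) (by simp)).clm_apply
      (contDiffAt_const (c := ((0 : ℝ), (1 : ℝ))))) hl
  refine (h1.prodMk h2).congr_of_eventuallyEq ?_
  filter_upwards [eventually_flow_mem hflow hs hm] with t ht
  rw [tmap_flow_verticalLift hflow ht.1 ht.2]
  simp only [comp_apply, addSMul_zero]

theorem hasDerivAt_tmap_flow (hU : IsOpen U)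
    (hY : IsSmoothFieldOn (𝓘(ℝ, B).prod 𝓘(ℝ, F)) (TotalSpace.proj ⁻¹' U) Y)
    (hflow : IsLocalFlow (𝓘(ℝ, B).prod 𝓘(ℝ, F)) (TotalSpace.proj ⁻¹' U) Y D φ)
    (hs : (s, p.proj) ∈ D) (hm : φ s p.proj ∈ (bundleChart B F E m).source) :
    HasDerivAt (fun t => ((bundleChart B F E m).tmap (tangentMap (𝓘(ℝ, B).prod 𝓘(ℝ, F))
        (𝓘(ℝ, B).prod 𝓘(ℝ, F)) (φ t) (verticalLift p))).2)
      (fderiv ℝ ((bundleChart B F E m).fieldCoord Y)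
        ((bundleChart B F E m).toPartialEquiv (φ s p.proj))
        ((bundleChart B F E m).tmap (tangentMap (𝓘(ℝ, B).prod 𝓘(ℝ, F))
          (𝓘(ℝ, B).prod 𝓘(ℝ, F)) (φ s) (verticalLift p))).2) s := by
  have hW : IsOpen (TotalSpace.proj ⁻¹' U : Set (TotalSpace F E)) :=
    hU.preimage (FiberBundle.continuous_proj F E)
  have hf := ((bundleChart B F E m).contDiffAt_fieldCoord hW hY hm
    (hflow.mem _ _ hs)).differentiableAt (by simp)
  have hev : ∀ᶠ q in 𝓝 (s, (0 : ℝ)), (q.1, addSMul q.2 p) ∈ D ∧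
      φ q.1 (addSMul q.2 p) ∈ (bundleChart B F E m).source := by
    have hs' := hs
    have hm' := hm
    rw [← addSMul_zero p] at hs' hm'
    refine Filter.Eventually.and (ContinuousAt.preimage_mem_nhds (f := fun q : ℝ × ℝ =>
      (q.1, addSMul q.2 p)) ?_ (hflow.isOpen_domain.mem_nhds hs'))
      ((contMDiffAt_flow_addSMul hflow hs).continuousAt.preimage_mem_nhds
        ((bundleChart B F E m).open_source.mem_nhds hm'))
    exact continuousAt_fst.prodMk
      ((continuous_addSMul_left p).continuousAt.comp continuousAt_snd)
  have h := hasDerivAt_variation (f := (bundleChart B F E m).fieldCoord Y)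
    (contDiffAt_infty.1 (contDiffAt_flowCoord hflow hs hm) 2) (by
      simpa only [addSMul_zero] using hf)
    (hev.mono fun q hq => hflow.hasDerivAt_comp (bundleChart B F E m) hq.1 hq.2)
  simp only [addSMul_zero] at h
  rw [tmap_flow_verticalLift hflow hs hm]
  refine h.congr_of_eventuallyEq ?_
  filter_upwards [eventually_flow_mem hflow hs hm] with t ht
  rw [tmap_flow_verticalLift hflow ht.1 ht.2]

theorem tangentMap_zero_flow
    (hflow : IsLocalFlow (𝓘(ℝ, B).prod 𝓘(ℝ, F)) (TotalSpace.proj ⁻¹' U) Y D φ)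
    (h0 : ((0 : ℝ), p.proj) ∈ D) :
    tangentMap (𝓘(ℝ, B).prod 𝓘(ℝ, F)) (𝓘(ℝ, B).prod 𝓘(ℝ, F)) (φ 0) (verticalLift p) =
      verticalLift p := by
  rw [tangentMap_flow_verticalLift hflow h0]
  refine velocity_congr ?_
  rw [← addSMul_zero p] at h0
  have hc : ContinuousAt (fun ε : ℝ => ((0 : ℝ), addSMul ε p)) 0 :=
    continuousAt_const.prodMk (continuous_addSMul_left p).continuousAt
  filter_upwards [hc.preimage_mem_nhds (hflow.isOpen_domain.mem_nhds h0)] with ε hε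
  exact hflow.map_zero _ hε

/-- The flow of a basic field maps vertical vectors to vertical vectors. -/
theorem IsBasicField.exists_verticalLift_eq (hU : IsOpen U) (hY : Hor.IsBasicField U Y)
    (hflow : IsLocalFlow (𝓘(ℝ, B).prod 𝓘(ℝ, F)) (TotalSpace.proj ⁻¹' U) Y D φ)
    (h0 : ((0 : ℝ), p.proj) ∈ D) :
    ∀ s ∈ {s | (s, p.proj) ∈ D}, ∃ q, verticalLift q = tangentMap (𝓘(ℝ, B).prod 𝓘(ℝ, F))
      (𝓘(ℝ, B).prod 𝓘(ℝ, F)) (φ s) (verticalLift p) := by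
  refine (hflow.ordConnected p.proj).isPreconnected.forall_of_locally (x₀ := 0)
    (P := fun s => ∃ q, verticalLift q = tangentMap (𝓘(ℝ, B).prod 𝓘(ℝ, F))
      (𝓘(ℝ, B).prod 𝓘(ℝ, F)) (φ s) (verticalLift p)) h0
    ⟨p, (tangentMap_zero_flow hflow h0).symm⟩ fun t ht => ?_
  have hm := mem_bundleChart_self (B := B) (φ t p.proj)
  generalize (φ t p.proj).proj = m at hm
  have hW : IsOpen (TotalSpace.proj ⁻¹' U : Set (TotalSpace F E)) :=
    hU.preimage (FiberBundle.continuous_proj F E)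
  have hev := eventually_flow_mem hflow ht hm
  have hf := (bundleChart B F E m).contDiffAt_fieldCoord hW hY.1 hm (hflow.mem _ _ ht)
  -- The base-to-base block of the derivative of the field along the flow line.
  let A : ℝ → B →L[ℝ] B := fun s => (ContinuousLinearMap.fst ℝ B F).comp
    ((fderiv ℝ ((bundleChart B F E m).fieldCoord Y)
        ((bundleChart B F E m).toPartialEquiv (φ s p.proj))).comp (ContinuousLinearMap.inl ℝ B F))
  have hA : ContinuousAt A t := by
    refine continuousAt_const.clm_comp (ContinuousAt.clm_comp ?_ continuousAt_const)
    exact ContinuousAt.comp (f := fun s => (bundleChart B F E m).toPartialEquiv (φ s p.proj))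
      (hf.continuousAt_fderiv (by simp)) (hflow.hasDerivAt_comp _ ht hm).continuousAt
  have hu : ∀ᶠ s in 𝓝 t, HasDerivAt (fun t => ((bundleChart B F E m).tmap
      (tangentMap (𝓘(ℝ, B).prod 𝓘(ℝ, F)) (𝓘(ℝ, B).prod 𝓘(ℝ, F)) (φ t) (verticalLift p))).2.1)
      (A s ((bundleChart B F E m).tmap (tangentMap (𝓘(ℝ, B).prod 𝓘(ℝ, F))
        (𝓘(ℝ, B).prod 𝓘(ℝ, F)) (φ s) (verticalLift p))).2.1) s := by
    filter_upwards [hev] with s hs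
    have h1 := (ContinuousLinearMap.fst ℝ B F).hasFDerivAt.comp_hasDerivAt s
      (hasDerivAt_tmap_flow hU hY.1 hflow hs.1 hs.2)
    have h2 := hY.fderiv_fieldCoord hU hs.2 (hflow.mem _ _ hs.1)
    refine h1.congr_deriv ?_
    generalize ((bundleChart B F E m).tmap (tangentMap (𝓘(ℝ, B).prod 𝓘(ℝ, F))
        (𝓘(ℝ, B).prod 𝓘(ℝ, F)) (φ s) (verticalLift p))).2 = v
    -- By `fderiv_fieldCoord` the part `(0, v.2)` contributes nothing to the base component, so that
    -- component satisfies the closed equation with coefficient `A`.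
    have h3 : v = (v.1, (0 : F)) + (0, v.2) := by simp
    rw [h3, map_add, map_add, h2]
    simp [A]
  obtain ⟨δ, hδ, H⟩ := exists_forall_linear_ode_eq_zero hA hu
  have key : ∀ s, φ s p.proj ∈ (bundleChart B F E m).source → _ := fun s hs =>
    exists_verticalLift_eq_iff (z := tangentMap (𝓘(ℝ, B).prod 𝓘(ℝ, F))
        (𝓘(ℝ, B).prod 𝓘(ℝ, F)) (φ s) (verticalLift p)) (m := m)
      (by rw [tangentMap_flow_verticalLift_proj]; exact hs)
  refine ⟨_, Filter.inter_mem hev (Ioo_mem_nhds (sub_lt_self t hδ) (lt_add_of_pos_right t hδ)), ?_⟩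
  intro y hy hσy z hz
  exact (key z hz.1.2).2 (H y hy.2 ((key y hy.1.2).1 hσy) z hz.2)

/-- Along the flow line the image of the vertical lift is vertical, so `fibreDeriv` never takes its
default value there. -/
theorem IsBasicField.verticalLift_fibreDeriv (hU : IsOpen U) (hY : Hor.IsBasicField U Y)
    (hflow : IsLocalFlow (𝓘(ℝ, B).prod 𝓘(ℝ, F)) (TotalSpace.proj ⁻¹' U) Y D φ)
    (h0 : ((0 : ℝ), p.proj) ∈ D) (hs : (s, p.proj) ∈ D) :
    verticalLift (fibreDeriv (φ s) p) = tangentMap (𝓘(ℝ, B).prod 𝓘(ℝ, F))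
      (𝓘(ℝ, B).prod 𝓘(ℝ, F)) (φ s) (verticalLift p) := by
  obtain ⟨q, hq⟩ := hY.exists_verticalLift_eq hU hflow h0 s hs
  rw [fibreDeriv, ← hq, verticalLift_injective.extend_apply, id]

/-- The fibre derivative of the flow of a basic field is horizontal. -/
theorem IsLinearization.isHorizontalLift_fibreDeriv (h : Hor.IsLinearization Hor')
    (hU : IsOpen U) (hY : Hor.IsBasicField U Y)
    (hflow : IsLocalFlow (𝓘(ℝ, B).prod 𝓘(ℝ, F)) (TotalSpace.proj ⁻¹' U) Y D φ)
    (h0 : ((0 : ℝ), p.proj) ∈ D) :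
    Hor'.IsHorizontalLift (fun s => φ s p.proj) {s | (s, p.proj) ∈ D}
      (fun s => fibreDeriv (φ s) p) := by
  have hV : ∀ s, (s, p.proj) ∈ D → _ := fun s hs => hY.verticalLift_fibreDeriv hU hflow h0 hs
  have hproj : ∀ s, (s, p.proj) ∈ D → (fibreDeriv (φ s) p).proj = φ s p.proj := fun s hs => by
    rw [← verticalLift_proj, hV s hs, tangentMap_flow_verticalLift_proj]
  have hcoord : ∀ (m : M) (s : ℝ), (s, p.proj) ∈ D →
      φ s p.proj ∈ (bundleChart B F E m).source →
      (pullbackChart B F E m).toPartialEquiv (fibreDeriv (φ s) p) =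
        (((bundleChart B F E m).tmap (tangentMap (𝓘(ℝ, B).prod 𝓘(ℝ, F))
          (𝓘(ℝ, B).prod 𝓘(ℝ, F)) (φ s) (verticalLift p))).1,
        ((bundleChart B F E m).tmap (tangentMap (𝓘(ℝ, B).prod 𝓘(ℝ, F))
          (𝓘(ℝ, B).prod 𝓘(ℝ, F)) (φ s) (verticalLift p))).2.2) := fun m s hs hm =>
    pullbackChart_of_verticalLift_eq (hV s hs) (by
      rw [tangentMap_flow_verticalLift_proj]; exact hm)
  have hsmooth : ∀ s, (s, p.proj) ∈ D → ContMDiffAt 𝓘(ℝ, ℝ)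
      ((𝓘(ℝ, B).prod 𝓘(ℝ, F)).prod 𝓘(ℝ, F)) ∞ (fun s => fibreDeriv (φ s) p) s := by
    intro s hs
    have hm := mem_bundleChart_self (B := B) (φ s p.proj)
    generalize (φ s p.proj).proj = m at hm
    have hev := eventually_flow_mem hflow hs hm
    have h1 := contDiffAt_tmap_flow hflow hs hm
    have h2 : ContDiffAt ℝ ∞ ((pullbackChart B F E m).toPartialEquiv ∘
        fun s => fibreDeriv (φ s) p) s := by
      refine (h1.fst.prodMk h1.snd.snd).congr_of_eventuallyEq ?_
      filter_upwards [hev] with t ht using hcoord m t ht.1 ht.2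
    have hev' : ∀ᶠ t in 𝓝 s, fibreDeriv (φ t) p ∈ (pullbackChart B F E m).source := by
      filter_upwards [hev] with t ht
      rw [mem_pullbackChart_source, hproj t ht.1]
      exact ht.2
    exact (pullbackChart B F E m).contMDiffAt_of_comp
      ((pullbackChart B F E m).continuousAt_of_comp hev' h2.continuousAt) hev'.self_of_nhds
      h2.contMDiffAt
  refine ⟨hproj, fun s hs => (hsmooth s hs).contMDiffWithinAt, fun s hs => ?_⟩
  have hm := mem_bundleChart_self (B := B) (φ s p.proj)
  generalize (φ s p.proj).proj = m at hm
  have hev := eventually_flow_mem hflow hs hm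
  have hm' : (fibreDeriv (φ s) p).proj ∈ (bundleChart B F E m).source := by
    rw [hproj s hs]; exact hm
  have hd1 : HasDerivAt (fun t => ((bundleChart B F E m).tmap (tangentMap (𝓘(ℝ, B).prod 𝓘(ℝ, F))
      (𝓘(ℝ, B).prod 𝓘(ℝ, F)) (φ t) (verticalLift p))).1) _ s :=
    (hflow.hasDerivAt_comp _ hs hm).congr_of_eventuallyEq (by
      filter_upwards [hev] with t ht
      rw [tmap_flow_verticalLift hflow ht.1 ht.2])
  have hd2 := (ContinuousLinearMap.snd ℝ B F).hasFDerivAt.comp_hasDerivAt s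
      (hasDerivAt_tmap_flow hU hY.1 hflow hs hm)
  have hd : HasDerivAt ((pullbackChart B F E m).toPartialEquiv ∘
        fun s => fibreDeriv (φ s) p) _ s :=
    (hd1.prodMk hd2).congr_of_eventuallyEq (by
      filter_upwards [hev] with t ht using hcoord m t ht.1 ht.2)
  have hvel := (pullbackChart B F E m).tmap_velocity (hsmooth s hs).continuousAt
    (mem_pullbackChart_source.2 hm') hd
  -- The velocity must be the lift of the velocity of the flow line, namely `Y` at its current
  -- point.
  have hlift := h.tmap_lift Hor hm' (Y (fibreDeriv (φ s) p).proj)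
  have heq : velocity ((𝓘(ℝ, B).prod 𝓘(ℝ, F)).prod 𝓘(ℝ, F)) (fun s => fibreDeriv (φ s) p) s =
      ⟨fibreDeriv (φ s) p, Hor'.lift (fibreDeriv (φ s) p) (Y (fibreDeriv (φ s) p).proj)⟩ := by
    refine (pullbackChart B F E m).tmap_injOn (mem_pullbackChart_source.2 hm')
      (mem_pullbackChart_source.2 hm') (hvel.trans (Eq.trans ?_ hlift.symm))
    have hY' := hY.fderiv_fieldCoord hU hm (hflow.mem _ _ hs)
    have hq := hcoord m s hs hm
    have hV1 := (exists_verticalLift_eq_iff (z := tangentMap (𝓘(ℝ, B).prod 𝓘(ℝ, F))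
        (𝓘(ℝ, B).prod 𝓘(ℝ, F)) (φ s) (verticalLift p)) (m := m)
      (by rw [tangentMap_flow_verticalLift_proj]; exact hm)).1 ⟨_, hV s hs⟩
    have hV0 : ((bundleChart B F E m).tmap (tangentMap (𝓘(ℝ, B).prod 𝓘(ℝ, F))
        (𝓘(ℝ, B).prod 𝓘(ℝ, F)) (φ s) (verticalLift p))).1 =
          (bundleChart B F E m).toPartialEquiv (φ s p.proj) := by
      rw [tmap_flow_verticalLift hflow hs hm]
    have hw := (bundleChart B F E m).fieldCoord_apply (Y := Y) hm'
    rw [hproj s hs] at hw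
    rw [hV0] at hq
    rw [hproj s hs, ← hw]
    generalize ((bundleChart B F E m).tmap (tangentMap (𝓘(ℝ, B).prod 𝓘(ℝ, F))
        (𝓘(ℝ, B).prod 𝓘(ℝ, F)) (φ s) (verticalLift p))).2 = v at *
    -- With zero base component, the fibre part of the variation equation is the formula in
    -- `linCoord`.
    have hv : v = (0, v.2) := Prod.ext hV1 rfl
    refine Prod.ext rfl (Prod.ext rfl ?_)
    rw [hv, hY']
    simp only [linCoord, hq]
    rfl
  rw [heq]
  exact ⟨_, rfl⟩

theorem IsLinearization.transportsByFlows (h : Hor.IsLinearization Hor') (hU : IsOpen U) :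
    Hor.TransportsByFlows Hor' U := by
  rintro Y hY D φ hflow a h0 p hp
  have hpa : p.proj = a := hp.trans (hflow.map_zero a h0)
  subst hpa
  have hzero : fibreDeriv (φ 0) p = p := verticalLift_injective (by
    rw [hY.verticalLift_fibreDeriv hU hflow h0 h0, tangentMap_zero_flow hflow h0])
  have hlift := h.isHorizontalLift_fibreDeriv hU hY hflow h0
  refine ⟨hzero, hlift, fun S σ hS hSo hSc h0S hσ hσ0 => ?_⟩
  exact h.eqOn_of_isHorizontalLift hSo hSc hσ
    ⟨fun s hs => hlift.1 s (hS hs), hlift.2.1.mono hS, fun s hs => hlift.2.2 s (hS hs)⟩ h0S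
    (hσ0.trans hzero.symm)

end Flow

end EhresmannConnection

end Transport

/-! ### Existence of local flows on manifolds -/

section LocalFlows

variable {A : Type*} [NormedAddCommGroup A] [NormedSpace ℝ A]
  {H : Type*} [TopologicalSpace H] {I : ModelWithCorners ℝ A H}
  {N : Type*} [TopologicalSpace N] [ChartedSpace H N] [IsManifold I ∞ N]
  {A' : Type*} [NormedAddCommGroup A'] [NormedSpace ℝ A'] [CompleteSpace A']

/-- A smooth vector field has a local flow around every point in the domain of a chart. -/
theorem SmoothChart.exists_isLocalFlow (c : SmoothChart I N A') {W : Set N} (hW : IsOpen W)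
    {Y : ∀ x : N, TangentSpace I x} (hY : IsSmoothFieldOn I W Y) {x₀ : N} (hx₀ : x₀ ∈ c.source)
    (hx₀W : x₀ ∈ W) : ∃ D φ, ((0 : ℝ), x₀) ∈ D ∧ IsLocalFlow I W Y D φ := by
  have hΩ : IsOpen (c.target ∩ c.toPartialEquiv.symm ⁻¹' W) :=
    c.contMDiffOn_invFun.continuousOn.isOpen_inter_preimage c.open_target hW
  have hf : ContDiffOn ℝ ∞ (c.fieldCoord Y) (c.target ∩ c.toPartialEquiv.symm ⁻¹' W) := by
    intro z hz
    have h := c.contDiffAt_fieldCoord hW hY (c.map_target hz.1) hz.2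
    have e : c.toPartialEquiv (c.toPartialEquiv.symm z) = z := c.right_inv hz.1
    rw [e] at h
    exact h.contDiffWithinAt
  have hz₀ : c.toPartialEquiv x₀ ∈ c.target ∩ c.toPartialEquiv.symm ⁻¹' W :=
    ⟨c.map_source hx₀, by
      have e : c.toPartialEquiv.symm (c.toPartialEquiv x₀) = x₀ := c.left_inv hx₀
      rw [mem_preimage, e]
      exact hx₀W⟩
  obtain ⟨δ, ψ, hδ, hψ, hψ0, hψf⟩ := exists_smooth_flow hΩ hf hz₀
  have hS : IsOpen (c.source ∩ c.toPartialEquiv ⁻¹' Metric.ball (c.toPartialEquiv x₀) δ) :=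
    c.contMDiffOn_toFun.continuousOn.isOpen_inter_preimage c.open_source Metric.isOpen_ball
  have hD := (isOpen_Ioo (a := -δ) (b := δ)).prod hS
  refine ⟨Ioo (-δ) δ ×ˢ (c.source ∩ c.toPartialEquiv ⁻¹' Metric.ball (c.toPartialEquiv x₀) δ),
    fun s x => c.toPartialEquiv.symm (ψ s (c.toPartialEquiv x)),
    ⟨⟨neg_lt_zero.2 hδ, hδ⟩, hx₀, Metric.mem_ball_self hδ⟩, ?_⟩
  refine ⟨hD, fun s x h => ⟨⟨neg_lt_zero.2 hδ, hδ⟩, h.2⟩, fun x => ?_, fun s x h =>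
    (hψf s h.1 _ h.2.2).1.2, ?_, fun x h => ?_, fun x s h => ?_⟩
  -- The domain is a product, so the set of times is the whole interval or empty.
  · by_cases hx : x ∈ c.source ∩ c.toPartialEquiv ⁻¹' Metric.ball (c.toPartialEquiv x₀) δ
    · convert ordConnected_Ioo (a := -δ) (b := δ)
      ext s
      exact ⟨fun h => h.1, fun h => ⟨h, hx⟩⟩
    · convert ordConnected_empty (α := ℝ)
      ext s
      exact ⟨fun h => hx h.2, fun h => h.elim⟩
  · rintro ⟨s, x⟩ h
    have h1 : ContMDiffAt (𝓘(ℝ, ℝ).prod I) 𝓘(ℝ, ℝ × A') ∞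
        (fun q : ℝ × N => (q.1, c.toPartialEquiv q.2)) (s, x) :=
      contMDiffAt_fst.prodMk_space
        (ContMDiffAt.comp (s, x) (c.contMDiffAt h.2.1) contMDiffAt_snd)
    have h2 : ContDiffAt ℝ ∞ (uncurry ψ) (s, c.toPartialEquiv x) :=
      hψ.contDiffAt ((isOpen_Ioo.prod Metric.isOpen_ball).mem_nhds ⟨h.1, h.2.2⟩)
    exact ((c.contMDiffAt_symm (hψf s h.1 _ h.2.2).1.1).comp (s, x)
      (h2.contMDiffAt.comp (s, x) h1)).contMDiffWithinAt
  · rw [hψ0 _ h.2.2]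
    exact c.left_inv h.2.1
  · obtain ⟨hmem, hd⟩ := hψf s h.1 _ h.2.2
    have h1 : HasMFDerivAt 𝓘(ℝ, ℝ) 𝓘(ℝ, A') (fun s => ψ s (c.toPartialEquiv x)) s
        ((1 : ℝ →L[ℝ] ℝ).smulRight (c.fieldCoord Y (ψ s (c.toPartialEquiv x)))) :=
      hd.hasFDerivAt.hasMFDerivAt
    have h2 := (c.mdifferentiableAt_symm hmem.1).hasMFDerivAt.comp s h1
    -- Pushing the coordinate velocity back through the chart recovers the value of `Y`.
    have h3 : c.tinv (ψ s (c.toPartialEquiv x), c.fieldCoord Y (ψ s (c.toPartialEquiv x))) =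
        ⟨_, Y (c.toPartialEquiv.symm (ψ s (c.toPartialEquiv x)))⟩ := by
      refine Eq.trans (congrArg c.tinv ?_) (c.tinv_tmap (c.map_target hmem.1))
      exact Prod.ext (c.right_inv hmem.1).symm rfl
    have h4 : mfderiv 𝓘(ℝ, A') I c.toPartialEquiv.symm (ψ s (c.toPartialEquiv x))
        (c.fieldCoord Y (ψ s (c.toPartialEquiv x))) =
          Y (c.toPartialEquiv.symm (ψ s (c.toPartialEquiv x))) :=
      eq_of_heq (TotalSpace.mk.inj h3).2
    refine (h2.congr_mfderiv ?_).hasMFDerivWithinAt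
    ext
    change mfderiv 𝓘(ℝ, A') I c.toPartialEquiv.symm (ψ s (c.toPartialEquiv x))
        ((1 : ℝ) • c.fieldCoord Y (ψ s (c.toPartialEquiv x))) =
          (1 : ℝ) • Y (c.toPartialEquiv.symm (ψ s (c.toPartialEquiv x)))
    rw [one_smul, one_smul, h4]

end LocalFlows

/-! ### Basic fields with prescribed values and the converse -/

section Converse

variable {B : Type*} [NormedAddCommGroup B] [NormedSpace ℝ B]
  {M : Type*} [TopologicalSpace M] [ChartedSpace B M] [IsManifold 𝓘(ℝ, B) ∞ M]
  {F : Type*} [NormedAddCommGroup F] [NormedSpace ℝ F]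
  {E : M → Type*} [∀ m, AddCommMonoid (E m)] [∀ m, Module ℝ (E m)]
  [∀ m, TopologicalSpace (E m)] [TopologicalSpace (TotalSpace F E)]
  [FiberBundle F E] [VectorBundle ℝ F E] [ContMDiffVectorBundle ∞ F E 𝓘(ℝ, B)]
  (Hor : EhresmannConnection 𝓘(ℝ, B) F E) {m : M}

/-- Needed where the cut-off vanishes: there `chartBasicField` has to agree with the zero field. -/
theorem verticalLift_zero (a : TotalSpace F E) :
    verticalLift (⟨a, (0 : E a.proj)⟩ : PullbackTotal 𝓘(ℝ, B) F E) = ⟨a, 0⟩ := by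
  have ha := mem_bundleChart_self (B := B) a
  refine (bundleChart B F E a.proj).tmap_injOn (by rw [verticalLift_proj]; exact ha) ha ?_
  rw [tmap_verticalLift ha, pullbackChart_apply ha]
  have h1 : (trivializationAt F E a.proj
      (snd (⟨a, (0 : E a.proj)⟩ : PullbackTotal 𝓘(ℝ, B) F E))).2 = 0 :=
    ((trivializationAt F E a.proj).linear ℝ (mem_bundleChart_source.1 ha).2).map_zero
  rw [h1]
  exact Prod.ext rfl (map_zero (mfderiv (𝓘(ℝ, B).prod 𝓘(ℝ, F)) 𝓘(ℝ, B × F)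
      (bundleChart B F E a.proj).toPartialEquiv a)).symm

theorem tangentMap_proj_verticalLift (p : PullbackTotal 𝓘(ℝ, B) F E) :
    tangentMap (𝓘(ℝ, B).prod 𝓘(ℝ, F)) 𝓘(ℝ, B) (TotalSpace.proj : TotalSpace F E → M)
      (verticalLift p) = ⟨p.proj.proj, 0⟩ := by
  rw [verticalLift, tangentMap_velocity
    ((contMDiffAt_proj E (n := ∞)).mdifferentiableAt (by simp))
    ((EhresmannConnection.contMDiff_addSMul_left p).contMDiffAt.mdifferentiableAt (by simp))]
  refine congrArg (TotalSpace.mk p.proj.proj) ?_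
  change mfderiv 𝓘(ℝ, ℝ) 𝓘(ℝ, B) (fun _ => p.proj.proj) (0 : ℝ) (1 : ℝ) = 0
  rw [mfderiv_const]
  rfl

namespace EhresmannConnection

/-- The base field that is `f • v` in the chart at `m`. -/
def chartField (m : M) (f : M → ℝ) (v : B) (x : M) : TangentSpace 𝓘(ℝ, B) x :=
  (f x • (show B from ((baseChart B m).tinv ((baseChart B m).toPartialEquiv x, v)).2) : B)

/-- The section that is `f • d` in the trivialization at `m`. -/
def chartSection (m : M) (f : M → ℝ) (d : F) (x : M) : E x :=
  f x • (trivializationAt F E m).symm x d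

/-- The basic field with horizontal part `chartField` and vertical part `chartSection`. -/
def chartBasicField (m : M) (f : M → ℝ) (v : B) (d : F) (a : TotalSpace F E) :
    TangentSpace (𝓘(ℝ, B).prod 𝓘(ℝ, F)) a :=
  Hor.lift a (chartField m f v a.proj) +
    (show TangentSpace (𝓘(ℝ, B).prod 𝓘(ℝ, F)) a from (verticalLift (⟨a, chartSection m f d a.proj⟩ :
      PullbackTotal 𝓘(ℝ, B) F E)).2)

variable {f : M → ℝ} {v : B} {d : F}

theorem tmap_chartField {x : M} (hx : x ∈ (baseChart B m).source) :
    (baseChart B m).tmap ⟨x, chartField m f v x⟩ = ((baseChart B m).toPartialEquiv x, f x • v) := by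
  have h1 : (⟨x, (show B from ((baseChart B m).tinv ((baseChart B m).toPartialEquiv x, v)).2)⟩ :
      TangentBundle 𝓘(ℝ, B) M) = (baseChart B m).tinv ((baseChart B m).toPartialEquiv x, v) :=
    TangentBundle.mk_eq ((baseChart B m).left_inv hx)
  have h2 := congrArg (baseChart B m).tmap h1
  rw [(baseChart B m).tmap_tinv ((baseChart B m).map_source hx)] at h2
  refine Prod.ext rfl (Eq.trans (map_smul (mfderiv 𝓘(ℝ, B) 𝓘(ℝ, B)
    (baseChart B m).toPartialEquiv x) (f x) _) ?_)
  exact congrArg (f x • ·) (congrArg Prod.snd h2)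

theorem trivialization_chartSection {x : M} (hx : x ∈ (trivializationAt F E m).baseSet) :
    (trivializationAt F E m ⟨x, chartSection m f d x⟩).2 = f x • d := by
  refine (((trivializationAt F E m).linear ℝ hx).map_smul (f x) _).trans ?_
  exact congrArg (f x • ·) (congrArg Prod.snd ((trivializationAt F E m).apply_mk_symm hx d))

theorem chartBasicField_eq (a : TotalSpace F E) :
    (⟨a, (show B × F from (verticalLift (⟨a, chartSection m f d a.proj⟩ :
      PullbackTotal 𝓘(ℝ, B) F E)).2)⟩ : TangentBundle (𝓘(ℝ, B).prod 𝓘(ℝ, F)) (TotalSpace F E)) =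
      verticalLift ⟨a, chartSection m f d a.proj⟩ :=
  TangentBundle.mk_eq (verticalLift_proj _)

theorem tmap_chartBasicField {a : TotalSpace F E} (ha : a ∈ (bundleChart B F E m).source) :
    (bundleChart B F E m).tmap ⟨a, Hor.chartBasicField m f v d a⟩ =
      ((bundleChart B F E m).toPartialEquiv a, (f a.proj • v,
        Hor.coeff m ((bundleChart B F E m).toPartialEquiv a) (f a.proj • v) + f a.proj • d)) := by
  have hs := mem_bundleChart_source.1 ha
  have h1 := Hor.tmap_lift ha (chartField m f v a.proj)
  rw [tmap_chartField hs.1] at h1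
  have h2 := congrArg (bundleChart B F E m).tmap (chartBasicField_eq (B := B) (F := F) (E := E)
    (m := m) (f := f) (d := d) a)
  rw [tmap_verticalLift ha, pullbackChart_apply ha] at h2
  have h3 : (trivializationAt F E m (snd (⟨a, chartSection m f d a.proj⟩ :
    PullbackTotal 𝓘(ℝ, B) F E))).2 = f a.proj • d := trivialization_chartSection hs.2
  rw [h3] at h2
  refine Prod.ext rfl (((bundleChart B F E m).tmap_add _ _).trans ?_)
  rw [h1, h2]
  exact Prod.ext (add_zero _) rfl

/-- The alternative in `hfU` covers both uses: `f = 1` with `U` inside the chart, and a bump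
function with `U = univ`. Off the support of `f` the field vanishes near the point, so the
meaningless chart values there do no harm. -/
theorem isSmoothFieldOn_chartField {U : Set M} (hf : ContMDiff 𝓘(ℝ, B) 𝓘(ℝ, ℝ) ∞ f)
    (hfU : ∀ x ∈ U, x ∈ (baseChart B m).source ∨ x ∉ tsupport f) :
    IsSmoothFieldOn 𝓘(ℝ, B) U (chartField m f v) := by
  intro x hx
  refine ContMDiffAt.contMDiffWithinAt ?_
  rcases hfU x hx with h | h
  · have hev := (baseChart B m).open_source.mem_nhds h
    have h1 : ContMDiffAt 𝓘(ℝ, B) 𝓘(ℝ, B × B) ∞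
        ((baseChart B m).tmap ∘ fun x => (⟨x, chartField m f v x⟩ : TangentBundle 𝓘(ℝ, B) M)) x := by
      refine ContMDiffAt.congr_of_eventuallyEq (((baseChart B m).contMDiffAt h).prodMk_space
        (hf.contMDiffAt.smul (contMDiffAt_const (c := v)))) ?_
      filter_upwards [hev] with y hy using tmap_chartField hy
    exact (baseChart B m).tangent.contMDiffAt_of_comp
      ((baseChart B m).tangent.continuousAt_of_comp hev h1.continuousAt) h h1
  · refine (Bundle.contMDiff_zeroSection ℝ (TangentSpace 𝓘(ℝ, B) : M → Type _)).contMDiffAt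
      |>.congr_of_eventuallyEq ?_
    filter_upwards [(isClosed_tsupport f).isOpen_compl.mem_nhds h] with y hy
    refine congrArg (TotalSpace.mk y) ?_
    rw [chartField, image_eq_zero_of_notMem_tsupport hy, zero_smul]
    rfl

theorem contMDiffOn_chartSection {U : Set M} (hf : ContMDiff 𝓘(ℝ, B) 𝓘(ℝ, ℝ) ∞ f)
    (hfU : ∀ x ∈ U, (x ∈ (baseChart B m).source ∧ x ∈ (trivializationAt F E m).baseSet) ∨
      x ∉ tsupport f) :
    ContMDiffOn 𝓘(ℝ, B) (𝓘(ℝ, B).prod 𝓘(ℝ, F)) ∞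
      (fun x => (⟨x, chartSection m f d x⟩ : TotalSpace F E)) U := by
  intro x hx
  refine ContMDiffAt.contMDiffWithinAt ?_
  rcases hfU x hx with h | h
  · have hev : ∀ᶠ y in 𝓝 x, y ∈ (baseChart B m).source ∧ y ∈ (trivializationAt F E m).baseSet :=
      Filter.Eventually.and ((baseChart B m).open_source.mem_nhds h.1)
        ((trivializationAt F E m).open_baseSet.mem_nhds h.2)
    have hev' : ∀ᶠ y in 𝓝 x, (⟨y, chartSection m f d y⟩ : TotalSpace F E) ∈
        (bundleChart B F E m).source := hev.mono fun y hy => mem_bundleChart_source.2 hy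
    have h1 : ContMDiffAt 𝓘(ℝ, B) 𝓘(ℝ, B × F) ∞
        ((bundleChart B F E m).toPartialEquiv ∘
          fun x => (⟨x, chartSection m f d x⟩ : TotalSpace F E)) x := by
      refine ContMDiffAt.congr_of_eventuallyEq (((baseChart B m).contMDiffAt h.1).prodMk_space
        (hf.contMDiffAt.smul (contMDiffAt_const (c := d)))) ?_
      filter_upwards [hev] with y hy
      refine (bundleChart_apply (mem_bundleChart_source.2 hy)).trans ?_
      rw [trivialization_chartSection hy.2]
      rfl
    exact (bundleChart B F E m).contMDiffAt_of_comp
      ((bundleChart B F E m).continuousAt_of_comp hev' h1.continuousAt) hev'.self_of_nhds h1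
  · refine (Bundle.contMDiff_zeroSection ℝ E).contMDiffAt.congr_of_eventuallyEq ?_
    filter_upwards [(isClosed_tsupport f).isOpen_compl.mem_nhds h] with y hy
    refine congrArg (TotalSpace.mk y) ?_
    rw [chartSection, image_eq_zero_of_notMem_tsupport hy, zero_smul]

theorem isSmoothFieldOn_chartBasicField {U : Set M} (hf : ContMDiff 𝓘(ℝ, B) 𝓘(ℝ, ℝ) ∞ f)
    (hfU : ∀ x ∈ U, (x ∈ (baseChart B m).source ∧ x ∈ (trivializationAt F E m).baseSet) ∨
      x ∉ tsupport f) :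
    IsSmoothFieldOn (𝓘(ℝ, B).prod 𝓘(ℝ, F)) (TotalSpace.proj ⁻¹' U)
      (Hor.chartBasicField m f v d) := by
  intro a ha
  refine ContMDiffAt.contMDiffWithinAt ?_
  rcases hfU a.proj ha with h | h
  · have has : a ∈ (bundleChart B F E m).source := mem_bundleChart_source.2 h
    have hev := (bundleChart B F E m).open_source.mem_nhds has
    have hfa : ContMDiffAt (𝓘(ℝ, B).prod 𝓘(ℝ, F)) 𝓘(ℝ, ℝ) ∞
        (fun a : TotalSpace F E => f a.proj) a := hf.contMDiffAt.comp a (contMDiffAt_proj E)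
    have hfv : ContMDiffAt (𝓘(ℝ, B).prod 𝓘(ℝ, F)) 𝓘(ℝ, B) ∞
        (fun a : TotalSpace F E => f a.proj • v) a := hfa.smul contMDiffAt_const
    have hfd : ContMDiffAt (𝓘(ℝ, B).prod 𝓘(ℝ, F)) 𝓘(ℝ, F) ∞
        (fun a : TotalSpace F E => f a.proj • d) a := hfa.smul contMDiffAt_const
    have hΓ : ContMDiffAt (𝓘(ℝ, B).prod 𝓘(ℝ, F)) 𝓘(ℝ, B →L[ℝ] F) ∞
        (fun a => Hor.coeff m ((bundleChart B F E m).toPartialEquiv a)) a :=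
      (Hor.contDiffAt_coeff ((bundleChart B F E m).map_source has)).contMDiffAt.comp a
            ((bundleChart B F E m).contMDiffAt has)
    have h1 : ContMDiffAt (𝓘(ℝ, B).prod 𝓘(ℝ, F)) 𝓘(ℝ, (B × F) × (B × F)) ∞
        ((bundleChart B F E m).tmap ∘ fun a => (⟨a, Hor.chartBasicField m f v d a⟩ :
          TangentBundle (𝓘(ℝ, B).prod 𝓘(ℝ, F)) (TotalSpace F E))) a := by
      refine ContMDiffAt.congr_of_eventuallyEq (((bundleChart B F E m).contMDiffAt
        has).prodMk_space (hfv.prodMk_space (ContMDiffAt.add (hΓ.clm_apply hfv) hfd))) ?_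
      filter_upwards [hev] with y hy using Hor.tmap_chartBasicField hy
    exact (bundleChart B F E m).tangent.contMDiffAt_of_comp
      ((bundleChart B F E m).tangent.continuousAt_of_comp hev h1.continuousAt) has h1
  · refine (Bundle.contMDiff_zeroSection ℝ (TangentSpace (𝓘(ℝ, B).prod 𝓘(ℝ, F)) :
      TotalSpace F E → Type _)).contMDiffAt |>.congr_of_eventuallyEq ?_
    filter_upwards [(FiberBundle.continuous_proj F E).continuousAt.preimage_mem_nhds
      ((isClosed_tsupport f).isOpen_compl.mem_nhds h)] with y hy
    have hfy : f y.proj = 0 := image_eq_zero_of_notMem_tsupport hy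
    have h1 := chartBasicField_eq (B := B) (F := F) (E := E) (m := m) (f := f) (d := d) y
    have h2 : (chartSection m f d y.proj : E y.proj) = 0 := by
      rw [chartSection, hfy, zero_smul]
    have h3 : chartField m f v y.proj = 0 := by
      rw [chartField, hfy, zero_smul]
      rfl
    refine Eq.trans (congrArg (TotalSpace.mk y) ?_) (h1.trans ?_)
    · rw [chartBasicField, h3, map_zero, zero_add]
    · rw [h2, verticalLift_zero]
      rfl

theorem isBasicField_chartBasicField {U : Set M} (hf : ContMDiff 𝓘(ℝ, B) 𝓘(ℝ, ℝ) ∞ f)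
    (hfU : ∀ x ∈ U, (x ∈ (baseChart B m).source ∧ x ∈ (trivializationAt F E m).baseSet) ∨
      x ∉ tsupport f) :
    Hor.IsBasicField U (Hor.chartBasicField m f v d) := by
  have hproj : ∀ a : TotalSpace F E, mfderiv (𝓘(ℝ, B).prod 𝓘(ℝ, F)) 𝓘(ℝ, B)
      (TotalSpace.proj : TotalSpace F E → M) a (Hor.chartBasicField m f v d a) =
        chartField m f v a.proj := by
    intro a
    have h1 := tangentMap_proj_verticalLift (B := B) (⟨a, chartSection m f d a.proj⟩ :
      PullbackTotal 𝓘(ℝ, B) F E)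
    rw [← chartBasicField_eq] at h1
    have h2 := eq_of_heq (TotalSpace.mk.inj h1).2
    rw [chartBasicField]
    refine (map_add _ _ _).trans ?_
    rw [Hor.proj_lift]
    exact (congrArg (chartField m f v a.proj + ·) h2).trans (add_zero _)
  refine ⟨Hor.isSmoothFieldOn_chartBasicField hf hfU, ⟨chartField m f v,
    isSmoothFieldOn_chartField hf fun x hx => (hfU x hx).imp And.left id, fun a _ => hproj a⟩,
    chartSection m f d, contMDiffOn_chartSection hf hfU, fun a _ => ?_⟩
  refine Eq.trans (congrArg (TotalSpace.mk a) ?_) (chartBasicField_eq a)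
  rw [horPart, hproj, chartBasicField]
  exact add_sub_cancel_left _ _

/-- Every vector tangent to the total space is the value of a basic field. -/
theorem exists_isBasicField_apply_eq {U : Set M} {a : TotalSpace F E}
    (hf : ContMDiff 𝓘(ℝ, B) 𝓘(ℝ, ℝ) ∞ f) (hfa : f a.proj = 1)
    (hfU : ∀ x ∈ U, (x ∈ (baseChart B a.proj).source ∧
      x ∈ (trivializationAt F E a.proj).baseSet) ∨ x ∉ tsupport f)
    (w : TangentSpace (𝓘(ℝ, B).prod 𝓘(ℝ, F)) a) :
    ∃ Y, Hor.IsBasicField U Y ∧ Y a = w := by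
  have ha := mem_bundleChart_self (B := B) a
  -- The base component of `w` is taken as `v`; the vertical part is what remains of `w` after
  -- subtracting `Γ v`.
  refine ⟨Hor.chartBasicField a.proj f ((bundleChart B F E a.proj).tmap ⟨a, w⟩).2.1
    (((bundleChart B F E a.proj).tmap ⟨a, w⟩).2.2 - Hor.coeff a.proj
      ((bundleChart B F E a.proj).toPartialEquiv a) ((bundleChart B F E a.proj).tmap ⟨a, w⟩).2.1),
    Hor.isBasicField_chartBasicField hf hfU, ?_⟩
  have h1 := Hor.tmap_chartBasicField (f := f)
    (v := ((bundleChart B F E a.proj).tmap ⟨a, w⟩).2.1)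
    (d := (((bundleChart B F E a.proj).tmap ⟨a, w⟩).2.2 - Hor.coeff a.proj
      ((bundleChart B F E a.proj).toPartialEquiv a)
        ((bundleChart B F E a.proj).tmap ⟨a, w⟩).2.1)) ha
  rw [hfa, one_smul, one_smul, add_sub_cancel] at h1
  have h2 := (bundleChart B F E a.proj).tmap_injOn (z' := ⟨a, w⟩) ha ha h1
  exact eq_of_heq (TotalSpace.mk.inj h2).2

/-- A horizontal vector is the lift of its own projection, for each of the two connections. -/
theorem lift_eq_of_mem_horizontal
    {Hor₁ Hor₂ : EhresmannConnection (𝓘(ℝ, B).prod 𝓘(ℝ, F)) F (PullbackFibre 𝓘(ℝ, B) F E)}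
    {z : TangentBundle ((𝓘(ℝ, B).prod 𝓘(ℝ, F)).prod 𝓘(ℝ, F)) (PullbackTotal 𝓘(ℝ, B) F E)}
    (h₁ : z ∈ Hor₁.horizontal) (h₂ : z ∈ Hor₂.horizontal) {p : PullbackTotal 𝓘(ℝ, B) F E}
    {w : TangentSpace (𝓘(ℝ, B).prod 𝓘(ℝ, F)) p.proj} (hp : z.proj = p)
    (hw : tangentMap ((𝓘(ℝ, B).prod 𝓘(ℝ, F)).prod 𝓘(ℝ, F)) (𝓘(ℝ, B).prod 𝓘(ℝ, F))
      (TotalSpace.proj : PullbackTotal 𝓘(ℝ, B) F E → TotalSpace F E) z = ⟨p.proj, w⟩) :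
    Hor₁.lift p w = Hor₂.lift p w := by
  subst hp
  obtain ⟨v₁, hv₁⟩ := h₁
  obtain ⟨v₂, hv₂⟩ := h₂
  have h := eq_of_heq (TotalSpace.mk.inj hw).2
  have e₁ : v₁ = w := by rw [← Hor₁.proj_lift z.proj v₁, ← hv₁]; exact h
  have e₂ : v₂ = w := by rw [← Hor₂.proj_lift z.proj v₂, ← hv₂]; exact h
  rw [← e₁, ← hv₁, hv₂, e₂, e₁]

variable {Hor} {Hor' : EhresmannConnection (𝓘(ℝ, B).prod 𝓘(ℝ, F)) F (PullbackFibre 𝓘(ℝ, B) F E)}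

theorem IsLinearization.of_lift_eq (h : ∀ p w, Hor'.lift p w = Hor.linearization.lift p w) :
    Hor.IsLinearization Hor' := by
  have e : Hor' = Hor.linearization :=
    EhresmannConnection.ext (funext fun p => ContinuousLinearMap.ext (h p))
  rw [e]
  exact Hor.isLinearization_linearization

-- Completeness of the model spaces enters through the existence of local flows.
variable [CompleteSpace B] [CompleteSpace F]

/-- Only the velocity of `s ↦ 𝓕φ_s(a, b)` at `s = 0` is used: it is horizontal for both connections
and lies over `Y(a) = w`. -/
theorem TransportsByFlows.lift_eq {U : Set M} (h : Hor.TransportsByFlows Hor' U)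
    (hU : IsOpen U) {p : PullbackTotal 𝓘(ℝ, B) F E} (hpU : p.proj.proj ∈ U)
    (hf : ContMDiff 𝓘(ℝ, B) 𝓘(ℝ, ℝ) ∞ f) (hfp : f p.proj.proj = 1)
    (hfU : ∀ x ∈ U, (x ∈ (baseChart B p.proj.proj).source ∧
      x ∈ (trivializationAt F E p.proj.proj).baseSet) ∨ x ∉ tsupport f)
    (w : TangentSpace (𝓘(ℝ, B).prod 𝓘(ℝ, F)) p.proj) :
    Hor'.lift p w = Hor.linearization.lift p w := by
  obtain ⟨Y, hY, rfl⟩ := Hor.exists_isBasicField_apply_eq hf hfp hfU w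
  obtain ⟨D, φ, h0, hflow⟩ := (bundleChart B F E p.proj.proj).exists_isLocalFlow
    (hU.preimage (FiberBundle.continuous_proj F E)) hY.1 (mem_bundleChart_self p.proj) hpU
  have hφ0 := hflow.map_zero p.proj h0
  obtain ⟨hT0, ⟨hproj, hsm, h1⟩, -⟩ := h Y hY D φ hflow p.proj h0 p hφ0.symm
  obtain ⟨-, ⟨-, -, h2⟩, -⟩ := Hor.isLinearization_linearization.transportsByFlows hU Y hY D φ
    hflow p.proj h0 p hφ0.symm
  have hJ := (hflow.isOpen_times p.proj).mem_nhds h0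
  refine lift_eq_of_mem_horizontal (h1 0 h0) (h2 0 h0) hT0 ?_
  refine (tangentMap_velocity ((contMDiffAt_proj _ (n := ∞)).mdifferentiableAt (by simp))
    ((hsm.contMDiffAt hJ).mdifferentiableAt (by simp))).trans ?_
  refine (velocity_congr (Filter.mem_of_superset hJ hproj)).trans ?_
  rw [hflow.velocity_eq h0, hφ0]

theorem IsLinearization.of_transportsByFlows
    (h : ∀ U : Set M, IsOpen U → Hor.TransportsByFlows Hor' U) : Hor.IsLinearization Hor' := by
  refine IsLinearization.of_lift_eq fun p w => ?_
  have hU : IsOpen ((baseChart B p.proj.proj).source ∩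
      (trivializationAt F E p.proj.proj).baseSet) :=
    (baseChart B p.proj.proj).open_source.inter (trivializationAt F E p.proj.proj).open_baseSet
  -- On the chart domain itself the constant cut-off `1` suffices.
  exact (h _ hU).lift_eq hU (mem_bundleChart_source.1 (mem_bundleChart_self p.proj))
    (contMDiff_const (c := (1 : ℝ))) rfl (fun x hx => Or.inl hx) w

theorem IsLinearization.of_transportsByFlows_univ (hM : AdmitsSmoothBumps 𝓘(ℝ, B) M)
    (h : Hor.TransportsByFlows Hor' univ) : Hor.IsLinearization Hor' := by
  refine IsLinearization.of_lift_eq fun p w => ?_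
  have hU : IsOpen ((baseChart B p.proj.proj).source ∩
      (trivializationAt F E p.proj.proj).baseSet) :=
    (baseChart B p.proj.proj).open_source.inter (trivializationAt F E p.proj.proj).open_baseSet
  obtain ⟨f, hf, hfp, hfU⟩ := hM p.proj.proj _
    (hU.mem_nhds (mem_bundleChart_source.1 (mem_bundleChart_self p.proj)))
  -- The bump is supported in the chart domain, so each point lies in that domain or off the
  -- support.
  exact h.lift_eq isOpen_univ (mem_univ _) hf hfp
    (fun x _ => (em (x ∈ tsupport f)).imp (fun hx => hfU hx) id) w

end EhresmannConnection

end Converse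

end

theorem theorem6p5
    {B : Type*} [NormedAddCommGroup B] [NormedSpace ℝ B] [CompleteSpace B]
    {M : Type*} [TopologicalSpace M] [ChartedSpace B M] [IsManifold 𝓘(ℝ, B) ∞ M]
    {F : Type*} [NormedAddCommGroup F] [NormedSpace ℝ F] [CompleteSpace F]
    {E : M → Type*} [∀ m, AddCommMonoid (E m)] [∀ m, Module ℝ (E m)]
    [∀ m, TopologicalSpace (E m)] [TopologicalSpace (TotalSpace F E)]
    [FiberBundle F E] [VectorBundle ℝ F E] [ContMDiffVectorBundle ∞ F E 𝓘(ℝ, B)]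
    (Hor : EhresmannConnection 𝓘(ℝ, B) F E) :
    -- the linearization exists and is unique
    (∃! Hor' : EhresmannConnection (𝓘(ℝ, B).prod 𝓘(ℝ, F)) F (PullbackFibre 𝓘(ℝ, B) F E),
      Hor.IsLinearization Hor') ∧
    ∀ Hor' : EhresmannConnection (𝓘(ℝ, B).prod 𝓘(ℝ, F)) F (PullbackFibre 𝓘(ℝ, B) F E),
      -- parallel transport of the linearization along flow lines of basic fields
      (Hor.IsLinearization Hor' → ∀ U : Set M, IsOpen U → Hor.TransportsByFlows Hor' U) ∧
      -- the converse
      ((∀ U : Set M, IsOpen U → Hor.TransportsByFlows Hor' U) → Hor.IsLinearization Hor') ∧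
      -- the converse for global vector fields only
      (AdmitsSmoothBumps 𝓘(ℝ, B) M → Hor.TransportsByFlows Hor' univ →
        Hor.IsLinearization Hor') :=
  ⟨⟨Hor.linearization, Hor.isLinearization_linearization, fun _ h => h.eq_linearization⟩,
    fun _ => ⟨fun h _ hU => h.transportsByFlows hU,
      EhresmannConnection.IsLinearization.of_transportsByFlows,
      EhresmannConnection.IsLinearization.of_transportsByFlows_univ⟩⟩
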